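/- Identify $\mathbb{R}^4=\mathbb{C}^2$ and $\mathbb{R}^3=\mathbb{R}\oplus\mathbb{C}$, let $\eta(z_1,z_2)=(|z_1|^2-|z_2|^2,\,2z_1\bar z_2)$ be the Hopf map, and let $u:\mathbb{R}^4\to\mathbb{R}^3$, $u(x)=\frac{\sqrt5}{2}|x|\,\eta(x/|x|)$, $u(0)=0$. The graph $\mathbf{C}\subset\mathbb{R}^7$ of $u$ is the Lawson–Osserman cone, and $M=\mathbf{C}\cap\mathbb{S}^6$ is its link, a closed $3$-dimensional minimal submanifold of the unit sphere $\mathbb{S}^6$. For a submanifold $S$ of a Riemannian manifold $A$ (here $M$ in $\mathbb{S}^6$, or $\mathbf{C}\setminus\{0\}$ in $\mathbb{R}^7$), with normal Laplacian $\Delta^\perp$, second fundamental form $B$, curvature tensor $R$ of $A$ (with the sign for which $R(X,Y)Z=\langle Y,Z\rangle X-\langle X,Z\rangle Y$ on the unit sphere) and a local orthonormal tangent frame $(e_i)$ of $S$, the Jacobi operator on smooth normal fields is $$\mathcal{J}_S Y=\Delta^\perp Y+\sum_{i,j}\langle B(e_i,e_j),Y\rangle B(e_i,e_j)+\Big(\sum_i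 R(Y,e_i)e_i\Big)^{N},$$ where $(\cdot)^N$ is the orthogonal projection to the normal bundle of $S$ in $A$. A smooth normal field $Y$ is a Jacobi field if $\mathcal{J}_SY=0$; a real number $\lambda$ is an eigenvalue of $\mathcal{J}_S$ if $\mathcal{J}_SY=-\lambda Y$ for some smooth normal field $Y\neq0$, and its multiplicity is the dimension of the space of all such $Y$ together with $0$. Then the following hold. 1. The Jacobi fields on $M$ in $\mathbb{S}^6$ are exactly the Killing Jacobi fields $p\mapsto (Tp)^N$ with $T\in\mathfrak{so}(7)$. 2. The cone $\mathbf{C}$ is integrable in Simon's sense (‡): every Jacobi field on $\mathbf{C}\setminus\{0\}$ in $\mathbb{R}^7$ that is homogeneous of degree $1$, i.e. $Z(tp)=tZ(p)$ for $t>0$, is the normal projection $p\mapsto(Tp)^N$ of an infinitesimal rotation, $T\in\mathfrak{so}(7)$, and every one that is homogeneous of degree $0$, i.e. $Z(tp)=Z(p)$ for $t>0$, is the normal projection $p\mapsto v^N$ of an infinitesimal translation, $v\in\mathbb{R}^7$. 3. The nonpositive eigenvalues of $\mathcal{J}_M$ are exactly $-\frac{15}{4}$, $-3$ and $0$, with multiplicities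 $1$, $7$ and $17$. The eigenspace of $-\frac{15}{4}$ is spanned by the unit normal field $$e_4=\Big(\tfrac{\sqrt5}{2}z_1,\ \tfrac{\sqrt5}{2}z_2,\ -\tfrac32\big(|z_1|^2-|z_2|^2\big),\ -3z_1\bar z_2\Big)$$ at the point of $M$ whose $\mathbb{C}^2$-component is $(z_1,z_2)$. The eigenspace of $-3$ is the space of the normal projections $p\mapsto v^N$ of constant vectors $v\in\mathbb{R}^7$. 4. Hence the Morse index of $M$ (the number of negative eigenvalues of $\mathcal{J}_M$, counted with multiplicity) is $8$, and its nullity (the dimension of the space of Jacobi fields) is $17$. -/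

import Mathlib

open scoped ContDiff Matrix

noncomputable section

namespace LawsonOsserman

/-! ### Submanifolds of a Euclidean space

All manifolds below are smooth embedded submanifolds of a Euclidean space `E`, given as subsets.
`S` is the submanifold under study and `A` (a round sphere, or all of `E`) is the ambient manifold,
`S ⊆ A ⊆ E`.  A vector field along `S` is a function `E → E` of which only the values on `S` are
used.  `fderivWithin ℝ Y S p v`, for `v` tangent to `S` at `p`, is the derivative of `Y` at `p` in
the direction `v`, i.e. the flat connection of `E` differentiating along `S`. -/

variable {E : Type*} [NormedAddCommGroup E] [InnerProductSpace ℝ E] [FiniteDimensional ℝ E]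

/-- The tangent space of `S` at `p`: velocities of smooth curves in `S` through `p`
(for a submanifold these velocities already form a linear subspace). -/
def tangentSpace (S : Set E) (p : E) : Submodule ℝ E :=
  Submodule.span ℝ
    {v | ∃ γ : ℝ → E, ContDiff ℝ ∞ γ ∧ (∀ t, γ t ∈ S) ∧ γ 0 = p ∧ deriv γ 0 = v}

/-- The normal space of `S` in `A` at `p`. -/
def normalSpace (A S : Set E) (p : E) : Submodule ℝ E :=
  tangentSpace A p ⊓ (tangentSpace S p)ᗮ

/-- Orthogonal projection `(·)ᵀ` of `E` onto the tangent space of `S` at `p`. -/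
def tanProj (S : Set E) (p : E) : E →L[ℝ] E := (tangentSpace S p).starProjection

/-- Orthogonal projection `(·)ᴺ` of `E` onto the normal space of `S` in `A` at `p`. -/
def norProj (A S : Set E) (p : E) : E →L[ℝ] E := (normalSpace A S p).starProjection

/-- The tangent vector field `q ↦ wᵀ` on `S`. If `w` is tangent to `S` at `p`, it is a smooth
extension of `w` to a tangent field. -/
def tanExt (S : Set E) (w : E) : E → E := fun q => tanProj S q w

/-- `∇_X Y = (D_X Y)ᵀ`, the Levi-Civita connection of `A`, applied to a field `X` tangent to `S`
and a field `Y` along `S` that is tangent to `A`. For `A = S` it is the Levi-Civita connection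
of `S`. -/
def conn (A S : Set E) (X Y : E → E) : E → E :=
  fun p => tanProj A p (fderivWithin ℝ Y S p (X p))

/-- The normal connection `∇^⊥_X Y = (∇_X Y)ᴺ` of `S` in `A`. -/
def normalConn (A S : Set E) (X Y : E → E) : E → E :=
  fun p => norProj A S p (conn A S X Y p)

/-- The second fundamental form `B(v, w) = (∇_V W)ᴺ` of `S` in `A` at `p`; `V`, `W` are tangent
fields extending `v`, `w`. -/
def secondFundForm (A S : Set E) (p v w : E) : E :=
  normalConn A S (tanExt S v) (tanExt S w) p

/-- An orthonormal basis `e₁, …, eₙ` of the tangent space of `S` at `p`. -/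
def tanFrame (S : Set E) (p : E) (i : Fin (Module.finrank ℝ (tangentSpace S p))) : E :=
  (stdOrthonormalBasis ℝ (tangentSpace S p) i : E)

/-- The normal Laplacian `Δ^⊥ Y = ∑ᵢ (∇^⊥_{eᵢ} ∇^⊥_{eᵢ} Y - ∇^⊥_{∇^S_{eᵢ} eᵢ} Y)`, the trace of the
second covariant derivative of `Y`. -/
def normalLaplacian (A S : Set E) (Y : E → E) (p : E) : E :=
  ∑ i, (normalConn A S (tanExt S (tanFrame S p i)) (normalConn A S (tanExt S (tanFrame S p i)) Y) p
    - normalConn A S (conn S S (tanExt S (tanFrame S p i)) (tanExt S (tanFrame S p i))) Y p)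

/-- Simons' operator `B̃(y) = ∑ᵢⱼ ⟨B(eᵢ, eⱼ), y⟩ B(eᵢ, eⱼ)`. -/
def simonsOp (A S : Set E) (p y : E) : E :=
  ∑ i, ∑ j, inner ℝ (secondFundForm A S p (tanFrame S p i) (tanFrame S p j)) y •
    secondFundForm A S p (tanFrame S p i) (tanFrame S p j)

/-- The Riemann tensor `R(x, y) z = ∇_X ∇_Y Z - ∇_Y ∇_X Z - ∇_{[X, Y]} Z` of `A` at `p`. -/
def curvature (A : Set E) (p x y z : E) : E :=
  conn A A (tanExt A x) (conn A A (tanExt A y) (tanExt A z)) p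
    - conn A A (tanExt A y) (conn A A (tanExt A x) (tanExt A z)) p
    - conn A A (fun q => fderivWithin ℝ (tanExt A y) A q (tanExt A x q)
        - fderivWithin ℝ (tanExt A x) A q (tanExt A y q)) (tanExt A z) p

/-- The curvature term `R̃(y) = (∑ᵢ R(y, eᵢ) eᵢ)ᴺ`. -/
def curvatureOp (A S : Set E) (p y : E) : E :=
  norProj A S p (∑ i, curvature A p y (tanFrame S p i) (tanFrame S p i))

/-- The Jacobi operator `J Y = Δ^⊥ Y + B̃(Y) + R̃(Y)` of `S` in `A`. -/
def jacobiOp (A S : Set E) (Y : E → E) (p : E) : E :=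
  normalLaplacian A S Y p + simonsOp A S p (Y p) + curvatureOp A S p (Y p)

/-- The space `Γ(NS)` of smooth normal fields on `S` in `A`. A field on `S` is represented by its
extension by zero to `E`, so that distinct elements are distinct fields on `S`. -/
def normalFields (A S : Set E) : Submodule ℝ (E → E) where
  carrier := {Y | ContDiffOn ℝ ∞ Y S ∧ (∀ p ∈ S, Y p ∈ normalSpace A S p) ∧ ∀ p ∉ S, Y p = 0}
  zero_mem' := ⟨contDiffOn_const, fun _ _ => Submodule.zero_mem _, fun _ _ => rfl⟩
  add_mem' := fun {X Y} hX hY =>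
    ⟨hX.1.add hY.1, fun p hp => Submodule.add_mem _ (hX.2.1 p hp) (hY.2.1 p hp),
      fun p hp => by simp [hX.2.2 p hp, hY.2.2 p hp]⟩
  smul_mem' := fun c X hX =>
    ⟨hX.1.const_smul c, fun p hp => Submodule.smul_mem _ c (hX.2.1 p hp),
      fun p hp => by simp [hX.2.2 p hp]⟩

/-- A Jacobi field: a smooth normal field `Y` with `J Y = 0`. -/
def IsJacobiField (A S : Set E) (Y : E → E) : Prop :=
  Y ∈ normalFields A S ∧ ∀ p ∈ S, jacobiOp A S Y p = 0

/-- `Y` is a smooth normal field with `J Y = -μ Y` (possibly `Y = 0`). -/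
def IsEigenfield (A S : Set E) (μ : ℝ) (Y : E → E) : Prop :=
  Y ∈ normalFields A S ∧ ∀ p ∈ S, jacobiOp A S Y p = -μ • Y p

/-- `μ` is an eigenvalue of the Jacobi operator: `J Y = -μ Y` for some `Y ≠ 0`. -/
def IsEigenvalue (A S : Set E) (μ : ℝ) : Prop :=
  ∃ Y, IsEigenfield A S μ Y ∧ Y ≠ 0

/-- The multiplicity of `μ`: the dimension of the space of all `Y` with `J Y = -μ Y`. -/
def jacobiMultiplicity (A S : Set E) (μ : ℝ) : ℕ :=
  Module.finrank ℝ (Submodule.span ℝ {Y | IsEigenfield A S μ Y})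

/-- The Morse index: the number of negative eigenvalues counted with multiplicity, i.e. the
dimension of the sum of all eigenspaces with negative eigenvalue. -/
def morseIndex (A S : Set E) : ℕ :=
  Module.finrank ℝ (Submodule.span ℝ {Y | ∃ μ < 0, IsEigenfield A S μ Y})

/-- The nullity: the dimension of the space of Jacobi fields. -/
def nullity (A S : Set E) : ℕ :=
  Module.finrank ℝ (Submodule.span ℝ {Y | IsJacobiField A S Y})

/-- Normal projections `p ↦ vᴺ` of constant vector fields (infinitesimal translations). -/
def translationFields (A S : Set E) : Set (E → E) :=
  {Y | ∃ v : E, Y = S.indicator fun p => norProj A S p v}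

/-- The Euclidean space `ℝᵐ`. -/
abbrev Euc (m : ℕ) : Type := EuclideanSpace ℝ (Fin m)

/-- Normal projections `p ↦ (T p)ᴺ` of infinitesimal rotations, `T ∈ so(m)`. For `A` the unit
sphere, `p ↦ T p` are the Killing fields of `A` and these are the Killing Jacobi fields on `S`. -/
def rotationFields {m : ℕ} (A S : Set (Euc m)) : Set (Euc m → Euc m) :=
  {Y | ∃ T ∈ LieAlgebra.Orthogonal.so (Fin m) ℝ,
    Y = S.indicator fun p => norProj A S p (WithLp.toLp 2 (T *ᵥ p.ofLp))}

/-- `Z` is homogeneous of degree `k` on the regular part `C \ {0}` of the cone `C`. -/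
def IsHomogeneousField (C : Set E) (k : ℕ) (Z : E → E) : Prop :=
  ∀ p ∈ C \ {0}, ∀ t : ℝ, 0 < t → Z (t • p) = t ^ k • Z p

/-- Integrability of a minimal cone `C ⊆ ℝᵐ` with isolated singularity at `0`: all Jacobi fields
on `C` that are homogeneous of degree 1 and 0 are generated by rotations, respectively
translations, of `ℝᵐ`. -/
def IsIntegrableCone {m : ℕ} (C : Set (Euc m)) : Prop :=
  ∀ Z : Euc m → Euc m, IsJacobiField Set.univ (C \ {0}) Z →
    (IsHomogeneousField C 1 Z → Z ∈ rotationFields Set.univ (C \ {0})) ∧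
    (IsHomogeneousField C 0 Z → Z ∈ translationFields Set.univ (C \ {0}))

/-! ### The Lawson–Osserman cone -/

/-- The Hopf map `(z₁, z₂) ↦ (|z₁|² - |z₂|², 2 z₁ z̄₂)`, `ℂ² = ℝ⁴` and `ℝ ⊕ ℂ = ℝ³`. -/
def hopf (x : Euc 4) : Euc 3 :=
  let z₁ : ℂ := ⟨x 0, x 1⟩
  let z₂ : ℂ := ⟨x 2, x 3⟩
  let w : ℂ := 2 * z₁ * star z₂
  !₂[‖z₁‖ ^ 2 - ‖z₂‖ ^ 2, w.re, w.im]

/-- `u(x) = (√5 / 2) |x| η(x / |x|)`, and `u(0) = 0`. -/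
def loFun (x : Euc 4) : Euc 3 := (√5 / 2 * ‖x‖) • hopf (‖x‖⁻¹ • x)

/-- The Lawson–Osserman cone: the graph of `u` in `ℝ⁷ = ℝ⁴ × ℝ³`. -/
def loCone : Set (Euc 7) :=
  Set.range fun x : Euc 4 => !₂[x 0, x 1, x 2, x 3, loFun x 0, loFun x 1, loFun x 2]

/-- The unit sphere `𝕊⁶ ⊆ ℝ⁷`. -/
def sphere6 : Set (Euc 7) := Metric.sphere 0 1

/-- The link of the Lawson–Osserman cone. -/
def loLink : Set (Euc 7) := loCone ∩ sphere6

/-- The unit normal field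
`e₄ = ((√5/2) z₁, (√5/2) z₂, -(3/2)(|z₁|² - |z₂|²), -3 z₁ z̄₂)` on the link. -/
def e4 : Euc 7 → Euc 7 :=
  loLink.indicator fun p =>
    let z₁ : ℂ := ⟨p 0, p 1⟩
    let z₂ : ℂ := ⟨p 2, p 3⟩
    let w : ℂ := -3 * z₁ * star z₂
    !₂[√5 / 2 * p 0, √5 / 2 * p 1, √5 / 2 * p 2, √5 / 2 * p 3,
      -(3 / 2) * (‖z₁‖ ^ 2 - ‖z₂‖ ^ 2), w.re, w.im]

end LawsonOsserman

end

open LawsonOsserman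

/-!
The link `M` is the orbit of a point under `SU(2)`, and is parametrized by `x ∈ 𝕊³`. Along it
there is an orthogonal frame `frame 0, …, frame 6` of `ℝ⁷` that is equivariant under `SU(2)`: the
position vector, three tangent fields and three normal fields. The three vector fields `vf i` on
`𝕊³` commute with `SU(2)` as well, so the derivatives of the frame along them have *constant*
coefficients (`fderiv_frame`). Hence, in terms of the coefficients `a = (a 0, a 1, a 2)` of a
normal field, the Jacobi operator of the link becomes the constant-coefficient operator `jop`
(`jacobiOp_link`), and on fields homogeneous of degree `d` the Jacobi operator of the cone is
`jop + d (d - 1) + 3 d - 3` (`jacobiOp_cone`). So everything, including the integrability of the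
cone, is a statement about the solutions of `jop a = ν a` with `ν ≥ 0`.

These are found by Fourier analysis. For a complex linear form `ℓ = α z₁ + β z₂` let `ℓ'` be its
derivative along the first vector field. The functions `ℓᵖ ℓ'^q` are total in `C(𝕊³, ℂ)`
(`monoSpan_eq_top`), and the vector fields, which are divergence free, only shift `(p, q)` to
`(p ∓ 1, q ± 1)`. Thus the Fourier coefficients of `a 0` and of `a 1 ± i a 2` satisfy a `3 × 3`
linear system for each `(p, q)` (`coef_system_coupled`), with determinant

  `R ((R - 9/2) (R + 3/2) + 9/4 ν)`,  `R = Λ - 3 + ν`,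

up to sign, where `Λ = Lam p q` is the eigenvalue of the scalar Laplacian (`coupled_det`). It is
positive for `Λ ≥ 9`, which leaves six pairs `(p, q)` with `Λ ∈ {0, 3, 15/2}` (`nine_le_Lam`). For
these the system is singular only if `ν = 15/4`, `3` or `0`. Then the solutions known beforehand
account for the kernel: multiples of `e₄` (`jop_axisCoef`), normal projections of constant vectors
(`jop_transCoef`) and of infinitesimal rotations (`jop_rotCoef`). Orthogonality to these gives
the linear relations between Fourier coefficients that are missing in the singular cases, so an
eigenfield orthogonal to them vanishes (`eq_zero_of_perp`). Subtracting an `L²`-projection onto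
the finite-dimensional space of known solutions classifies the eigenfields (`exists_axis`,
`exists_translation`, `exists_rotation`).

For the multiplicities, no nonzero translation projects to a multiple of `e₄`,
whence `1 + 7 = 8`. The
algebra `so(7)`, of dimension `21`, is the sum of the symmetry algebra `u(2)` of the link, which
consists of rotations tangent to the link (`nor_symMat`), and a complement of dimension `17` that
acts faithfully (`rotMat_injective`).
-/

set_option linter.unusedSectionVars false

noncomputable section

namespace LawsonOsserman

/-! ### Derivatives along a submanifold -/

section Abstract

variable {E : Type*} [NormedAddCommGroup E] [InnerProductSpace ℝ E] [FiniteDimensional ℝ E]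

/-- `fderivWithin` picks one of several linear maps when `S` is too thin for uniqueness, but
its values on tangent vectors do not depend on the choice. -/
theorem fderivWithin_eq_of_mem_tangentSpace {S : Set E} {Y : E → E} {L : E →L[ℝ] E} {p v : E}
    (h : HasFDerivWithinAt Y L S p) (hv : v ∈ tangentSpace S p) :
    fderivWithin ℝ Y S p v = L v := by
  have h' : HasFDerivWithinAt Y (fderivWithin ℝ Y S p) S p :=
    h.differentiableWithinAt.hasFDerivWithinAt
  induction hv using Submodule.span_induction with
  | mem v hv =>
    obtain ⟨γ, hγ, hS, h0, rfl⟩ := hv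
    have hd : HasDerivAt γ (deriv γ 0) 0 := (hγ.differentiable (by simp) 0).hasDerivAt
    subst h0
    have e1 : HasDerivAt (Y ∘ γ) (L (deriv γ 0)) 0 := by
      have := h.comp_hasDerivWithinAt (s := Set.univ) 0 hd.hasDerivWithinAt (fun t _ => hS t)
      simpa using this
    have e2 : HasDerivAt (Y ∘ γ) (fderivWithin ℝ Y S (γ 0) (deriv γ 0)) 0 := by
      have := h'.comp_hasDerivWithinAt (s := Set.univ) 0 hd.hasDerivWithinAt (fun t _ => hS t)
      simpa using this
    exact e2.unique e1
  | zero => simp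
  | add x y _ _ hx hy => simp [hx, hy]
  | smul c x _ hx => simp [hx]

theorem fderivWithin_eq_of_eqOn {S : Set E} {Y g : E → E} {L : E →L[ℝ] E} {p v : E}
    (hYg : Set.EqOn Y g S) (hp : p ∈ S) (h : HasFDerivAt g L p) (hv : v ∈ tangentSpace S p) :
    fderivWithin ℝ Y S p v = L v :=
  fderivWithin_eq_of_mem_tangentSpace (h.hasFDerivWithinAt.congr hYg (hYg hp)) hv

theorem normalSpace_le (A S : Set E) (p : E) : normalSpace A S p ≤ tangentSpace A p :=
  inf_le_left

theorem norProj_tanProj (A S : Set E) (p w : E) :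
    norProj A S p (tanProj A p w) = norProj A S p w := by
  have := Submodule.starProjection_comp_starProjection_of_le (normalSpace_le A S p)
  exact congrArg (fun L => L w) this

theorem normalConn_apply (A S : Set E) (X Y : E → E) (p : E) :
    normalConn A S X Y p = norProj A S p (fderivWithin ℝ Y S p (X p)) :=
  norProj_tanProj A S p _

theorem norProj_of_mem_tangentSpace {A S : Set E} {p w : E} (hw : w ∈ tangentSpace S p) :
    norProj A S p w = 0 := by
  rw [norProj, Submodule.starProjection_apply_eq_zero_iff, Submodule.mem_orthogonal']
  intro u hu
  exact hu.2 w hw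

theorem norProj_of_mem_normalSpace {A S : Set E} {p w : E} (hw : w ∈ normalSpace A S p) :
    norProj A S p w = w :=
  Submodule.starProjection_eq_self_iff.2 hw

theorem norProj_mem (A S : Set E) (p w : E) : norProj A S p w ∈ normalSpace A S p :=
  Submodule.starProjection_apply_mem _ _

/-- Orthogonal projection onto the span of an orthogonal family. -/
theorem starProjection_span_range {ι : Type*} [Fintype ι] [DecidableEq ι] (t : ι → E) (n : ι → ℝ)
    (hn : ∀ i, n i ≠ 0) (ht : ∀ i j, inner ℝ (t i) (t j) = if i = j then n i else 0) (w : E) :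
    (Submodule.span ℝ (Set.range t)).starProjection w
      = ∑ i, ((n i)⁻¹ * inner ℝ (t i) w) • t i := by
  refine Submodule.eq_starProjection_of_mem_orthogonal
    (Submodule.sum_mem _ fun i _ => Submodule.smul_mem _ _ (Submodule.subset_span ⟨i, rfl⟩)) ?_
  rw [Submodule.mem_orthogonal]
  intro u hu
  induction hu using Submodule.span_induction with
  | mem v hv =>
    obtain ⟨j, rfl⟩ := hv
    simp only [inner_sub_right, inner_sum, inner_smul_right, ht, mul_ite, mul_zero,
      Finset.sum_ite_eq, Finset.mem_univ, if_true]
    have := hn j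
    field_simp
    ring
  | zero => simp
  | add x y _ _ hx hy => simp [inner_add_left, hx, hy]
  | smul c x _ hx => simp [inner_smul_left, hx]

/-! ### The Jacobi operator in a moving orthogonal frame -/

/-- A differentiable frame field `τ` of the tangent bundle of `S`, orthogonal, with constant
squared lengths `n`. -/
structure IsOrthoFrame {ι : Type*} [DecidableEq ι] (S : Set E) (τ : ι → E → E)
    (n : ι → ℝ) : Prop where
  span_eq : ∀ q ∈ S, tangentSpace S q = Submodule.span ℝ (Set.range fun i => τ i q)
  inner_eq : ∀ q ∈ S, ∀ i j, inner ℝ (τ i q) (τ j q) = if i = j then n i else 0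
  ne_zero : ∀ i, n i ≠ 0
  diff : ∀ i, ∀ q ∈ S, DifferentiableWithinAt ℝ (τ i) S q

namespace IsOrthoFrame

variable {ι : Type*} [Fintype ι] [DecidableEq ι] {S : Set E} {τ : ι → E → E} {n : ι → ℝ}

/-- The coefficient at `q` of `τ i` in the tangential projection of `w`, i.e. the `i`-th coefficient
of the vector field `tanExt S w`. -/
def coord (τ : ι → E → E) (n : ι → ℝ) (w : E) (i : ι) (q : E) : ℝ :=
  (n i)⁻¹ * inner ℝ (τ i q) w

theorem mem_tangentSpace (h : IsOrthoFrame S τ n) {q : E} (hq : q ∈ S) (i : ι) :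
    τ i q ∈ tangentSpace S q := by
  rw [h.span_eq q hq]; exact Submodule.subset_span ⟨i, rfl⟩

theorem tanProj_eq (h : IsOrthoFrame S τ n) {q : E} (hq : q ∈ S) (w : E) :
    tanProj S q w = ∑ i, coord τ n w i q • τ i q := by
  have key : (tangentSpace S q).starProjection w = ∑ i, coord τ n w i q • τ i q := by
    rw [h.span_eq q hq]
    exact starProjection_span_range (fun i => τ i q) n h.ne_zero (h.inner_eq q hq) w
  exact key

theorem tanExt_eqOn (h : IsOrthoFrame S τ n) (w : E) :
    Set.EqOn (tanExt S w) (fun q => ∑ i, coord τ n w i q • τ i q) S :=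
  fun _ hq => h.tanProj_eq hq w

theorem differentiableWithinAt_coord (h : IsOrthoFrame S τ n) {q : E} (hq : q ∈ S) (w : E)
    (i : ι) : DifferentiableWithinAt ℝ (coord τ n w i) S q :=
  ((h.diff i q hq).inner ℝ (differentiableWithinAt_const w)).const_mul _

/-- Summing over an orthonormal basis of the tangent space contracts the coefficients. -/
theorem sum_coord_mul_coord (h : IsOrthoFrame S τ n) {p : E} (hp : p ∈ S) (i j : ι) :
    ∑ a, coord τ n (tanFrame S p a) i p * coord τ n (tanFrame S p a) j p
      = if i = j then (n i)⁻¹ else 0 := by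
  have e := (stdOrthonormalBasis ℝ (tangentSpace S p)).sum_inner_mul_inner
    (⟨τ i p, h.mem_tangentSpace hp i⟩ : tangentSpace S p) ⟨τ j p, h.mem_tangentSpace hp j⟩
  have e' : ∑ a, inner ℝ (τ i p) (tanFrame S p a) * inner ℝ (τ j p) (tanFrame S p a)
      = if i = j then n i else 0 := by
    rw [← h.inner_eq p hp i j]
    simp only [Submodule.coe_inner] at e
    rw [← e]
    refine Finset.sum_congr rfl fun a _ => ?_
    rw [real_inner_comm (τ j p)]
    rfl
  have : ∑ a, coord τ n (tanFrame S p a) i p * coord τ n (tanFrame S p a) j p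
      = (n i)⁻¹ * (n j)⁻¹ *
        ∑ a, inner ℝ (τ i p) (tanFrame S p a) * inner ℝ (τ j p) (tanFrame S p a) := by
    rw [Finset.mul_sum]
    exact Finset.sum_congr rfl fun a _ => by simp only [coord]; ring
  rw [this, e']
  have := h.ne_zero i
  split_ifs with hij
  · subst hij; field_simp
  · simp

/-- Contraction of a bilinear expression over an orthonormal basis of the tangent space. -/
theorem sum_contract (h : IsOrthoFrame S τ n) {p : E} (hp : p ∈ S) (B : ι → ι → E) :
    ∑ a, ∑ j, ∑ i, (coord τ n (tanFrame S p a) j p * coord τ n (tanFrame S p a) i p) • B i j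
      = ∑ i, (n i)⁻¹ • B i i := by
  rw [Finset.sum_comm]
  refine Finset.sum_congr rfl fun j _ => ?_
  rw [Finset.sum_comm]
  simp_rw [← Finset.sum_smul, h.sum_coord_mul_coord hp, ite_smul, zero_smul]
  simp

/-- Leibniz rule for a field whose coefficients are those of a projected constant vector. -/
theorem fderivWithin_sum_coord (h : IsOrthoFrame S τ n) {p : E} (hp : p ∈ S) (w : E)
    {V : ι → E → E} (hV : ∀ i, DifferentiableWithinAt ℝ (V i) S p) {v : E}
    (hv : v ∈ tangentSpace S p) {Z : E → E}
    (hZ : Set.EqOn Z (fun q => ∑ i, coord τ n w i q • V i q) S) :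
    fderivWithin ℝ Z S p v = ∑ i, (coord τ n w i p • fderivWithin ℝ (V i) S p v
      + fderivWithin ℝ (coord τ n w i) S p v • V i p) := by
  have h1 : HasFDerivWithinAt (fun q => ∑ i, coord τ n w i q • V i q)
      (∑ i, (coord τ n w i p • fderivWithin ℝ (V i) S p
        + (fderivWithin ℝ (coord τ n w i) S p).smulRight (V i p))) S p :=
    HasFDerivWithinAt.fun_sum fun i _ =>
      (h.differentiableWithinAt_coord hp w i).hasFDerivWithinAt.smul (hV i).hasFDerivWithinAt
  rw [fderivWithin_eq_of_mem_tangentSpace (h1.congr hZ (hZ hp)) hv]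
  simp

/-- The second fundamental form is bilinear in the frame coefficients. -/
theorem secondFundForm_eq (h : IsOrthoFrame S τ n) (A : Set E) {p : E} (hp : p ∈ S) (v w : E) :
    secondFundForm A S p v w = ∑ j, ∑ i, (coord τ n v j p * coord τ n w i p) •
      norProj A S p (fderivWithin ℝ (τ i) S p (τ j p)) := by
  have hv : tanExt S v p ∈ tangentSpace S p := Submodule.starProjection_apply_mem _ _
  rw [secondFundForm, normalConn_apply,
    h.fderivWithin_sum_coord hp w (fun i => h.diff i p hp) hv (h.tanExt_eqOn w)]
  rw [map_sum, Finset.sum_comm]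
  refine Finset.sum_congr rfl fun i _ => ?_
  rw [map_add, map_smul, map_smul, norProj_of_mem_tangentSpace (h.mem_tangentSpace hp i),
    smul_zero, add_zero, h.tanExt_eqOn v hp, map_sum, map_sum, Finset.smul_sum]
  refine Finset.sum_congr rfl fun j _ => ?_
  rw [map_smul, map_smul, smul_smul, mul_comm]

/-- The normal Laplacian in the frame: `W i` is the normal covariant derivative of `Y` in the
direction `τ i`. No derivatives of coefficients survive, since they enter `∇_V ∇_V Y` and
`∇_{∇_V V} Y` in the same way. -/
theorem normalLaplacian_eq (h : IsOrthoFrame S τ n) (A : Set E) {p : E} (hp : p ∈ S) {Y : E → E}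
    {W : ι → E → E}
    (hW : ∀ i, ∀ q ∈ S, W i q = norProj A S q (fderivWithin ℝ Y S q (τ i q)))
    (hWd : ∀ i, DifferentiableWithinAt ℝ (W i) S p) :
    normalLaplacian A S Y p = ∑ i, (n i)⁻¹ • (norProj A S p (fderivWithin ℝ (W i) S p (τ i p))
      - norProj A S p (fderivWithin ℝ Y S p (tanProj S p (fderivWithin ℝ (τ i) S p (τ i p))))) := by
  have hWN : ∀ i, norProj A S p (W i p) = W i p := fun i => by
    rw [hW i p hp]; exact norProj_of_mem_normalSpace (norProj_mem A S p _)
  -- the inner normal derivative along the extension of `w`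
  have hin : ∀ w : E, Set.EqOn (normalConn A S (tanExt S w) Y)
      (fun q => ∑ i, coord τ n w i q • W i q) S := by
    intro w q hq
    simp only [normalConn_apply]
    rw [h.tanExt_eqOn w hq, map_sum, map_sum]
    exact Finset.sum_congr rfl fun i _ => by rw [map_smul, map_smul, hW i q hq]
  rw [normalLaplacian, ← h.sum_contract hp (fun i j =>
    norProj A S p (fderivWithin ℝ (W i) S p (τ j p))
      - norProj A S p (fderivWithin ℝ Y S p (tanProj S p (fderivWithin ℝ (τ i) S p (τ j p)))))]
  refine Finset.sum_congr rfl fun a _ => ?_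
  set w := tanFrame S p a
  have hv : tanExt S w p ∈ tangentSpace S p := Submodule.starProjection_apply_mem _ _
  rw [normalConn_apply, normalConn_apply, conn, h.fderivWithin_sum_coord hp w hWd hv (hin w),
    h.fderivWithin_sum_coord hp w (fun i => h.diff i p hp) hv (h.tanExt_eqOn w), Finset.sum_comm]
  simp only [map_sum]
  rw [← Finset.sum_sub_distrib]
  refine Finset.sum_congr rfl fun i _ => ?_
  -- the derivatives of the coefficients cancel
  have hτ : tanProj S p (τ i p) = τ i p :=
    Submodule.starProjection_eq_self_iff.2 (h.mem_tangentSpace hp i)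
  simp only [map_add, map_smul, hτ, hWN, ← hW i p hp]
  rw [add_sub_add_right_eq_sub, h.tanExt_eqOn w hp]
  simp only [map_sum, map_smul, Finset.smul_sum]
  rw [← Finset.sum_sub_distrib]
  refine Finset.sum_congr rfl fun j _ => ?_
  rw [smul_smul, smul_smul, smul_sub, mul_comm]

/-- The quadratic expression in the second fundamental form, computed in the frame. -/
theorem simonsOp_eq (h : IsOrthoFrame S τ n) (A : Set E) {p : E} (hp : p ∈ S) (y : E) :
    simonsOp A S p y = ∑ i, ∑ j, ((n i)⁻¹ * (n j)⁻¹ *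
      inner ℝ (norProj A S p (fderivWithin ℝ (τ j) S p (τ i p))) y) •
        norProj A S p (fderivWithin ℝ (τ j) S p (τ i p)) := by
  set B : ι → ι → E := fun i j => norProj A S p (fderivWithin ℝ (τ j) S p (τ i p)) with hB
  have h1 : ∀ v w, secondFundForm A S p v w =
      ∑ j, ∑ i, (coord τ n v j p * coord τ n w i p) • B j i := fun v w =>
    h.secondFundForm_eq A hp v w
  -- contract in the second slot, then in the first
  have step : ∀ u : ι → E, ∑ b, inner ℝ (∑ i, coord τ n (tanFrame S p b) i p • u i) y •
      (∑ i, coord τ n (tanFrame S p b) i p • u i)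
      = ∑ i, ((n i)⁻¹ * inner ℝ (u i) y) • u i := by
    intro u
    have := h.sum_contract hp (fun i j => inner ℝ (u i) y • u j)
    simp only [smul_smul] at this
    rw [← this]
    refine Finset.sum_congr rfl fun b _ => ?_
    rw [Finset.smul_sum]
    refine Finset.sum_congr rfl fun j _ => ?_
    rw [sum_inner, smul_smul, Finset.sum_mul, Finset.sum_smul]
    refine Finset.sum_congr rfl fun i _ => ?_
    rw [real_inner_smul_left]
    ring_nf
  rw [simonsOp]
  have h2 : ∀ v w, secondFundForm A S p v w =
      ∑ i, coord τ n w i p • ∑ j, coord τ n v j p • B j i := fun v w => by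
    rw [h1, Finset.sum_comm]
    refine Finset.sum_congr rfl fun i _ => ?_
    rw [Finset.smul_sum]
    exact Finset.sum_congr rfl fun j _ => by rw [smul_smul, mul_comm]
  simp_rw [h2, step]
  rw [Finset.sum_comm]
  conv_rhs => rw [Finset.sum_comm]
  refine Finset.sum_congr rfl fun j _ => ?_
  have := congrArg (fun z => (n j)⁻¹ • z) (step fun i => B i j)
  simp only [Finset.smul_sum, smul_smul] at this
  have e : ∀ i, (n i)⁻¹ * (n j)⁻¹ * inner ℝ (B i j) y = (n j)⁻¹ * ((n i)⁻¹ * inner ℝ (B i j) y) :=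
    fun i => by ring
  change _ = ∑ i, ((n i)⁻¹ * (n j)⁻¹ * inner ℝ (B i j) y) • B i j
  simp_rw [e]
  rw [← this]
  refine Finset.sum_congr rfl fun b _ => ?_
  rw [Finset.smul_sum]
  refine Finset.sum_congr rfl fun i _ => ?_
  rw [smul_smul, mul_assoc]

theorem finrank_tangentSpace (h : IsOrthoFrame S τ n) {p : E} (hp : p ∈ S) :
    Module.finrank ℝ (tangentSpace S p) = Fintype.card ι := by
  rw [h.span_eq p hp]
  refine finrank_span_eq_card ?_
  rw [Fintype.linearIndependent_iff]
  intro g hg i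
  have := congrArg (fun z => inner ℝ (τ i p) z) hg
  simp only [inner_sum, inner_smul_right, h.inner_eq p hp, inner_zero_right, mul_ite, mul_zero,
    Finset.sum_ite_eq, Finset.mem_univ, if_true] at this
  exact (mul_eq_zero.1 this).resolve_right (h.ne_zero i)

end IsOrthoFrame

/-! ### Curvature of the ambient manifolds -/

theorem tangentSpace_univ (p : E) : tangentSpace (Set.univ : Set E) p = ⊤ := by
  rw [eq_top_iff]
  intro v _
  refine Submodule.subset_span ⟨fun t => p + t • v, by fun_prop, fun _ => trivial, by simp, ?_⟩
  have := (((hasDerivAt_id (0 : ℝ)).smul_const v).const_add p).deriv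
  simpa using this

theorem tanProj_univ (p w : E) : tanProj (Set.univ : Set E) p w = w := by
  have key : (tangentSpace (Set.univ : Set E) p).starProjection w = w :=
    Submodule.starProjection_eq_self_iff.2 (by rw [tangentSpace_univ]; trivial)
  exact key

theorem curvature_univ (p x y z : E) : curvature (Set.univ : Set E) p x y z = 0 := by
  have h : ∀ w : E, tanExt (Set.univ : Set E) w = fun _ => w :=
    fun w => funext fun q => tanProj_univ q w
  have hc : ∀ X : E → E, conn Set.univ Set.univ X (fun _ => z) = fun _ => 0 := by
    intro X
    funext q
    simp [conn]
  simp only [curvature, h, hc]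
  simp [conn]

theorem curvatureOp_univ (S : Set E) (p y : E) : curvatureOp Set.univ S p y = 0 := by
  simp [curvatureOp, curvature_univ]

/-- The tangent space of the unit sphere. -/
theorem tangentSpace_sphere {p : E} (hp : p ∈ Metric.sphere (0 : E) 1) :
    tangentSpace (Metric.sphere (0 : E) 1) p = (ℝ ∙ p)ᗮ := by
  have hp1 : ‖p‖ = 1 := by simpa using hp
  apply le_antisymm
  · refine Submodule.span_le.2 ?_
    rintro v ⟨γ, hγ, hS, h0, rfl⟩
    rw [SetLike.mem_coe, Submodule.mem_orthogonal_singleton_iff_inner_right]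
    have hd : HasDerivAt γ (deriv γ 0) 0 := (hγ.differentiable (by simp) 0).hasDerivAt
    have h1 := hd.inner ℝ hd
    have h2 : (fun t => inner ℝ (γ t) (γ t)) = fun _ => (1 : ℝ) := by
      funext t
      have : ‖γ t‖ = 1 := by simpa using hS t
      rw [real_inner_self_eq_norm_sq, this, one_pow]
    rw [h2] at h1
    have h3 := h1.unique (hasDerivAt_const 0 1)
    rw [real_inner_comm (γ 0), h0] at h3
    rw [h0] at *
    linarith [real_inner_comm p (deriv γ 0)]
  · intro v hv
    rw [Submodule.mem_orthogonal_singleton_iff_inner_right] at hv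
    by_cases hv0 : v = 0
    · rw [hv0]; exact Submodule.zero_mem _
    have hvn : ‖v‖ ≠ 0 := norm_ne_zero_iff.2 hv0
    -- the great circle through `p` in the direction `v`
    have hmem : ‖v‖⁻¹ • v ∈ tangentSpace (Metric.sphere (0 : E) 1) p := by
      refine Submodule.subset_span
        ⟨fun t => Real.cos t • p + Real.sin t • (‖v‖⁻¹ • v), ?_, ?_, by simp, ?_⟩
      · exact (Real.contDiff_cos.smul contDiff_const).add (Real.contDiff_sin.smul contDiff_const)
      · intro t
        rw [mem_sphere_zero_iff_norm, ← sq_eq_sq₀ (norm_nonneg _) zero_le_one, norm_add_sq_real]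
        rw [norm_smul, norm_smul, norm_smul, hp1, norm_inv, norm_norm, inv_mul_cancel₀ hvn,
          inner_smul_left, inner_smul_right, inner_smul_right, hv]
        simp
      · have hc := ((Real.hasDerivAt_cos 0).smul_const p).add
          ((Real.hasDerivAt_sin 0).smul_const (‖v‖⁻¹ • v))
        have := hc.deriv
        simpa using this
    have := Submodule.smul_mem _ ‖v‖ hmem
    rwa [smul_smul, mul_inv_cancel₀ hvn, one_smul] at this

theorem tanProj_sphere {q : E} (hq : q ∈ Metric.sphere (0 : E) 1) (w : E) :
    tanProj (Metric.sphere (0 : E) 1) q w = w - inner ℝ q w • q := by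
  have hq1 : ‖q‖ = 1 := by simpa using hq
  have key : (tangentSpace (Metric.sphere (0 : E) 1) q).starProjection w
      = w - inner ℝ q w • q := by
    rw [tangentSpace_sphere hq, Submodule.starProjection_orthogonal_val,
      Submodule.starProjection_unit_singleton ℝ hq1]
  exact key

/-- The unit sphere has constant curvature `1`. -/
theorem curvature_sphere {p x y z : E} (hp : p ∈ Metric.sphere (0 : E) 1)
    (hx : inner ℝ p x = 0) (hy : inner ℝ p y = 0) (hz : inner ℝ p z = 0) :
    curvature (Metric.sphere (0 : E) 1) p x y z = inner ℝ y z • x - inner ℝ x z • y := by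
  set A := Metric.sphere (0 : E) 1
  have hE : ∀ w : E, Set.EqOn (tanExt A w) (fun q => w - inner ℝ q w • q) A :=
    fun w q hq => tanProj_sphere hq w
  have hD : ∀ w q : E, HasFDerivAt (fun q => w - inner ℝ q w • q)
      (-(inner ℝ q w • ContinuousLinearMap.id ℝ E +
        (((innerSL ℝ).flip w : E →L[ℝ] ℝ)).smulRight q)) q := by
    intro w q
    have h1 : HasFDerivAt (fun q : E => inner ℝ q w) ((innerSL ℝ).flip w : E →L[ℝ] ℝ) q :=
      ((innerSL ℝ).flip w : E →L[ℝ] ℝ).hasFDerivAt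
    have := (h1.smul (hasFDerivAt_id q)).const_sub w
    simpa using this
  have hT : ∀ w q : E, tanExt A w q ∈ tangentSpace A q :=
    fun w q => Submodule.starProjection_apply_mem _ _
  have hDE : ∀ w q v : E, q ∈ A → v ∈ tangentSpace A q →
      fderivWithin ℝ (tanExt A w) A q v = -(inner ℝ q w • v + inner ℝ v w • q) := by
    intro w q v hq hv
    rw [fderivWithin_eq_of_eqOn (hE w) hq (hD w q) hv]
    simp [real_inner_comm]
    rfl
  -- `∇_V W = -⟨q, w⟩ V` for the extensions of constant vectors
  have hC : ∀ v w : E, Set.EqOn (conn A A (tanExt A v) (tanExt A w))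
      (fun q => -(inner ℝ q w • (v - inner ℝ q v • q))) A := by
    intro v w q hq
    have hqq : inner ℝ q q = (1 : ℝ) := by
      rw [real_inner_self_eq_norm_sq, show ‖q‖ = 1 by simpa [A] using hq, one_pow]
    simp only [conn]
    rw [hDE w q _ hq (hT v q), tanProj_sphere hq, hE v hq]
    simp only [inner_neg_right, inner_add_right, inner_smul_right, inner_sub_right, hqq]
    module
  have hDC : ∀ u v w : E, inner ℝ p u = 0 → inner ℝ p v = 0 → inner ℝ p w = 0 →
      conn A A (tanExt A u) (conn A A (tanExt A v) (tanExt A w)) p = -(inner ℝ u w • v) := by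
    intro u v w hu hv hw
    have h1 : HasFDerivAt (fun q : E => inner ℝ q w) ((innerSL ℝ).flip w : E →L[ℝ] ℝ) p :=
      ((innerSL ℝ).flip w : E →L[ℝ] ℝ).hasFDerivAt
    have h2 := (h1.smul (hD v p)).neg
    have hup : tanExt A u p = u := by rw [hE u hp]; simp [hu]
    simp only [conn] at *
    rw [fderivWithin_eq_of_eqOn (hC v w) hp h2 (hT u p), tanProj_sphere hp, hup]
    simp [hv, hw, inner_neg_right, inner_smul_right]
    rw [real_inner_comm]
    rfl
  have hbr : fderivWithin ℝ (tanExt A y) A p (tanExt A x p)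
      - fderivWithin ℝ (tanExt A x) A p (tanExt A y p) = 0 := by
    rw [hDE y p _ hp (hT x p), hDE x p _ hp (hT y p), hE x hp, hE y hp]
    simp [hx, hy, real_inner_comm]
  rw [curvature, hDC x y z hx hy hz, hDC y x z hy hx hz]
  have h3 : conn A A (fun q => fderivWithin ℝ (tanExt A y) A q (tanExt A x q)
      - fderivWithin ℝ (tanExt A x) A q (tanExt A y q)) (tanExt A z) p = 0 := by
    simp only [conn]
    rw [hbr]; simp
  rw [h3]
  module

/-- The curvature term for a submanifold of the unit sphere is multiplication by its dimension. -/
theorem curvatureOp_sphere {S : Set E} {p y : E} (hp : p ∈ Metric.sphere (0 : E) 1)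
    (hS : tangentSpace S p ≤ tangentSpace (Metric.sphere (0 : E) 1) p)
    (hy : y ∈ normalSpace (Metric.sphere (0 : E) 1) S p) :
    curvatureOp (Metric.sphere (0 : E) 1) S p y
      = (Module.finrank ℝ (tangentSpace S p) : ℝ) • y := by
  have hperp : ∀ {v}, v ∈ tangentSpace (Metric.sphere (0 : E) 1) p → inner ℝ p v = 0 := by
    intro v hv
    rwa [tangentSpace_sphere hp, Submodule.mem_orthogonal_singleton_iff_inner_right] at hv
  have hmem : ∀ i, tanFrame S p i ∈ tangentSpace S p := fun i =>
    (stdOrthonormalBasis ℝ (tangentSpace S p) i).2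
  have hone : ∀ i, inner ℝ (tanFrame S p i) (tanFrame S p i) = (1 : ℝ) := by
    intro i
    have := (stdOrthonormalBasis ℝ (tangentSpace S p)).orthonormal.1 i
    have h1 : ‖tanFrame S p i‖ = 1 := this
    rw [real_inner_self_eq_norm_sq, h1, one_pow]
  have : ∀ i, curvature (Metric.sphere (0 : E) 1) p y (tanFrame S p i) (tanFrame S p i) = y := by
    intro i
    have hi := hperp (hS (hmem i))
    have h0 : inner ℝ y (tanFrame S p i) = 0 := by
      rw [real_inner_comm]; exact hy.2 _ (hmem i)
    rw [curvature_sphere hp (hperp hy.1) hi hi, hone, h0]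
    simp
  simp only [curvatureOp, this, Finset.sum_const, Finset.card_univ, Fintype.card_fin]
  rw [← Nat.cast_smul_eq_nsmul ℝ, map_smul, norProj_of_mem_normalSpace hy]

end Abstract

/-! ### The moving frame of the cone -/

/-- The three unit vector fields on `𝕊³` commuting with `SU(2)`, as linear maps of `ℝ⁴ = ℂ²`:
`(-z̄₂, z̄₁)`, `i (-z̄₂, z̄₁)` and `(i z₁, i z₂)`. -/
def vf (i : Fin 3) : Euc 4 →L[ℝ] Euc 4 :=
  LinearMap.toContinuousLinearMap
    { toFun := fun x => ![!₂[-x 2, x 3, x 0, -x 1], !₂[-x 3, -x 2, x 1, x 0],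
        !₂[-x 1, x 0, -x 3, x 2]] i
      map_add' := fun x y => by
        fin_cases i <;> ext j <;> fin_cases j <;> simp <;> ring
      map_smul' := fun c x => by
        fin_cases i <;> ext j <;> fin_cases j <;> simp }

theorem vf_apply (i : Fin 3) (x : Euc 4) : vf i x = ![!₂[-x 2, x 3, x 0, -x 1],
    !₂[-x 3, -x 2, x 1, x 0], !₂[-x 1, x 0, -x 3, x 2]] i := rfl

/-- The polar form of the Hopf map. -/
def hopfPol : Euc 4 →L[ℝ] Euc 4 →L[ℝ] Euc 3 :=
  LinearMap.toContinuousBilinearMap (LinearMap.mk₂ ℝ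
    (fun x y => !₂[x 0 * y 0 + x 1 * y 1 - x 2 * y 2 - x 3 * y 3,
      x 0 * y 2 + x 2 * y 0 + (x 1 * y 3 + x 3 * y 1),
      x 1 * y 2 + x 2 * y 1 - (x 0 * y 3 + x 3 * y 0)])
    (fun x x' y => by ext j; fin_cases j <;> simp <;> ring)
    (fun c x y => by ext j; fin_cases j <;> simp <;> ring)
    (fun x y y' => by ext j; fin_cases j <;> simp <;> ring)
    (fun c x y => by ext j; fin_cases j <;> simp <;> ring))

theorem hopfPol_apply (x y : Euc 4) :
    hopfPol x y = !₂[x 0 * y 0 + x 1 * y 1 - x 2 * y 2 - x 3 * y 3,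
      x 0 * y 2 + x 2 * y 0 + (x 1 * y 3 + x 3 * y 1),
      x 1 * y 2 + x 2 * y 1 - (x 0 * y 3 + x 3 * y 0)] := rfl

/-- `(u, w) ↦ (u, √5 w)`, from `ℝ⁴ × ℝ³` to `ℝ⁷`. -/
def join : (Euc 4 × Euc 3) →L[ℝ] Euc 7 :=
  LinearMap.toContinuousLinearMap
    { toFun := fun p => !₂[p.1 0, p.1 1, p.1 2, p.1 3, √5 * p.2 0, √5 * p.2 1, √5 * p.2 2]
      map_add' := fun x y => by ext j; fin_cases j <;> simp <;> ring
      map_smul' := fun c x => by ext j; fin_cases j <;> simp <;> ring }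

theorem join_apply (u : Euc 4) (w : Euc 3) :
    join (u, w) = !₂[u 0, u 1, u 2, u 3, √5 * w 0, √5 * w 1, √5 * w 2] := rfl

theorem inner_join (u u' : Euc 4) (w w' : Euc 3) :
    inner ℝ (join (u, w)) (join (u', w')) = inner ℝ u u' + 5 * inner ℝ w w' := by
  have h5 : √5 * √5 = 5 := Real.mul_self_sqrt (by norm_num)
  simp only [join_apply, PiLp.inner_apply, Fin.sum_univ_succ, Fin.sum_univ_zero]
  simp
  linear_combination (w 0 * w' 0 + w 1 * w' 1 + w 2 * w' 2) * h5

/-- The linear map on `ℝ⁴` underlying the `A`-th frame field. -/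
def frameLin (A : Fin 7) : Euc 4 →L[ℝ] Euc 4 :=
  ![ContinuousLinearMap.id ℝ _, vf 0, vf 1, vf 2, ContinuousLinearMap.id ℝ _, vf 0, vf 1] A

/-- An orthogonal frame of `ℝ⁷` along the link, as a function of the unit vector `x ∈ ℝ⁴` that
parametrizes it: `frame 0 x` is the point of the link, `frame 1`, `frame 2`, `frame 3` are tangent
and `frame 4 = √5 e₄`, `frame 5`, `frame 6` are normal to the link in the sphere. Lengths are
not normalized, so that all structure constants are rational. The tangent fields are the
derivatives of `frame 0` along the vector fields `vf i`, and the numerical factors of the normal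
fields make these orthogonal to the cone. -/
def frame (A : Fin 7) (x : Euc 4) : Euc 7 :=
  join ((![2 / 3, 2 / 3, 2 / 3, 2 / 3, 5 / 3, -10 / 3, -10 / 3] A : ℝ) • frameLin A x,
    (![1 / 3, 2 / 3, 2 / 3, 2 / 3, -2 / 3, 2 / 3, 2 / 3] A : ℝ) • hopfPol x (frameLin A x))

/-- The squared lengths of the frame fields. -/
def frameSq : Fin 7 → ℝ := ![1, 8 / 3, 8 / 3, 4 / 9, 5, 40 / 3, 40 / 3]

/-- The constants `Ω` in `X_i F_A = ∑ B, Ω i A B • F_B`, where `X_i` is the derivative along `vf i`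
and `F_A = frame A`; see `fderiv_frame`. -/
def structConst : Fin 3 → Fin 7 → Fin 7 → ℝ :=
  ![![![0, 1, 0, 0, 0, 0, 0],
      ![-8 / 3, 0, 0, 0, 2 / 3, 0, 0],
      ![0, 0, 0, -1, 0, 0, 0],
      ![0, 0, 1 / 6, 0, 0, 0, -1 / 6],
      ![0, -5 / 4, 0, 0, 0, -3 / 4, 0],
      ![0, 0, 0, 0, 2, 0, 0],
      ![0, 0, 0, 5, 0, 0, 0]],
    ![![0, 0, 1, 0, 0, 0, 0],
      ![0, 0, 0, 1, 0, 0, 0],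
      ![-8 / 3, 0, 0, 0, 2 / 3, 0, 0],
      ![0, -1 / 6, 0, 0, 0, 1 / 6, 0],
      ![0, 0, -5 / 4, 0, 0, 0, -3 / 4],
      ![0, 0, 0, -5, 0, 0, 0],
      ![0, 0, 0, 0, 2, 0, 0]],
    ![![0, 0, 0, 1, 0, 0, 0],
      ![0, 0, -11 / 6, 0, 0, 0, -1 / 6],
      ![0, 11 / 6, 0, 0, 0, 1 / 6, 0],
      ![-4 / 9, 0, 0, 0, -2 / 9, 0, 0],
      ![0, 0, 0, 5 / 2, 0, 0, 0],
      ![0, 0, -5 / 6, 0, 0, 0, -7 / 6],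
      ![0, 5 / 6, 0, 0, 0, 7 / 6, 0]]]

theorem inner_euc_three (u v : Euc 3) : inner ℝ u v = u 0 * v 0 + u 1 * v 1 + u 2 * v 2 := by
  simp [PiLp.inner_apply, Fin.sum_univ_succ]
  ring

theorem inner_euc_four (u v : Euc 4) :
    inner ℝ u v = u 0 * v 0 + u 1 * v 1 + u 2 * v 2 + u 3 * v 3 := by
  simp [PiLp.inner_apply, Fin.sum_univ_succ]
  ring

theorem vf_sq (i : Fin 3) (x : Euc 4) : vf i (vf i x) = -x := by
  fin_cases i <;> ext j <;> fin_cases j <;> simp [vf_apply]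

theorem inner_vf_self (i : Fin 3) (x : Euc 4) : inner ℝ x (vf i x) = 0 := by
  fin_cases i <;> simp [vf_apply, PiLp.inner_apply, Fin.sum_univ_succ] <;> ring

theorem norm_vf (i : Fin 3) (x : Euc 4) : ‖vf i x‖ = ‖x‖ := by
  rw [EuclideanSpace.norm_eq, EuclideanSpace.norm_eq]
  congr 1
  fin_cases i <;> simp [vf_apply, Fin.sum_univ_succ] <;> ring

theorem sum_sq_eq_one {x : Euc 4} (hx : ‖x‖ = 1) :
    x 0 * x 0 + x 1 * x 1 + x 2 * x 2 + x 3 * x 3 = 1 := by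
  have := real_inner_self_eq_norm_sq x
  rw [hx] at this
  simp only [PiLp.inner_apply, Fin.sum_univ_succ, Fin.sum_univ_zero] at this
  simp at this
  linear_combination this

/-- `x` and the three vector fields form an orthonormal basis at every unit vector `x`. -/
theorem eq_sum_vf {x : Euc 4} (hx : ‖x‖ = 1) (v : Euc 4) :
    v = inner ℝ x v • x + ∑ i, inner ℝ (vf i x) v • vf i x := by
  have h := sum_sq_eq_one hx
  ext j
  fin_cases j <;>
    simp [vf_apply, PiLp.inner_apply, Fin.sum_univ_succ]
  · linear_combination -v 0 * h
  · linear_combination -v 1 * h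
  · linear_combination -v 2 * h
  · linear_combination -v 3 * h

theorem hasFDerivAt_frame (A : Fin 7) (x : Euc 4) :
    HasFDerivAt (frame A) (join.comp (ContinuousLinearMap.prod
      ((![2 / 3, 2 / 3, 2 / 3, 2 / 3, 5 / 3, -10 / 3, -10 / 3] A : ℝ) • frameLin A)
      ((![1 / 3, 2 / 3, 2 / 3, 2 / 3, -2 / 3, 2 / 3, 2 / 3] A : ℝ) •
        (hopfPol.precompR (Euc 4) x (frameLin A)
          + hopfPol.precompL (Euc 4) (ContinuousLinearMap.id ℝ (Euc 4)) (frameLin A x))))) x := by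
  have h1 : HasFDerivAt (fun y => frameLin A y) (frameLin A) x := (frameLin A).hasFDerivAt
  have h2 := hopfPol.hasFDerivAt_of_bilinear (hasFDerivAt_id x) h1
  have h3 := (h1.const_smul (![2 / 3, 2 / 3, 2 / 3, 2 / 3, 5 / 3, -10 / 3, -10 / 3] A : ℝ)).prodMk
    (h2.const_smul (![1 / 3, 2 / 3, 2 / 3, 2 / 3, -2 / 3, 2 / 3, 2 / 3] A : ℝ))
  exact join.hasFDerivAt.comp x h3

theorem contDiff_frame (A : Fin 7) : ContDiff ℝ ∞ (frame A) := by
  have h1 : ContDiff ℝ ∞ (fun y => frameLin A y) := (frameLin A).contDiff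
  have h2 : ContDiff ℝ ∞ (fun y => hopfPol y (frameLin A y)) :=
    hopfPol.isBoundedBilinearMap.contDiff.comp (contDiff_id.prodMk h1)
  exact join.contDiff.comp ((h1.const_smul _).prodMk (h2.const_smul _))

theorem vf_vf (x : Euc 4) :
    vf 0 (vf 1 x) = vf 2 x ∧ vf 1 (vf 0 x) = -vf 2 x ∧ vf 0 (vf 2 x) = -vf 1 x ∧
      vf 2 (vf 0 x) = vf 1 x ∧ vf 1 (vf 2 x) = vf 0 x ∧ vf 2 (vf 1 x) = -vf 0 x := by
  refine ⟨?_, ?_, ?_, ?_, ?_, ?_⟩ <;> ext j <;> fin_cases j <;> simp [vf_apply]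

theorem hopfPol_comm (x y : Euc 4) : hopfPol x y = hopfPol y x := by
  ext j; fin_cases j <;> simp [hopfPol_apply] <;> ring

theorem hopfPol_vf_two (x : Euc 4) : hopfPol x (vf 2 x) = 0 := by
  ext j; fin_cases j <;> simp [hopfPol_apply, vf_apply] <;> ring

theorem hopfPol_vf_vf (x : Euc 4) :
    hopfPol (vf 0 x) (vf 0 x) = -hopfPol x x ∧ hopfPol (vf 1 x) (vf 1 x) = -hopfPol x x ∧
      hopfPol (vf 2 x) (vf 2 x) = hopfPol x x ∧ hopfPol (vf 0 x) (vf 1 x) = 0 ∧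
      hopfPol (vf 0 x) (vf 2 x) = -hopfPol x (vf 1 x) ∧
      hopfPol (vf 1 x) (vf 2 x) = hopfPol x (vf 0 x) := by
  refine ⟨?_, ?_, ?_, ?_, ?_, ?_⟩ <;> ext j <;> fin_cases j <;>
    simp [hopfPol_apply, vf_apply] <;> ring

set_option maxHeartbeats 1000000 in
/-- The frame fields have constant structure coefficients along `𝕊³`, because frame and
vector fields are both equivariant under `SU(2)`. -/
theorem fderiv_frame (i : Fin 3) (A : Fin 7) (x : Euc 4) :
    fderiv ℝ (frame A) x (vf i x) = ∑ B, structConst i A B • frame B x := by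
  obtain ⟨a1, a2, a3, a4, a5, a6⟩ := vf_vf x
  obtain ⟨b1, b2, b3, b4, b5, b6⟩ := hopfPol_vf_vf x
  have c1 := hopfPol_vf_two x
  have c2 : ∀ i, hopfPol (vf i x) x = hopfPol x (vf i x) := fun i => hopfPol_comm _ _
  have b4' := (hopfPol_comm (vf 1 x) (vf 0 x)).trans b4
  have b5' := (hopfPol_comm (vf 2 x) (vf 0 x)).trans b5
  have b6' := (hopfPol_comm (vf 2 x) (vf 1 x)).trans b6
  rw [(hasFDerivAt_frame A x).fderiv]
  have key : ∀ (u u' : Euc 4) (w w' : Euc 3), u = u' → w = w' → join (u, w) = join (u', w') := by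
    rintro u _ w _ rfl rfl; rfl
  have hs : ∑ B, structConst i A B • frame B x = join (∑ B, structConst i A B •
      ((![2 / 3, 2 / 3, 2 / 3, 2 / 3, 5 / 3, -10 / 3, -10 / 3] B : ℝ) • frameLin B x),
      ∑ B, structConst i A B • ((![1 / 3, 2 / 3, 2 / 3, 2 / 3, -2 / 3, 2 / 3, 2 / 3] B : ℝ) •
        hopfPol x (frameLin B x))) := by
    simp only [frame, ← map_smul, ← map_sum]
    congr 1
    exact Prod.ext (by simp [Prod.fst_sum]) (by simp [Prod.snd_sum])
  rw [hs]
  refine key _ _ _ _ ?_ ?_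
  · simp only [Fin.sum_univ_succ, Fin.sum_univ_zero]
    fin_cases i <;> fin_cases A <;>
      simp [structConst, frameLin, a1, a2, a3, a4, a5, a6, vf_sq] <;> module
  · simp only [Fin.sum_univ_succ, Fin.sum_univ_zero]
    fin_cases i <;> fin_cases A <;>
      simp [structConst, frameLin, a1, a2, a3, a4, a5, a6, vf_sq, b1, b2, b3, b4, b5, b6, b4', b5',
        b6', c1, c2] <;> module

/-- The frame is orthogonal. -/
theorem inner_frame {x : Euc 4} (hx : ‖x‖ = 1) (A B : Fin 7) :
    inner ℝ (frame A x) (frame B x) = if A = B then frameSq A else 0 := by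
  have h := sum_sq_eq_one hx
  have hxv := fun i => inner_vf_self i x
  have hvx : ∀ i, inner ℝ (vf i x) x = 0 := fun i => by rw [real_inner_comm]; exact hxv i
  have hvv : ∀ i j, i ≠ j → inner ℝ (vf i x) (vf j x) = 0 := by
    intro i j hij
    fin_cases i <;> fin_cases j <;> first
      | exact absurd rfl hij
      | (simp [vf_apply, PiLp.inner_apply, Fin.sum_univ_succ]; ring)
  have v01 := hvv 0 1 (by decide)
  have v02 := hvv 0 2 (by decide)
  have v10 := hvv 1 0 (by decide)
  have v12 := hvv 1 2 (by decide)
  have v20 := hvv 2 0 (by decide)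
  have v21 := hvv 2 1 (by decide)
  have q2 := hopfPol_vf_two x
  have q00 : ‖hopfPol x x‖ ^ 2 = 1 := by
    rw [← real_inner_self_eq_norm_sq, inner_euc_three]
    simp [hopfPol_apply]
    linear_combination (x 0 * x 0 + x 1 * x 1 + x 2 * x 2 + x 3 * x 3 + 1) * h
  have q11 : ‖hopfPol x (vf 0 x)‖ ^ 2 = 1 := by
    rw [← real_inner_self_eq_norm_sq, inner_euc_three]
    simp [hopfPol_apply, vf_apply]
    linear_combination (x 0 * x 0 + x 1 * x 1 + x 2 * x 2 + x 3 * x 3 + 1) * h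
  have q22 : ‖hopfPol x (vf 1 x)‖ ^ 2 = 1 := by
    rw [← real_inner_self_eq_norm_sq, inner_euc_three]
    simp [hopfPol_apply, vf_apply]
    linear_combination (x 0 * x 0 + x 1 * x 1 + x 2 * x 2 + x 3 * x 3 + 1) * h
  have q01 : inner ℝ (hopfPol x x) (hopfPol x (vf 0 x)) = (0 : ℝ) := by
    rw [inner_euc_three]; simp [hopfPol_apply, vf_apply]; ring
  have q02 : inner ℝ (hopfPol x x) (hopfPol x (vf 1 x)) = (0 : ℝ) := by
    rw [inner_euc_three]; simp [hopfPol_apply, vf_apply]; ring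
  have q12 : inner ℝ (hopfPol x (vf 0 x)) (hopfPol x (vf 1 x)) = (0 : ℝ) := by
    rw [inner_euc_three]; simp [hopfPol_apply, vf_apply]; ring
  have q10 := (real_inner_comm (hopfPol x x) (hopfPol x (vf 0 x))).trans q01
  have q20 := (real_inner_comm (hopfPol x x) (hopfPol x (vf 1 x))).trans q02
  have q21 := (real_inner_comm (hopfPol x (vf 0 x)) (hopfPol x (vf 1 x))).trans q12
  simp only [frame, inner_join, inner_smul_left, inner_smul_right]
  fin_cases A <;> fin_cases B <;>
    simp [frameLin, frameSq, hx, norm_vf, hxv, hvx, v01, v02, v10, v12, v20, v21, q2, q00, q11, q22,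
      q01, q02, q12, q10, q20, q21] <;> norm_num

/-! ### Homogeneous extension -/

/-- The function on `ℝ⁴ \ {0}`, homogeneous of degree `d`, with the values of `g` on `𝕊³`. -/
def hom {F : Type*} [NormedAddCommGroup F] [NormedSpace ℝ F] (d : ℤ) (g : Euc 4 → F)
    (y : Euc 4) : F :=
  ‖y‖ ^ d • g (‖y‖⁻¹ • y)

theorem norm_pos_smul {V : Type*} [NormedAddCommGroup V] [NormedSpace ℝ V] {x : V}
    (hx : ‖x‖ = 1) {t : ℝ} (ht : 0 < t) : ‖t • x‖ = t := by
  rw [norm_smul, hx, mul_one, Real.norm_of_nonneg ht.le]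

theorem normalize_smul {V : Type*} [NormedAddCommGroup V] [NormedSpace ℝ V] {x : V}
    (hx : ‖x‖ = 1) {t : ℝ} (ht : 0 < t) : ‖t • x‖⁻¹ • t • x = x := by
  rw [norm_pos_smul hx ht, smul_smul, inv_mul_cancel₀ ht.ne', one_smul]

theorem hom_smul {F : Type*} [NormedAddCommGroup F] [NormedSpace ℝ F] (d : ℤ) (g : Euc 4 → F)
    {x : Euc 4} (hx : ‖x‖ = 1) {t : ℝ} (ht : 0 < t) : hom d g (t • x) = t ^ d • g x := by
  rw [hom, normalize_smul hx ht, norm_pos_smul hx ht]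

/-- Derivatives of a homogeneous extension in tangential and radial directions. -/
theorem hasFDerivAt_hom {F : Type*} [NormedAddCommGroup F] [NormedSpace ℝ F] (d : ℤ)
    {g : Euc 4 → F} {x : Euc 4} (hx : ‖x‖ = 1) {t : ℝ} (ht : 0 < t)
    (hg : DifferentiableAt ℝ g x) :
    ∃ L : Euc 4 →L[ℝ] F, HasFDerivAt (hom d g) L (t • x) ∧
      (∀ v, inner ℝ x v = 0 → L v = t ^ (d - 1) • fderiv ℝ g x v) ∧
      L x = (d * t ^ (d - 1)) • g x := by
  have hn := norm_pos_smul hx ht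
  have hN : HasFDerivAt (fun y : Euc 4 => ‖y‖) (innerSL ℝ x) (t • x) := by
    have h := (hasStrictFDerivAt_norm_sq (t • x)).hasFDerivAt.sqrt (by rw [hn]; positivity)
    simp only [Real.sqrt_sq (norm_nonneg _)] at h
    have e : (1 / (2 * ‖t • x‖)) • (2 : ℕ) • innerSL ℝ (t • x) = innerSL ℝ x := by
      rw [hn]
      ext v
      simp
      field_simp
    rwa [e] at h
  have hp := (hasDerivAt_zpow d ‖t • x‖ (Or.inl (by rw [hn]; exact ht.ne'))).comp_hasFDerivAt
    (t • x) hN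
  have hi := (hasDerivAt_inv (x := ‖t • x‖) (by rw [hn]; exact ht.ne')).comp_hasFDerivAt
    (t • x) hN
  have hnz := hi.smul (hasFDerivAt_id (t • x))
  have hg' : HasFDerivAt g (fderiv ℝ g x) (‖t • x‖⁻¹ • t • x) := by
    rw [normalize_smul hx ht]; exact hg.hasFDerivAt
  have hfin := hp.smul (HasFDerivAt.comp (t • x) (f := fun y : Euc 4 => ‖y‖⁻¹ • y) hg' hnz)
  refine ⟨_, hfin, ?_, ?_⟩
  · intro v hv
    have ht' := ht.ne'
    simp [hn, hv, smul_smul, zpow_sub_one₀ ht']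
  · have ht' := ht.ne'
    simp [hn, hx, smul_smul, inv_mul_cancel₀ ht']
    have h2 : (t ^ 2)⁻¹ * t = t⁻¹ := by field_simp
    rw [h2, add_neg_cancel]

/-- Three halves of the projection `ℝ⁷ → ℝ⁴`, the inverse of the parametrization `frame 0`. -/
def pr : Euc 7 →L[ℝ] Euc 4 :=
  LinearMap.toContinuousLinearMap
    { toFun := fun p => !₂[3 / 2 * p 0, 3 / 2 * p 1, 3 / 2 * p 2, 3 / 2 * p 3]
      map_add' := fun x y => by ext j; fin_cases j <;> simp <;> ring
      map_smul' := fun c x => by ext j; fin_cases j <;> simp <;> ring }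

theorem pr_apply (p : Euc 7) : pr p = !₂[3 / 2 * p 0, 3 / 2 * p 1, 3 / 2 * p 2, 3 / 2 * p 3] := rfl

theorem pr_join (u : Euc 4) (w : Euc 3) : pr (join (u, w)) = (3 / 2 : ℝ) • u := by
  ext j; fin_cases j <;> simp [pr_apply, join_apply]

theorem pr_frame_zero (x : Euc 4) : pr (frame 0 x) = x := by
  simp [frame, pr_join, frameLin, smul_smul]

theorem pr_frame_succ (i : Fin 3) (x : Euc 4) :
    pr (frame (i.succ.castLE (by omega)) x) = vf i x := by
  fin_cases i <;> simp [frame, pr_join, frameLin, smul_smul]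

theorem norm_frame_zero {x : Euc 4} (hx : ‖x‖ = 1) : ‖frame 0 x‖ = 1 := by
  have := inner_frame hx 0 0
  rw [real_inner_self_eq_norm_sq] at this
  simp [frameSq] at this
  rcases this with h | h
  · exact h
  · linarith [norm_nonneg (frame 0 x)]

theorem hopf_eq (x : Euc 4) : hopf x = hopfPol x x := by
  ext j
  fin_cases j <;> simp [hopf, hopfPol_apply, Complex.sq_norm, Complex.normSq_mk] <;> ring

/-- The point of the cone over `y ≠ 0`. -/
theorem cone_point_eq {x : Euc 4} (hx : ‖x‖ = 1) {t : ℝ} (ht : 0 < t) :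
    (!₂[((2 / 3 * t) • x) 0, ((2 / 3 * t) • x) 1, ((2 / 3 * t) • x) 2, ((2 / 3 * t) • x) 3,
      loFun ((2 / 3 * t) • x) 0, loFun ((2 / 3 * t) • x) 1, loFun ((2 / 3 * t) • x) 2] : Euc 7)
      = t • frame 0 x := by
  have h : loFun ((2 / 3 * t) • x) = (√5 / 3 * t) • hopfPol x x := by
    rw [loFun, normalize_smul hx (by positivity), norm_pos_smul hx (by positivity), hopf_eq]
    congr 1; ring
  rw [h]
  ext j
  fin_cases j <;> simp [frame, frameLin, join_apply] <;> ring

theorem mem_cone_iff {p : Euc 7} :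
    p ∈ loCone \ {0} ↔ ∃ t : ℝ, 0 < t ∧ ∃ x : Euc 4, ‖x‖ = 1 ∧ p = t • frame 0 x := by
  constructor
  · rintro ⟨⟨y, rfl⟩, hy⟩
    have hy0 : y ≠ 0 := by
      rintro rfl
      apply hy
      ext j
      fin_cases j <;> simp [loFun]
    have hyn : 0 < ‖y‖ := norm_pos_iff.2 hy0
    have hx : ‖‖y‖⁻¹ • y‖ = 1 := by rw [norm_smul, norm_inv, norm_norm, inv_mul_cancel₀ hyn.ne']
    refine ⟨3 / 2 * ‖y‖, by positivity, ‖y‖⁻¹ • y, hx, ?_⟩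
    have h := cone_point_eq hx (t := 3 / 2 * ‖y‖) (by positivity)
    rw [smul_smul, show 2 / 3 * (3 / 2 * ‖y‖) * ‖y‖⁻¹ = 1 by field_simp, one_smul] at h
    exact h
  · rintro ⟨t, ht, x, hx, rfl⟩
    refine ⟨⟨(2 / 3 * t) • x, cone_point_eq hx ht⟩, ?_⟩
    rw [Set.mem_singleton_iff, ← norm_eq_zero, norm_pos_smul (norm_frame_zero hx) ht]
    exact ht.ne'

theorem mem_link_iff {p : Euc 7} : p ∈ loLink ↔ ∃ x : Euc 4, ‖x‖ = 1 ∧ p = frame 0 x := by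
  constructor
  · rintro ⟨h1, h2⟩
    have hp : ‖p‖ = 1 := by simpa [sphere6] using h2
    have h0 : p ∉ ({0} : Set (Euc 7)) := by
      rintro rfl; simp at hp
    obtain ⟨t, ht, x, hx, rfl⟩ := mem_cone_iff.1 ⟨h1, h0⟩
    rw [norm_pos_smul (norm_frame_zero hx) ht] at hp
    exact ⟨x, hx, by rw [hp, one_smul]⟩
  · rintro ⟨x, hx, rfl⟩
    refine ⟨(mem_cone_iff.2 ⟨1, one_pos, x, hx, by rw [one_smul]⟩).1, ?_⟩
    simpa [sphere6] using norm_frame_zero hx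

theorem frame_zero_mem_link {x : Euc 4} (hx : ‖x‖ = 1) : frame 0 x ∈ loLink :=
  mem_link_iff.2 ⟨x, hx, rfl⟩

theorem smul_frame_zero_mem_cone {x : Euc 4} (hx : ‖x‖ = 1) {t : ℝ} (ht : 0 < t) :
    t • frame 0 x ∈ loCone \ {0} :=
  mem_cone_iff.2 ⟨t, ht, x, hx, rfl⟩

/-! ### Tangent and normal spaces -/

theorem fderiv_frame_zero (i : Fin 3) (x : Euc 4) :
    fderiv ℝ (frame 0) x (vf i x) = frame (i.succ.castLE (by omega)) x := by
  rw [fderiv_frame]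
  fin_cases i <;> simp [structConst, Fin.sum_univ_succ]

theorem differentiable_frame (A : Fin 7) : Differentiable ℝ (frame A) :=
  (contDiff_frame A).differentiable (by simp)

theorem frame_expansion {x : Euc 4} (hx : ‖x‖ = 1) (v : Euc 7) :
    v = ∑ A, ((frameSq A)⁻¹ * inner ℝ (frame A x) v) • frame A x := by
  have hn : ∀ A, frameSq A ≠ 0 := fun A => by fin_cases A <;> simp [frameSq]
  have hli : LinearIndependent ℝ fun A => frame A x := by
    rw [Fintype.linearIndependent_iff]
    intro g hg i
    have := congrArg (fun z => inner ℝ (frame i x) z) hg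
    simp only [inner_sum, inner_smul_right, inner_frame hx, inner_zero_right, mul_ite, mul_zero,
      Finset.sum_ite_eq, Finset.mem_univ, if_true] at this
    exact (mul_eq_zero.1 this).resolve_right (hn i)
  have htop : Submodule.span ℝ (Set.range fun A => frame A x) = ⊤ :=
    hli.span_eq_top_of_card_eq_finrank (by simp)
  have := starProjection_span_range (fun A => frame A x) frameSq hn (inner_frame hx) v
  rwa [htop, Submodule.starProjection_top'] at this

/-- Velocities of curves in the cone. -/
theorem velocity_eq {γ : ℝ → Euc 7} (hγ : ContDiff ℝ ∞ γ) (hS : ∀ s, γ s ∈ loCone \ {0})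
    {t : ℝ} (ht : 0 < t) {x : Euc 4} (hx : ‖x‖ = 1) (h0 : γ 0 = t • frame 0 x) :
    ∃ (c : ℝ) (b : Fin 3 → ℝ), deriv γ 0 =
      c • frame 0 x + ∑ i : Fin 3, b i • frame (i.succ.castLE (by omega)) x := by
  have hd : HasDerivAt γ (deriv γ 0) 0 := (hγ.differentiable (by simp) 0).hasDerivAt
  obtain ⟨L, hL, hLt, hLr⟩ := hasFDerivAt_hom 1 hx ht (differentiable_frame 0 x)
  have hpr0 : pr (γ 0) = t • x := by rw [h0, map_smul, pr_frame_zero]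
  have h1 : HasDerivAt (fun s => pr (γ s)) (pr (deriv γ 0)) 0 :=
    pr.hasFDerivAt.comp_hasDerivAt 0 hd
  rw [← hpr0] at hL
  have h2 : HasDerivAt (fun s => hom 1 (frame 0) (pr (γ s))) (L (pr (deriv γ 0))) 0 :=
    HasFDerivAt.comp_hasDerivAt (f := fun s => pr (γ s)) 0 hL h1
  have h3 : (fun s => hom 1 (frame 0) (pr (γ s))) = γ := by
    funext s
    obtain ⟨r, hr, z, hz, h⟩ := mem_cone_iff.1 (hS s)
    rw [h, map_smul, pr_frame_zero, hom_smul 1 _ hz hr, zpow_one]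
  rw [h3] at h2
  refine ⟨inner ℝ x (pr (deriv γ 0)), fun i => inner ℝ (vf i x) (pr (deriv γ 0)), ?_⟩
  rw [hd.unique h2]
  conv_lhs => rw [eq_sum_vf hx (pr (deriv γ 0))]
  rw [← hd.unique h2, map_add, map_smul, hLr, map_sum]
  congr 1
  · simp
  · refine Finset.sum_congr rfl fun i _ => ?_
    rw [map_smul, hLt _ (inner_vf_self i x), fderiv_frame_zero]
    simp

theorem frame_succ_velocity {S : Set (Euc 7)} {t : ℝ} (i : Fin 3) {x : Euc 4} (hx : ‖x‖ = 1)
    (hS : ∀ z, ‖z‖ = 1 → t • frame 0 z ∈ S) (ht : 0 < t) :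
    frame (i.succ.castLE (by omega)) x ∈ tangentSpace S (t • frame 0 x) := by
  have hmem : t • frame (i.succ.castLE (by omega)) x ∈ tangentSpace S (t • frame 0 x) := by
    have hc := ((Real.hasDerivAt_cos 0).smul_const x).add
      ((Real.hasDerivAt_sin 0).smul_const (vf i x))
    have hcc : ContDiff ℝ ∞ (fun s : ℝ => Real.cos s • x + Real.sin s • vf i x) :=
      (Real.contDiff_cos.smul contDiff_const).add (Real.contDiff_sin.smul contDiff_const)
    refine Submodule.subset_span
      ⟨fun s => t • frame 0 (Real.cos s • x + Real.sin s • vf i x), ?_, ?_, by simp, ?_⟩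
    · exact ((contDiff_frame 0).comp hcc).const_smul t
    · intro s
      apply hS
      rw [← sq_eq_sq₀ (norm_nonneg _) zero_le_one, norm_add_sq_real, norm_smul, norm_smul, norm_vf,
        hx, inner_smul_left, inner_smul_right, inner_vf_self]
      simp
    · have hf : HasFDerivAt (frame 0) (fderiv ℝ (frame 0) x)
          (Real.cos 0 • x + Real.sin 0 • vf i x) := by
        simpa using (differentiable_frame 0 x).hasFDerivAt
      have := ((hf.comp_hasDerivAt (0 : ℝ) hc).const_smul t).deriv
      simp only [Real.sin_zero, Real.cos_zero, neg_zero, zero_smul, one_smul, zero_add,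
        fderiv_frame_zero] at this
      exact this
  have := Submodule.smul_mem _ t⁻¹ hmem
  rwa [smul_smul, inv_mul_cancel₀ ht.ne', one_smul] at this

theorem frame_zero_velocity {t : ℝ} {x : Euc 4} (hx : ‖x‖ = 1) (ht : 0 < t) :
    frame 0 x ∈ tangentSpace (loCone \ {0}) (t • frame 0 x) := by
  have hmem : t • frame 0 x ∈ tangentSpace (loCone \ {0}) (t • frame 0 x) := by
    refine Submodule.subset_span
      ⟨fun s => Real.exp s • t • frame 0 x, ?_, ?_, by simp, ?_⟩
    · exact Real.contDiff_exp.smul contDiff_const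
    · intro s
      dsimp only
      rw [smul_smul]
      exact smul_frame_zero_mem_cone hx (mul_pos (Real.exp_pos s) ht)
    · have := ((Real.hasDerivAt_exp 0).smul_const (t • frame 0 x)).deriv
      simpa using this
  have := Submodule.smul_mem _ t⁻¹ hmem
  rwa [smul_smul, inv_mul_cancel₀ ht.ne', one_smul] at this

/-- Indices of the frame fields tangent to the link. -/
def linkIdx : Fin 3 → Fin 7 := ![1, 2, 3]

/-- Indices of the frame fields tangent to the cone. -/
def coneIdx : Fin 4 → Fin 7 := ![0, 1, 2, 3]

/-- Indices of the normal frame fields. -/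
def norIdx : Fin 3 → Fin 7 := ![4, 5, 6]

theorem succ_castLE (i : Fin 3) : (i.succ.castLE (by omega) : Fin 7) = linkIdx i := by
  fin_cases i <;> rfl

theorem tangentSpace_cone {t : ℝ} {x : Euc 4} (hx : ‖x‖ = 1) (ht : 0 < t) :
    tangentSpace (loCone \ {0}) (t • frame 0 x)
      = Submodule.span ℝ (Set.range fun i => frame (coneIdx i) x) := by
  apply le_antisymm
  · refine Submodule.span_le.2 ?_
    rintro v ⟨γ, hγ, hS, h0, rfl⟩
    obtain ⟨c, b, h⟩ := velocity_eq hγ hS ht hx h0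
    rw [h]
    refine Submodule.add_mem _ (Submodule.smul_mem _ _ (Submodule.subset_span ⟨0, rfl⟩))
      (Submodule.sum_mem _ fun i _ => Submodule.smul_mem _ _ (Submodule.subset_span ⟨i.succ, ?_⟩))
    fin_cases i <;> rfl
  · refine Submodule.span_le.2 ?_
    rintro _ ⟨i, rfl⟩
    refine Fin.cases ?_ (fun i => ?_) i
    · exact frame_zero_velocity hx ht
    · have := frame_succ_velocity i hx (fun z hz => smul_frame_zero_mem_cone hz ht) ht
      fin_cases i <;> exact this

theorem tangentSpace_link {x : Euc 4} (hx : ‖x‖ = 1) :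
    tangentSpace loLink (frame 0 x)
      = Submodule.span ℝ (Set.range fun i => frame (linkIdx i) x) := by
  apply le_antisymm
  · refine Submodule.span_le.2 ?_
    rintro v ⟨γ, hγ, hS, h0, rfl⟩
    obtain ⟨c, b, h⟩ := velocity_eq hγ (fun s => by
      obtain ⟨z, hz, h⟩ := mem_link_iff.1 (hS s)
      rw [h]; simpa using smul_frame_zero_mem_cone hz one_pos) one_pos hx (by rw [h0, one_smul])
    -- velocities of curves in the sphere have no radial component
    have hperp : deriv γ 0 ∈ tangentSpace sphere6 (frame 0 x) :=
      Submodule.subset_span ⟨γ, hγ, fun s => (hS s).2, h0, rfl⟩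
    rw [sphere6, tangentSpace_sphere (by simpa using norm_frame_zero hx),
      Submodule.mem_orthogonal_singleton_iff_inner_right, h, inner_add_right, inner_smul_right,
      inner_frame hx, inner_sum] at hperp
    have hz : ∀ i : Fin 3, (0 : Fin 7) ≠ i.succ.castLE (by omega) := by decide
    simp only [inner_smul_right, inner_frame hx, hz, if_false, mul_zero, Finset.sum_const_zero,
      add_zero, if_true, frameSq, Matrix.cons_val_zero, mul_one] at hperp
    rw [h, hperp, zero_smul, zero_add]
    refine Submodule.sum_mem _ fun i _ => Submodule.smul_mem _ _ (Submodule.subset_span ⟨i, ?_⟩)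
    simp only [succ_castLE]
  · refine Submodule.span_le.2 ?_
    rintro _ ⟨i, rfl⟩
    have := frame_succ_velocity (S := loLink) (t := 1) i hx
      (fun z hz => by rw [one_smul]; exact frame_zero_mem_link hz) one_pos
    rwa [succ_castLE, one_smul] at this

/-- Orthogonal projection onto the normal space, in the frame. -/
def nor (x : Euc 4) (w : Euc 7) : Euc 7 :=
  ∑ β, ((frameSq (norIdx β))⁻¹ * inner ℝ (frame (norIdx β) x) w) • frame (norIdx β) x

theorem mem_span_nor {x : Euc 4} (hx : ‖x‖ = 1) {v : Euc 7}
    (h : ∀ i, inner ℝ (frame (coneIdx i) x) v = 0) :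
    v ∈ Submodule.span ℝ (Set.range fun β => frame (norIdx β) x) := by
  rw [frame_expansion hx v]
  refine Submodule.sum_mem _ fun A _ => ?_
  have h0 := h 0
  have h1 := h 1
  have h2 := h 2
  have h3 := h 3
  simp only [coneIdx] at h0 h1 h2 h3
  fin_cases A
  · simp at h0; simp [h0]
  · simp at h1; simp [h1]
  · simp at h2; simp [h2]
  · simp at h3; simp [h3]
  · exact Submodule.smul_mem _ _ (Submodule.subset_span ⟨0, rfl⟩)
  · exact Submodule.smul_mem _ _ (Submodule.subset_span ⟨1, rfl⟩)
  · exact Submodule.smul_mem _ _ (Submodule.subset_span ⟨2, rfl⟩)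

theorem normalSpace_cone {t : ℝ} {x : Euc 4} (hx : ‖x‖ = 1) (ht : 0 < t) :
    normalSpace Set.univ (loCone \ {0}) (t • frame 0 x)
      = Submodule.span ℝ (Set.range fun β => frame (norIdx β) x) := by
  rw [normalSpace, tangentSpace_univ, top_inf_eq, tangentSpace_cone hx ht]
  apply le_antisymm
  · intro v hv
    exact mem_span_nor hx fun i => hv _ (Submodule.subset_span ⟨i, rfl⟩)
  · rw [← Submodule.isOrtho_iff_le, Submodule.isOrtho_comm, Submodule.isOrtho_span]
    rintro _ ⟨i, rfl⟩ _ ⟨β, rfl⟩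
    dsimp only
    rw [inner_frame hx, if_neg]
    revert i β; decide

theorem normalSpace_link {x : Euc 4} (hx : ‖x‖ = 1) :
    normalSpace sphere6 loLink (frame 0 x)
      = Submodule.span ℝ (Set.range fun β => frame (norIdx β) x) := by
  rw [normalSpace, tangentSpace_link hx, sphere6,
    tangentSpace_sphere (by simpa using norm_frame_zero hx)]
  apply le_antisymm
  · rintro v ⟨h1, h2⟩
    refine mem_span_nor hx fun i => ?_
    refine Fin.cases ?_ (fun i => ?_) i
    · exact Submodule.mem_orthogonal_singleton_iff_inner_right.1 h1
    · have := h2 _ (Submodule.subset_span ⟨i, rfl⟩)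
      fin_cases i <;> exact this
  · refine Submodule.span_le.2 ?_
    rintro _ ⟨β, rfl⟩
    refine ⟨?_, ?_⟩
    · rw [SetLike.mem_coe, Submodule.mem_orthogonal_singleton_iff_inner_right, inner_frame hx,
        if_neg]
      revert β; decide
    · intro u hu
      induction hu using Submodule.span_induction with
      | mem v hv =>
        obtain ⟨i, rfl⟩ := hv
        dsimp only
        rw [inner_frame hx, if_neg]
        revert i β; decide
      | zero => simp
      | add a b _ _ ha hb => rw [inner_add_left, ha, hb, add_zero]
      | smul c a _ ha => rw [inner_smul_left, ha, mul_zero]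

theorem starProjection_nor {x : Euc 4} (hx : ‖x‖ = 1) (w : Euc 7) :
    (Submodule.span ℝ (Set.range fun β => frame (norIdx β) x)).starProjection w = nor x w :=
  starProjection_span_range (fun β => frame (norIdx β) x) (fun β => frameSq (norIdx β))
    (fun β => by fin_cases β <;> simp [frameSq, norIdx])
    (fun α β => by
      rw [inner_frame hx]
      have : norIdx α = norIdx β ↔ α = β := by revert α β; decide
      simp [this]) w

theorem norProj_cone {t : ℝ} {x : Euc 4} (hx : ‖x‖ = 1) (ht : 0 < t) (w : Euc 7) :
    norProj Set.univ (loCone \ {0}) (t • frame 0 x) w = nor x w := by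
  have key : (normalSpace Set.univ (loCone \ {0}) (t • frame 0 x)).starProjection w = nor x w := by
    rw [normalSpace_cone hx ht, starProjection_nor hx]
  exact key

theorem norProj_link {x : Euc 4} (hx : ‖x‖ = 1) (w : Euc 7) :
    norProj sphere6 loLink (frame 0 x) w = nor x w := by
  have key : (normalSpace sphere6 loLink (frame 0 x)).starProjection w = nor x w := by
    rw [normalSpace_link hx, starProjection_nor hx]
  exact key

/-! ### The Jacobi operator of the link and of the cone -/

/-- The derivative of `f` along the `i`-th unit vector field of `𝕊³`. -/
def D {F : Type*} [NormedAddCommGroup F] [NormedSpace ℝ F] (i : Fin 3) (f : Euc 4 → F)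
    (x : Euc 4) : F :=
  fderiv ℝ f x (vf i x)

/-- Smoothness on `ℝ⁴ \ {0}`. -/
def SmoothOff {F : Type*} [NormedAddCommGroup F] [NormedSpace ℝ F] (f : Euc 4 → F) : Prop :=
  ContDiffOn ℝ ∞ f {0}ᶜ

theorem ne_zero_of_norm_one {x : Euc 4} (hx : ‖x‖ = 1) : x ≠ 0 := by
  rintro rfl; simp at hx

namespace SmoothOff

variable {F : Type*} [NormedAddCommGroup F] [NormedSpace ℝ F] {f : Euc 4 → F}

theorem contDiffAt (h : SmoothOff f) {x : Euc 4} (hx : x ≠ 0) : ContDiffAt ℝ ∞ f x :=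
  ContDiffOn.contDiffAt h (isOpen_compl_singleton.mem_nhds hx)

theorem differentiableAt (h : SmoothOff f) {x : Euc 4} (hx : x ≠ 0) : DifferentiableAt ℝ f x :=
  (h.contDiffAt hx).differentiableAt (by simp)

theorem D (h : SmoothOff f) (i : Fin 3) : SmoothOff (D i f) := by
  have h1 : ContDiffOn ℝ ∞ (fderiv ℝ f) {0}ᶜ :=
    ContDiffOn.fderiv_of_isOpen h isOpen_compl_singleton (by simp)
  exact h1.clm_apply (vf i).contDiff.contDiffOn

theorem of_contDiff (h : ContDiff ℝ ∞ f) : SmoothOff f := h.contDiffOn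

end SmoothOff

/-- The normal field with coefficients `a` in the frame, as a function of the parameter `x ∈ 𝕊³`.
The values of `a` away from `𝕊³` do not matter. -/
def sec (a : Fin 3 → Euc 4 → ℝ) (x : Euc 4) : Euc 7 :=
  ∑ β, a β x • frame (norIdx β) x

/-- Coefficients of the normal covariant derivative along the `i`-th vector field. -/
def cov (i : Fin 3) (a : Fin 3 → Euc 4 → ℝ) (β : Fin 3) (x : Euc 4) : ℝ :=
  D i (a β) x + ∑ α, a α x * structConst i (norIdx α) (norIdx β)

theorem SmoothOff.cov {a : Fin 3 → Euc 4 → ℝ} (ha : ∀ β, SmoothOff (a β)) (i β : Fin 3) :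
    SmoothOff (cov i a β) :=
  ((ha β).D i).add (ContDiffOn.sum fun α _ => (ha α).mul contDiffOn_const)

theorem inner_nor_nor {x : Euc 4} (hx : ‖x‖ = 1) (α β : Fin 3) :
    inner ℝ (frame (norIdx α) x) (frame (norIdx β) x)
      = if α = β then frameSq (norIdx α) else 0 := by
  rw [inner_frame hx]
  have : norIdx α = norIdx β ↔ α = β := by revert α β; decide
  simp [this]

theorem frameSq_norIdx_ne_zero (β : Fin 3) : frameSq (norIdx β) ≠ 0 := by
  fin_cases β <;> simp [frameSq, norIdx]

theorem nor_sum_frame {x : Euc 4} (hx : ‖x‖ = 1) (c : Fin 7 → ℝ) :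
    nor x (∑ B, c B • frame B x) = ∑ β, c (norIdx β) • frame (norIdx β) x := by
  refine Finset.sum_congr rfl fun β _ => ?_
  simp only [inner_sum, inner_smul_right, inner_frame hx, mul_ite, mul_zero,
    Finset.sum_ite_eq, Finset.mem_univ, if_true]
  have := frameSq_norIdx_ne_zero β
  congr 1
  field_simp

theorem nor_add (x : Euc 4) (v w : Euc 7) : nor x (v + w) = nor x v + nor x w := by
  simp only [nor, inner_add_right, mul_add, add_smul, Finset.sum_add_distrib]

theorem nor_smul (x : Euc 4) (c : ℝ) (v : Euc 7) : nor x (c • v) = c • nor x v := by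
  simp only [nor, inner_smul_right, Finset.smul_sum, smul_smul]
  refine Finset.sum_congr rfl fun β _ => ?_
  congr 1; ring

theorem nor_zero (x : Euc 4) : nor x 0 = 0 := by simp [nor]

theorem nor_sec {x : Euc 4} (hx : ‖x‖ = 1) (a : Fin 3 → Euc 4 → ℝ) : nor x (sec a x) = sec a x := by
  refine Finset.sum_congr rfl fun β _ => ?_
  rw [sec]
  simp only [inner_sum, inner_smul_right, inner_nor_nor hx, mul_ite, mul_zero,
    Finset.sum_ite_eq, Finset.mem_univ, if_true]
  have := frameSq_norIdx_ne_zero β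
  congr 1
  field_simp

theorem nor_frame_link {x : Euc 4} (hx : ‖x‖ = 1) (i : Fin 3) :
    nor x (frame (linkIdx i) x) = 0 := by
  refine Finset.sum_eq_zero fun β _ => ?_
  rw [inner_frame hx, if_neg (by revert i β; decide), mul_zero, zero_smul]

theorem hasFDerivAt_sec {a : Fin 3 → Euc 4 → ℝ} (ha : ∀ β, SmoothOff (a β)) {x : Euc 4}
    (hx : x ≠ 0) : HasFDerivAt (sec a) (∑ β, (a β x • fderiv ℝ (frame (norIdx β)) x
      + (fderiv ℝ (a β) x).smulRight (frame (norIdx β) x))) x :=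
  HasFDerivAt.fun_sum fun β _ => ((ha β).differentiableAt hx).hasFDerivAt.smul
    (differentiable_frame _ x).hasFDerivAt

theorem nor_fderiv_sec {a : Fin 3 → Euc 4 → ℝ} (ha : ∀ β, SmoothOff (a β)) {x : Euc 4}
    (hx : ‖x‖ = 1) (i : Fin 3) : nor x (fderiv ℝ (sec a) x (vf i x)) = sec (cov i a) x := by
  rw [(hasFDerivAt_sec ha (ne_zero_of_norm_one hx)).fderiv]
  simp only [sum_apply, add_apply, smul_apply, ContinuousLinearMap.smulRight_apply, fderiv_frame]
  rw [Finset.sum_add_distrib, nor_add]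
  have h1 : ∑ β, a β x • ∑ B, structConst i (norIdx β) B • frame B x
      = ∑ B, (∑ β, a β x * structConst i (norIdx β) B) • frame B x := by
    simp only [Finset.smul_sum, smul_smul, Finset.sum_smul]
    exact Finset.sum_comm
  have h2 : ∑ β, (fderiv ℝ (a β) x) (vf i x) • frame (norIdx β) x
      = sec (fun β => D i (a β)) x := rfl
  rw [h1, nor_sum_frame hx, h2, nor_sec hx]
  simp only [sec, cov, add_smul, Finset.sum_add_distrib]
  rw [add_comm]

/-- The frame field with index `A` as a vector field along the cone, constant along rays. -/
def frameField (A : Fin 7) (q : Euc 7) : Euc 7 := hom 0 (frame A) (pr q)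

theorem pr_smul_frame_zero (t : ℝ) (x : Euc 4) : pr (t • frame 0 x) = t • x := by
  rw [map_smul, pr_frame_zero]

theorem pr_frame_link (i : Fin 3) (x : Euc 4) : pr (frame (linkIdx i) x) = vf i x := by
  rw [← succ_castLE, pr_frame_succ]

theorem frameField_smul (A : Fin 7) {x : Euc 4} (hx : ‖x‖ = 1) {t : ℝ} (ht : 0 < t) :
    frameField A (t • frame 0 x) = frame A x := by
  rw [frameField, pr_smul_frame_zero, hom_smul 0 _ hx ht, zpow_zero, one_smul]

theorem frameField_frame_zero (A : Fin 7) {x : Euc 4} (hx : ‖x‖ = 1) :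
    frameField A (frame 0 x) = frame A x := by
  simpa using frameField_smul A hx one_pos

theorem hasFDerivAt_hom_pr (d : ℤ) {g : Euc 4 → Euc 7} {x : Euc 4} (hx : ‖x‖ = 1) {t : ℝ}
    (ht : 0 < t) (hg : DifferentiableAt ℝ g x) :
    ∃ L : Euc 7 →L[ℝ] Euc 7, HasFDerivAt (fun q => hom d g (pr q)) L (t • frame 0 x) ∧
      (∀ i, L (frame (linkIdx i) x) = t ^ (d - 1) • fderiv ℝ g x (vf i x)) ∧
      L (frame 0 x) = (d * t ^ (d - 1)) • g x := by
  obtain ⟨L, hL, h1, h2⟩ := hasFDerivAt_hom d hx ht hg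
  rw [← pr_smul_frame_zero] at hL
  refine ⟨L.comp pr, hL.comp _ pr.hasFDerivAt, fun i => ?_, ?_⟩
  · rw [ContinuousLinearMap.comp_apply, pr_frame_link, h1 _ (inner_vf_self i x)]
  · rw [ContinuousLinearMap.comp_apply, pr_frame_zero, h2]

theorem isOrthoFrame_cone : IsOrthoFrame (loCone \ {0}) (fun i => frameField (coneIdx i))
    (fun i => frameSq (coneIdx i)) where
  span_eq q hq := by
    obtain ⟨t, ht, x, hx, rfl⟩ := mem_cone_iff.1 hq
    simp only [frameField_smul _ hx ht, tangentSpace_cone hx ht]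
  inner_eq q hq i j := by
    obtain ⟨t, ht, x, hx, rfl⟩ := mem_cone_iff.1 hq
    rw [frameField_smul _ hx ht, frameField_smul _ hx ht, inner_frame hx]
    have : coneIdx i = coneIdx j ↔ i = j := by revert i j; decide
    simp [this]
  ne_zero i := by fin_cases i <;> simp [frameSq, coneIdx]
  diff i q hq := by
    obtain ⟨t, ht, x, hx, rfl⟩ := mem_cone_iff.1 hq
    obtain ⟨L, hL, -⟩ := hasFDerivAt_hom_pr 0 hx ht (differentiable_frame (coneIdx i) x)
    exact hL.differentiableAt.differentiableWithinAt

theorem isOrthoFrame_link : IsOrthoFrame loLink (fun i => frameField (linkIdx i))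
    (fun i => frameSq (linkIdx i)) where
  span_eq q hq := by
    obtain ⟨x, hx, rfl⟩ := mem_link_iff.1 hq
    simp only [frameField_frame_zero _ hx, tangentSpace_link hx]
  inner_eq q hq i j := by
    obtain ⟨x, hx, rfl⟩ := mem_link_iff.1 hq
    rw [frameField_frame_zero _ hx, frameField_frame_zero _ hx, inner_frame hx]
    have : linkIdx i = linkIdx j ↔ i = j := by revert i j; decide
    simp [this]
  ne_zero i := by fin_cases i <;> simp [frameSq, linkIdx]
  diff i q hq := by
    obtain ⟨x, hx, rfl⟩ := mem_link_iff.1 hq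
    obtain ⟨L, hL, -⟩ := hasFDerivAt_hom_pr 0 hx one_pos (differentiable_frame (linkIdx i) x)
    rw [one_smul] at hL
    exact hL.differentiableAt.differentiableWithinAt

/-- The scalar part `∑ (length)⁻² X_i²` of the Jacobi operator. -/
def lap (f : Euc 4 → ℝ) (x : Euc 4) : ℝ :=
  3 / 8 * (D 0 (D 0 f) x + D 1 (D 1 f) x) + 9 / 4 * D 2 (D 2 f) x

/-- The Jacobi operator of the link on the coefficients of a normal field; see `jacobiOp_link`. It
has constant coefficients with respect to the vector fields `vf i`. -/
def jop (a : Fin 3 → Euc 4 → ℝ) : Fin 3 → Euc 4 → ℝ :=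
  ![fun x => lap (a 0) x + 3 / 2 * (D 0 (a 1) x + D 1 (a 2) x) + 15 / 4 * a 0 x,
    fun x => lap (a 1) x - 9 / 16 * D 0 (a 0) x + 21 / 4 * D 2 (a 2) x,
    fun x => lap (a 2) x - 9 / 16 * D 1 (a 0) x - 21 / 4 * D 2 (a 1) x]

/-- The second fundamental form on the frame fields. -/
def sff (i j : Fin 3) (x : Euc 4) : Euc 7 :=
  ∑ β, structConst i (linkIdx j) (norIdx β) • frame (norIdx β) x

theorem inner_sff_sec {x : Euc 4} (hx : ‖x‖ = 1) (i j : Fin 3) (a : Fin 3 → Euc 4 → ℝ) :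
    inner ℝ (sff i j x) (sec a x)
      = ∑ β, structConst i (linkIdx j) (norIdx β) * (frameSq (norIdx β) * a β x) := by
  simp only [sff, sec, sum_inner, inner_sum, inner_smul_left, inner_smul_right, inner_nor_nor hx,
    mul_ite, mul_zero]
  refine Finset.sum_congr rfl fun β _ => ?_
  simp
  ring

/-- The second covariant derivative, with `structConst` entering through its constancy. -/
theorem cov_cov {a : Fin 3 → Euc 4 → ℝ} (ha : ∀ β, SmoothOff (a β)) {x : Euc 4} (hx : x ≠ 0)
    (i β : Fin 3) : cov i (cov i a) β x = D i (D i (a β)) x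
      + ∑ α, D i (a α) x * structConst i (norIdx α) (norIdx β)
      + ∑ α, cov i a α x * structConst i (norIdx α) (norIdx β) := by
  have h : HasFDerivAt (cov i a β) (fderiv ℝ (D i (a β)) x
      + ∑ α, structConst i (norIdx α) (norIdx β) • fderiv ℝ (a α) x) x :=
    (((ha β).D i).differentiableAt hx).hasFDerivAt.add (HasFDerivAt.fun_sum fun α _ =>
      ((ha α).differentiableAt hx).hasFDerivAt.mul_const _)
  rw [cov, D, h.fderiv]
  simp [sum_apply, D, mul_comm]

/-- The three terms of the Jacobi operator of the link add up to `jop`; the summand `3` is the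
curvature of the sphere. -/
theorem sec_jop {a : Fin 3 → Euc 4 → ℝ} (ha : ∀ β, SmoothOff (a β)) {x : Euc 4} (hx : ‖x‖ = 1) :
    ∑ i, (frameSq (linkIdx i))⁻¹ • sec (cov i (cov i a)) x
      + ∑ i, ∑ j, ((frameSq (linkIdx i))⁻¹ * (frameSq (linkIdx j))⁻¹
        * inner ℝ (sff i j x) (sec a x)) • sff i j x
      + (3 : ℝ) • sec a x = sec (jop a) x := by
  simp only [inner_sff_sec hx]
  simp only [sec, sff, cov_cov ha (ne_zero_of_norm_one hx)]
  simp only [cov, Fin.sum_univ_three]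
  simp [linkIdx, norIdx, structConst, frameSq, jop, lap]
  module

theorem nor_fderiv_frame_link {x : Euc 4} (hx : ‖x‖ = 1) (i j : Fin 3) :
    nor x (fderiv ℝ (frame (linkIdx j)) x (vf i x)) = sff i j x := by
  rw [fderiv_frame, nor_sum_frame hx]; rfl

/-- The Jacobi operator of the link acts on coefficients as `jop`. -/
theorem jacobiOp_link {Y : Euc 7 → Euc 7} {a : Fin 3 → Euc 4 → ℝ} (ha : ∀ β, SmoothOff (a β))
    (hY : ∀ x, ‖x‖ = 1 → Y (frame 0 x) = sec a x) {x : Euc 4} (hx : ‖x‖ = 1) :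
    jacobiOp sphere6 loLink Y (frame 0 x) = sec (jop a) x := by
  have hp := frame_zero_mem_link hx
  have hmem : ∀ {z : Euc 4}, ‖z‖ = 1 → ∀ i, frame (linkIdx i) z ∈ tangentSpace loLink (frame 0 z) :=
    fun hz i => by rw [tangentSpace_link hz]; exact Submodule.subset_span ⟨i, rfl⟩
  -- derivatives of fields extended constantly along rays
  have hder : ∀ {Z : Euc 7 → Euc 7} {g : Euc 4 → Euc 7} {z : Euc 4}, ‖z‖ = 1 →
      DifferentiableAt ℝ g z → (∀ y, ‖y‖ = 1 → Z (frame 0 y) = g y) → ∀ i,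
      fderivWithin ℝ Z loLink (frame 0 z) (frame (linkIdx i) z) = fderiv ℝ g z (vf i z) := by
    intro Z g z hz hg hZ i
    obtain ⟨L, hL, h1, -⟩ := hasFDerivAt_hom_pr 0 hz one_pos hg
    rw [one_smul] at hL
    rw [fderivWithin_eq_of_eqOn ?_ (frame_zero_mem_link hz) hL (hmem hz i), h1 i]
    · simp
    · intro q hq
      obtain ⟨y, hy, rfl⟩ := mem_link_iff.1 hq
      have := hom_smul 0 g hy one_pos
      rw [one_smul, zpow_zero, one_smul] at this
      change Z (frame 0 y) = hom 0 g (pr (frame 0 y))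
      rw [hZ y hy, pr_frame_zero, this]
  have hsec : ∀ {b : Fin 3 → Euc 4 → ℝ}, (∀ β, SmoothOff (b β)) → ∀ {z : Euc 4}, ‖z‖ = 1 →
      DifferentiableAt ℝ (sec b) z := fun hb z hz =>
    (hasFDerivAt_sec hb (ne_zero_of_norm_one hz)).differentiableAt
  have hcov := fun i => SmoothOff.cov ha i
  set W : Fin 3 → Euc 7 → Euc 7 := fun i q => hom 0 (sec (cov i a)) (pr q)
  have hW : ∀ i, ∀ z, ‖z‖ = 1 → W i (frame 0 z) = sec (cov i a) z := by
    intro i z hz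
    have := hom_smul 0 (sec (cov i a)) hz one_pos
    rw [one_smul, zpow_zero, one_smul] at this
    simp only [W, pr_frame_zero, this]
  have hlap := isOrthoFrame_link.normalLaplacian_eq sphere6 hp (Y := Y) (W := W) (by
    intro i q hq
    obtain ⟨z, hz, rfl⟩ := mem_link_iff.1 hq
    rw [hW i z hz, frameField_frame_zero _ hz, hder hz (hsec ha hz) hY, norProj_link hz,
      nor_fderiv_sec ha hz]) (by
    intro i
    obtain ⟨L, hL, -⟩ := hasFDerivAt_hom_pr 0 hx one_pos (hsec (hcov i) hx)
    rw [one_smul] at hL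
    exact hL.differentiableAt.differentiableWithinAt)
  have hff := fun i j => hder hx (differentiable_frame (linkIdx j) x)
    (fun y hy => frameField_frame_zero (linkIdx j) hy) i
  -- the frame fields are geodesic in the link
  have hgeo : ∀ i, tanProj loLink (frame 0 x)
      (fderiv ℝ (frame (linkIdx i)) x (vf i x)) = 0 := by
    intro i
    rw [fderiv_frame, isOrthoFrame_link.tanProj_eq hp]
    refine Finset.sum_eq_zero fun j _ => ?_
    rw [IsOrthoFrame.coord, frameField_frame_zero _ hx]
    simp only [inner_sum, inner_smul_right, inner_frame hx, mul_ite, mul_zero,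
      Finset.sum_ite_eq, Finset.mem_univ, if_true]
    fin_cases i <;> fin_cases j <;> simp [structConst, linkIdx]
  have hYp : Y (frame 0 x) ∈ normalSpace sphere6 loLink (frame 0 x) := by
    rw [normalSpace_link hx, hY x hx]
    exact Submodule.sum_mem _ fun β _ => Submodule.smul_mem _ _ (Submodule.subset_span ⟨β, rfl⟩)
  have hcurv : curvatureOp sphere6 loLink (frame 0 x) (Y (frame 0 x)) = (3 : ℝ) • sec a x := by
    have := curvatureOp_sphere (S := loLink) (p := frame 0 x) (by simpa using norm_frame_zero hx)
      (fun v hv => by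
        rw [tangentSpace_sphere (by simpa using norm_frame_zero hx),
          Submodule.mem_orthogonal_singleton_iff_inner_right]
        rw [tangentSpace_link hx] at hv
        induction hv using Submodule.span_induction with
        | mem v hv =>
          obtain ⟨i, rfl⟩ := hv
          dsimp only
          rw [inner_frame hx, if_neg]
          revert i; decide
        | zero => simp
        | add a b _ _ ha hb => rw [inner_add_right, ha, hb, add_zero]
        | smul c a _ ha => rw [inner_smul_right, ha, mul_zero]) hYp
    rw [isOrthoFrame_link.finrank_tangentSpace hp, Fintype.card_fin] at this
    rw [sphere6, this, hY x hx]
    norm_num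
  rw [jacobiOp, hlap, isOrthoFrame_link.simonsOp_eq sphere6 hp, hcurv, ← sec_jop ha hx]
  simp only [frameField_frame_zero _ hx, hff, hgeo, map_zero, norProj_link hx, nor_zero, sub_zero,
    nor_fderiv_frame_link hx, hY x hx, fun i => hder hx (hsec (hcov i) hx) (hW i) i,
    nor_fderiv_sec (hcov _) hx]

theorem coneIdx_succ (i : Fin 3) : coneIdx i.succ = linkIdx i := by revert i; decide

/-- The Jacobi operator of the cone on fields homogeneous of degree `d`: the radial terms add
`d (d - 1) + 3 d`, and the curvature term `3` of the sphere is absent. -/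
theorem jacobiOp_cone (d : ℤ) {Z : Euc 7 → Euc 7} {a : Fin 3 → Euc 4 → ℝ}
    (ha : ∀ β, SmoothOff (a β))
    (hZ : ∀ t : ℝ, 0 < t → ∀ x, ‖x‖ = 1 → Z (t • frame 0 x) = t ^ d • sec a x) {x : Euc 4}
    (hx : ‖x‖ = 1) : jacobiOp Set.univ (loCone \ {0}) Z (frame 0 x)
      = sec (jop a) x + (d * (d - 1) + 3 * d - 3 : ℝ) • sec a x := by
  have hS : ∀ {t : ℝ}, 0 < t → ∀ {z}, ‖z‖ = 1 → t • frame 0 z ∈ (loCone \ {0}) := fun ht _ hz =>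
    smul_frame_zero_mem_cone hz ht
  have hp : frame 0 x ∈ (loCone \ {0}) := by simpa using hS one_pos hx
  have hmem : ∀ {t : ℝ}, 0 < t → ∀ {z : Euc 4}, ‖z‖ = 1 → ∀ i,
      frame (coneIdx i) z ∈ tangentSpace (loCone \ {0}) (t • frame 0 z) :=
    fun ht _ hz i => by rw [tangentSpace_cone hz ht]; exact Submodule.subset_span ⟨i, rfl⟩
  have hder : ∀ {Z : Euc 7 → Euc 7} {k : ℤ} {g : Euc 4 → Euc 7} {t : ℝ}, 0 < t →
      ∀ {z : Euc 4}, ‖z‖ = 1 → DifferentiableAt ℝ g z →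
      (∀ t : ℝ, 0 < t → ∀ y, ‖y‖ = 1 → Z (t • frame 0 y) = t ^ k • g y) →
      (∀ i, fderivWithin ℝ Z (loCone \ {0}) (t • frame 0 z) (frame (linkIdx i) z)
        = t ^ (k - 1) • fderiv ℝ g z (vf i z)) ∧
      fderivWithin ℝ Z (loCone \ {0}) (t • frame 0 z) (frame 0 z) = (k * t ^ (k - 1)) • g z := by
    intro Z k g t ht z hz hg hZ
    obtain ⟨L, hL, h1, h2⟩ := hasFDerivAt_hom_pr k hz ht hg
    have heq : Set.EqOn Z (fun q => hom k g (pr q)) (loCone \ {0}) := by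
      intro q hq
      obtain ⟨s, hs, y, hy, rfl⟩ := mem_cone_iff.1 hq
      change _ = hom k g (pr (s • frame 0 y))
      rw [hZ s hs y hy, pr_smul_frame_zero, hom_smul k g hy hs]
    refine ⟨fun i => ?_, ?_⟩
    · have hm := hmem ht hz i.succ
      rw [coneIdx_succ] at hm
      rw [fderivWithin_eq_of_eqOn heq (hS ht hz) hL hm, h1 i]
    · exact (fderivWithin_eq_of_eqOn heq (hS ht hz) hL (hmem ht hz 0)).trans h2
  have hsec : ∀ {b : Fin 3 → Euc 4 → ℝ}, (∀ β, SmoothOff (b β)) → ∀ {z : Euc 4}, ‖z‖ = 1 →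
      DifferentiableAt ℝ (sec b) z := fun hb z hz =>
    (hasFDerivAt_sec hb (ne_zero_of_norm_one hz)).differentiableAt
  have hcov := fun i => SmoothOff.cov ha i
  set G : Fin 4 → Euc 4 → Euc 7 :=
    Fin.cons (fun z => (d : ℝ) • sec a z) (fun i => sec (cov i a)) with hG
  have hGd : ∀ i {z : Euc 4}, ‖z‖ = 1 → DifferentiableAt ℝ (G i) z := by
    intro i z hz
    refine Fin.cases ?_ (fun i => ?_) i
    · exact (hsec ha hz).const_smul (d : ℝ)
    · exact hsec (hcov i) hz
  set W : Fin 4 → Euc 7 → Euc 7 := fun i q => hom (d - 1) (G i) (pr q)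
  have hW : ∀ i (t : ℝ), 0 < t → ∀ z, ‖z‖ = 1 → W i (t • frame 0 z) = t ^ (d - 1) • G i z := by
    intro i t ht z hz
    simp only [W, pr_smul_frame_zero, hom_smul (d - 1) _ hz ht]
  have hlap := isOrthoFrame_cone.normalLaplacian_eq Set.univ hp (Y := Z) (W := W) (by
    intro i q hq
    obtain ⟨t, ht, z, hz, rfl⟩ := mem_cone_iff.1 hq
    rw [hW i t ht z hz, frameField_smul _ hz ht, norProj_cone hz ht]
    have h := hder ht hz (hsec ha hz) hZ
    refine Fin.cases ?_ (fun i => ?_) i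
    · change _ = nor z (fderivWithin ℝ Z (loCone \ {0}) (t • frame 0 z) (frame 0 z))
      rw [h.2, nor_smul, nor_sec hz]
      change t ^ (d - 1) • (d : ℝ) • sec a z = _
      rw [smul_smul, mul_comm]
    · rw [coneIdx_succ, h.1 i, nor_smul, nor_fderiv_sec ha hz]
      rfl) (by
    intro i
    obtain ⟨L, hL, -⟩ := hasFDerivAt_hom_pr (d - 1) hx one_pos (hGd i hx)
    rw [one_smul] at hL
    exact hL.differentiableAt.differentiableWithinAt)
  have hff := fun j => hder (Z := frameField (coneIdx j)) (k := 0) one_pos hx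
    (differentiable_frame (coneIdx j) x)
    (fun t ht y hy => by rw [frameField_smul (coneIdx j) hy ht, zpow_zero, one_smul])
  have hWd := fun i => hder one_pos hx (hGd i hx) (hW i)
  have hZd := hder one_pos hx (hsec ha hx) hZ
  simp only [one_smul, one_zpow, mul_one, Int.cast_zero, zero_smul] at hff hWd hZd
  -- the curves tangent to the frame fields of the link bend towards the vertex of the cone
  have hgeo : ∀ i, tanProj (loCone \ {0}) (frame 0 x) (fderiv ℝ (frame (linkIdx i)) x (vf i x))
      = -frameSq (linkIdx i) • frame 0 x := by
    intro i
    rw [fderiv_frame, isOrthoFrame_cone.tanProj_eq hp]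
    simp only [IsOrthoFrame.coord, frameField_frame_zero _ hx]
    simp only [inner_sum, inner_smul_right, inner_frame hx, mul_ite, mul_zero,
      Finset.sum_ite_eq, Finset.mem_univ, if_true]
    fin_cases i <;> simp [structConst, linkIdx, coneIdx, frameSq, Fin.sum_univ_succ] <;> module
  have hnorx : ∀ w, norProj Set.univ (loCone \ {0}) (frame 0 x) w = nor x w := fun w => by
    have := norProj_cone hx one_pos w
    rwa [one_smul] at this
  have hZx : Z (frame 0 x) = sec a x := by simpa using hZ 1 one_pos x hx
  rw [jacobiOp, hlap, isOrthoFrame_cone.simonsOp_eq Set.univ hp, curvatureOp_univ, hZx, add_zero]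
  simp only [Fin.sum_univ_succ (n := 3), frameField_frame_zero _ hx, coneIdx_succ]
  have h0 : coneIdx 0 = 0 := rfl
  have hG0 : G 0 = fun z => (d : ℝ) • sec a z := rfl
  have hGs : ∀ i : Fin 3, G i.succ = sec (cov i a) := fun i => rfl
  have hff0 := fun i => (hff 0).1 i
  have hffs := fun i j => (hff (Fin.succ j)).1 i
  have hff0' := (hff 0).2
  have hffs' := fun j => (hff (Fin.succ j)).2
  have hWd0 := (hWd 0).2
  have hWds := fun i => (hWd (Fin.succ i)).1 i
  simp only [h0, coneIdx_succ, hG0, hGs] at hff0 hffs hff0' hffs' hWd0 hWds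
  have hfz : ∀ i, fderiv ℝ (frame 0) x (vf i x) = frame (linkIdx i) x := fun i => by
    rw [fderiv_frame_zero, succ_castLE]
  simp only [h0, hff0, hffs, hff0', hffs', hWd0, hWds, hZd.2, hgeo, hfz, map_zero, map_smul, hnorx,
    nor_zero, nor_frame_link hx, inner_zero_left, mul_zero, smul_zero,
    Finset.sum_const_zero, add_zero, zero_add, sub_zero, nor_fderiv_sec (hcov _) hx,
    nor_fderiv_frame_link hx, ← sec_jop ha hx]
  have hs : ∑ i : Fin 3, (frameSq (linkIdx i))⁻¹ • nor x (-frameSq (linkIdx i) • (d : ℝ) • sec a x)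
      = (-3 * (d : ℝ)) • sec a x := by
    have h1 : ∀ i : Fin 3, (frameSq (linkIdx i))⁻¹ • nor x (-frameSq (linkIdx i) •
        (d : ℝ) • sec a x) = (-(d : ℝ)) • sec a x := fun i => by
      have := isOrthoFrame_link.ne_zero i
      rw [nor_smul, nor_smul, nor_sec hx, smul_smul, smul_smul]
      congr 1
      field_simp
    simp only [h1, Finset.sum_const, Finset.card_univ, Fintype.card_fin]
    module
  have h00 : (frameSq 0)⁻¹ = 1 := by simp [frameSq]
  simp only [smul_sub, Finset.sum_sub_distrib, hs, h00]
  simp only [nor_smul, nor_sec hx]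
  push_cast
  module

section

/-! ### Integration over the three-sphere -/

open MeasureTheory
open scoped Pointwise

/-- The unit sphere of `ℝ⁴`. -/
abbrev S3 : Type := Metric.sphere (0 : Euc 4) 1

/-- The rotation-invariant measure on `𝕊³`. -/
def sphVol : Measure S3 := (volume : Measure (Euc 4)).toSphere

instance : IsFiniteMeasure sphVol :=
  inferInstanceAs (IsFiniteMeasure (volume : Measure (Euc 4)).toSphere)

instance : sphVol.IsOpenPosMeasure :=
  inferInstanceAs ((volume : Measure (Euc 4)).toSphere.IsOpenPosMeasure)

theorem S3.norm_eq (s : S3) : ‖(s : Euc 4)‖ = 1 := by simp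

theorem S3.ne_zero (s : S3) : (s : Euc 4) ≠ 0 := ne_zero_of_norm_one s.norm_eq

/-- Linear isometries preserve the measure of `𝕊³`, which is defined through cones over subsets. -/
theorem integral_rotate (φ : Euc 4 ≃ₗᵢ[ℝ] Euc 4) (f : Euc 4 → ℂ) :
    ∫ s : S3, f (φ s) ∂sphVol = ∫ s : S3, f s ∂sphVol := by
  let e : S3 ≃ₜ S3 := φ.toHomeomorph.subtype (fun x => by simp)
  have he : ∀ s : S3, ((e s : S3) : Euc 4) = φ s := fun s => rfl
  have hmp : MeasurePreserving e.toMeasurableEquiv sphVol sphVol := by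
    refine ⟨e.toMeasurableEquiv.measurable, ?_⟩
    ext s hs
    rw [e.toMeasurableEquiv.map_apply, sphVol, Measure.toSphere_apply' _ hs,
      Measure.toSphere_apply' _ (e.toMeasurableEquiv.measurable hs)]
    congr 1
    have h1 : Set.Ioo (0 : ℝ) 1 • (Subtype.val '' (e.toMeasurableEquiv ⁻¹' s))
        = φ ⁻¹' (Set.Ioo (0 : ℝ) 1 • (Subtype.val '' s)) := by
      ext y
      simp only [Set.mem_smul, Set.mem_image, Set.mem_preimage]
      constructor
      · rintro ⟨r, hr, _, ⟨z, hz, rfl⟩, rfl⟩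
        exact ⟨r, hr, _, ⟨_, hz, rfl⟩, by rw [map_smul]; rfl⟩
      · rintro ⟨r, hr, _, ⟨z, hz, rfl⟩, h⟩
        refine ⟨r, hr, _, ⟨e.symm z, ?_, rfl⟩, ?_⟩
        · change e (e.symm z) ∈ s
          rwa [e.apply_symm_apply]
        · apply φ.injective
          rw [map_smul, ← h, ← he, e.apply_symm_apply]
    rw [h1]
    exact φ.measurePreserving.measure_preimage_emb φ.toHomeomorph.measurableEmbedding _
  exact hmp.integral_comp' (fun s => f s)

/-- The flow of the `i`-th vector field, by rotations. -/
def flow (i : Fin 3) (t : ℝ) : Euc 4 ≃ₗᵢ[ℝ] Euc 4 :=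
  LinearIsometry.toLinearIsometryEquiv
    { toLinearMap := Real.cos t • LinearMap.id + Real.sin t • (vf i).toLinearMap
      norm_map' := fun x => by
        rw [← sq_eq_sq₀ (norm_nonneg _) (norm_nonneg _)]
        simp only [LinearMap.add_apply, LinearMap.smul_apply, LinearMap.id_apply,
          ContinuousLinearMap.coe_coe]
        rw [norm_add_sq_real, norm_smul, norm_smul, norm_vf, inner_smul_left, inner_smul_right,
          inner_vf_self, mul_pow, mul_pow, Real.norm_eq_abs, Real.norm_eq_abs, sq_abs, sq_abs]
        linear_combination (‖x‖ ^ 2) * Real.sin_sq_add_cos_sq t } rfl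

theorem flow_apply (i : Fin 3) (t : ℝ) (x : Euc 4) :
    flow i t x = Real.cos t • x + Real.sin t • vf i x := rfl

theorem hasDerivAt_flow (i : Fin 3) (t : ℝ) (x : Euc 4) :
    HasDerivAt (fun t => flow i t x) (vf i (flow i t x)) t := by
  have hc := ((Real.hasDerivAt_cos t).smul_const x).add
    ((Real.hasDerivAt_sin t).smul_const (vf i x))
  have e : vf i (flow i t x) = -Real.sin t • x + Real.cos t • vf i x := by
    rw [flow_apply, map_add, map_smul, map_smul, vf_sq]
    module
  rw [e]
  exact hc

theorem SmoothOff.continuous_restrict {F : Type*} [NormedAddCommGroup F] [NormedSpace ℝ F]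
    {f : Euc 4 → F} (h : SmoothOff f) : Continuous fun s : S3 => f s := by
  have h1 : ContinuousOn f {0}ᶜ := ContDiffOn.continuousOn h
  exact h1.comp_continuous continuous_subtype_val fun s => s.ne_zero

theorem integrable_of_continuous {F : Type*} [NormedAddCommGroup F] {f : S3 → F}
    (h : Continuous f) : Integrable f sphVol :=
  h.integrable_of_hasCompactSupport (HasCompactSupport.of_compactSpace f)

theorem SmoothOff.integrable {F : Type*} [NormedAddCommGroup F] [NormedSpace ℝ F]
    {f : Euc 4 → F} (h : SmoothOff f) : Integrable (fun s : S3 => f s) sphVol :=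
  integrable_of_continuous h.continuous_restrict

/-- The vector fields are divergence free: their flows preserve the measure, so that the derivative
of `∫ f ∘ flow i t` vanishes. -/
theorem integral_D {f : Euc 4 → ℂ} (hf : SmoothOff f) (i : Fin 3) :
    ∫ s : S3, D i f s ∂sphVol = 0 := by
  obtain ⟨C, hC⟩ : ∃ C, ∀ s : S3, ‖D i f s‖ ≤ C := by
    obtain ⟨C, hC⟩ := (isCompact_range (hf.D i).continuous_restrict).isBounded.exists_norm_le
    exact ⟨C, fun s => hC _ ⟨s, rfl⟩⟩
  have hmem : ∀ (t : ℝ) (s : S3), ‖flow i t s‖ = 1 := fun t s => by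
    rw [LinearIsometryEquiv.norm_map, s.norm_eq]
  have hcont : ∀ t, Continuous fun s : S3 => (⟨flow i t s, by simp⟩ : S3) :=
    fun t => ((flow i t).continuous.comp continuous_subtype_val).subtype_mk _
  have h := (hasDerivAt_integral_of_dominated_loc_of_deriv_le (μ := sphVol) (x₀ := (0 : ℝ))
    (s := Set.univ) (F := fun t (s : S3) => f (flow i t s))
    (F' := fun t (s : S3) => D i f (flow i t s)) (bound := fun _ => C) Filter.univ_mem
    (Filter.Eventually.of_forall fun t =>
      (hf.continuous_restrict.comp (hcont t)).aestronglyMeasurable)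
    (integrable_of_continuous (hf.continuous_restrict.comp (hcont 0)))
    ((hf.D i).continuous_restrict.comp (hcont 0)).aestronglyMeasurable
    (Filter.Eventually.of_forall fun s t _ => hC ⟨flow i t s, by simp⟩)
    (integrable_const C)
    (Filter.Eventually.of_forall fun s t _ =>
      (hf.differentiableAt (ne_zero_of_norm_one (hmem t s))).hasFDerivAt.comp_hasDerivAt t
        (hasDerivAt_flow i t s))).2
  have h0 : (fun t => ∫ s : S3, f (flow i t s) ∂sphVol) = fun _ => ∫ s : S3, f s ∂sphVol :=
    funext fun t => integral_rotate (flow i t) f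
  have h1 := h.unique (h0 ▸ hasDerivAt_const (0 : ℝ) (∫ s : S3, f s ∂sphVol))
  simpa [flow_apply] using h1

theorem SmoothOff.mul {f g : Euc 4 → ℂ} (hf : SmoothOff f) (hg : SmoothOff g) :
    SmoothOff fun x => f x * g x :=
  ContDiffOn.mul hf hg

/-- Integration by parts. -/
theorem integral_D_mul {f g : Euc 4 → ℂ} (hf : SmoothOff f) (hg : SmoothOff g) (i : Fin 3) :
    ∫ s : S3, D i f s * g s ∂sphVol = -∫ s : S3, f s * D i g s ∂sphVol := by
  have h := integral_D (hf.mul hg) i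
  have e : ∀ s : S3, D i (fun x => f x * g x) s = D i f s * g s + f s * D i g s := by
    intro s
    have h1 := (hf.differentiableAt s.ne_zero).hasFDerivAt.mul
      (hg.differentiableAt s.ne_zero).hasFDerivAt
    have h1' : HasFDerivAt (fun x => f x * g x) _ (s : Euc 4) := h1
    rw [D, h1'.fderiv]
    simp [D]
    ring
  simp only [e] at h
  rw [integral_add ((hf.D i).mul hg).integrable (hf.mul (hg.D i)).integrable] at h
  exact eq_neg_of_add_eq_zero_left h

/-! ### A complete system of functions on the three-sphere -/

/-- The complex linear form `α z₁ + β z₂` on `ℂ² = ℝ⁴`. -/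
def ell (α β : ℂ) : Euc 4 →L[ℝ] ℂ :=
  LinearMap.toContinuousLinearMap
    { toFun := fun x => α * (x 0 + x 1 * Complex.I) + β * (x 2 + x 3 * Complex.I)
      map_add' := fun x y => by simp; ring
      map_smul' := fun c x => by simp; ring }

/-- The form `-α z̄₂ + β z̄₁`, the partner of `ell α β` under the vector fields `vf`. -/
def ell' (α β : ℂ) : Euc 4 →L[ℝ] ℂ :=
  LinearMap.toContinuousLinearMap
    { toFun := fun x => -α * (x 2 - x 3 * Complex.I) + β * (x 0 - x 1 * Complex.I)
      map_add' := fun x y => by simp; ring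
      map_smul' := fun c x => by simp; ring }

theorem ell_apply (α β : ℂ) (x : Euc 4) :
    ell α β x = α * (x 0 + x 1 * Complex.I) + β * (x 2 + x 3 * Complex.I) := rfl

theorem ell'_apply (α β : ℂ) (x : Euc 4) :
    ell' α β x = -α * (x 2 - x 3 * Complex.I) + β * (x 0 - x 1 * Complex.I) := rfl

theorem ell_vf (α β : ℂ) (x : Euc 4) : ell α β (vf 0 x) = ell' α β x ∧
    ell α β (vf 1 x) = Complex.I * ell' α β x ∧ ell α β (vf 2 x) = Complex.I * ell α β x := by
  have hI := Complex.I_mul_I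
  refine ⟨?_, ?_, ?_⟩ <;> simp [ell_apply, ell'_apply, vf_apply]
  · ring
  · linear_combination (β * x 1 - α * x 3 : ℂ) * hI
  · linear_combination (-α * x 1 - β * x 3 : ℂ) * hI

theorem ell'_vf (α β : ℂ) (x : Euc 4) : ell' α β (vf 0 x) = -ell α β x ∧
    ell' α β (vf 1 x) = Complex.I * ell α β x ∧ ell' α β (vf 2 x) = -Complex.I * ell' α β x := by
  have hI := Complex.I_mul_I
  refine ⟨?_, ?_, ?_⟩ <;> simp [ell_apply, ell'_apply, vf_apply]
  · ring
  · linear_combination (-α * x 1 - β * x 3 : ℂ) * hI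
  · linear_combination (α * x 3 - β * x 1 : ℂ) * hI

/-- The matrix coefficients `ℓᵖ ℓ'^q` of the irreducible representations of `SU(2)`. -/
def mono (α β : ℂ) (p q : ℕ) (x : Euc 4) : ℂ := ell α β x ^ p * ell' α β x ^ q

theorem contDiff_mono (α β : ℂ) (p q : ℕ) : ContDiff ℝ ∞ (mono α β p q) :=
  ((ell α β).contDiff.pow p).mul ((ell' α β).contDiff.pow q)

theorem smoothOff_mono (α β : ℂ) (p q : ℕ) : SmoothOff (mono α β p q) :=
  SmoothOff.of_contDiff (contDiff_mono α β p q)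

theorem D_mono_aux (α β : ℂ) (p q : ℕ) (i : Fin 3) (x : Euc 4) : D i (mono α β p q) x
    = p * ell α β x ^ (p - 1) * ell α β (vf i x) * ell' α β x ^ q
      + ell α β x ^ p * (q * ell' α β x ^ (q - 1) * ell' α β (vf i x)) := by
  have h := (((ell α β).hasFDerivAt (x := x)).pow p).mul (((ell' α β).hasFDerivAt (x := x)).pow q)
  have h' : HasFDerivAt (mono α β p q) _ x := h
  rw [D, h'.fderiv]
  simp
  ring

theorem D_mono (α β : ℂ) (p q : ℕ) (x : Euc 4) :
    D 0 (mono α β p q) x = p * mono α β (p - 1) (q + 1) x - q * mono α β (p + 1) (q - 1) x ∧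
    D 1 (mono α β p q) x = Complex.I *
      (p * mono α β (p - 1) (q + 1) x + q * mono α β (p + 1) (q - 1) x) ∧
    D 2 (mono α β p q) x = Complex.I * (p - q) * mono α β p q x := by
  obtain ⟨a0, a1, a2⟩ := ell_vf α β x
  obtain ⟨b0, b1, b2⟩ := ell'_vf α β x
  refine ⟨?_, ?_, ?_⟩
  · rw [D_mono_aux, a0, b0]; simp only [mono, pow_succ]; ring
  · rw [D_mono_aux, a1, b1]; simp only [mono, pow_succ]; ring
  · rw [D_mono_aux, a2, b2]
    rcases p with _ | p <;> rcases q with _ | q <;> simp [mono, pow_succ] <;> ring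

theorem D_mono_fun (α β : ℂ) (p q : ℕ) :
    D 0 (mono α β p q) = (fun x => (p : ℂ) * mono α β (p - 1) (q + 1) x
      + (-q : ℂ) * mono α β (p + 1) (q - 1) x) ∧
    D 1 (mono α β p q) = (fun x => (Complex.I * p) * mono α β (p - 1) (q + 1) x
      + (Complex.I * q) * mono α β (p + 1) (q - 1) x) ∧
    D 2 (mono α β p q) = fun x => (Complex.I * (p - q)) * mono α β p q x := by
  refine ⟨funext fun x => ?_, funext fun x => ?_, funext fun x => ?_⟩
  · rw [(D_mono α β p q x).1]; ring
  · rw [(D_mono α β p q x).2.1]; ring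
  · rw [(D_mono α β p q x).2.2]

theorem D_lincomb {f g : Euc 4 → ℂ} {x : Euc 4} (hf : DifferentiableAt ℝ f x)
    (hg : DifferentiableAt ℝ g x) (b c : ℂ) (i : Fin 3) :
    D i (fun x => b * f x + c * g x) x = b * D i f x + c * D i g x := by
  have h := (hf.hasFDerivAt.const_mul b).add (hg.hasFDerivAt.const_mul c)
  have h' : HasFDerivAt (fun x => b * f x + c * g x) _ x := h
  rw [D, h'.fderiv]
  simp [D]

/-- The functions `ℓᵖ ℓ'^q` are joint eigenfunctions of `X₁² + X₂²` and `X₃²`. -/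
theorem D_D_mono (α β : ℂ) (p q : ℕ) (x : Euc 4) :
    D 0 (D 0 (mono α β p q)) x + D 1 (D 1 (mono α β p q)) x
      = -(2 * (2 * p * q + p + q)) * mono α β p q x ∧
    D 2 (D 2 (mono α β p q)) x = -(p - q : ℂ) ^ 2 * mono α β p q x := by
  have hd : ∀ p q, DifferentiableAt ℝ (mono α β p q) x := fun p q =>
    ((contDiff_mono α β p q).differentiable (by simp)) x
  have hI := Complex.I_mul_I
  obtain ⟨h0, h1, h2⟩ := D_mono_fun α β p q
  rw [h0, h1, h2, D_lincomb (hd _ _) (hd _ _), D_lincomb (hd _ _) (hd _ _)]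
  have hp : (p : ℂ) * mono α β (p - 1 + 1) q x = p * mono α β p q x := by
    rcases p with _ | p <;> simp
  have hq : (q : ℂ) * mono α β p (q - 1 + 1) x = q * mono α β p q x := by
    rcases q with _ | q <;> simp
  have h3 : D 2 (fun x => (Complex.I * (p - q)) * mono α β p q x) x
      = (Complex.I * (p - q)) * D 2 (mono α β p q) x := by
    have := D_lincomb (hd p q) (hd p q) (Complex.I * (p - q)) 0 2
    simpa using this
  refine ⟨?_, ?_⟩
  · rw [(D_mono α β (p - 1) (q + 1) x).1, (D_mono α β (p + 1) (q - 1) x).1,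
      (D_mono α β (p - 1) (q + 1) x).2.1, (D_mono α β (p + 1) (q - 1) x).2.1]
    simp only [Nat.add_sub_cancel]
    push_cast
    generalize mono α β (p - 1 - 1) (q + 1 + 1) x = A
    generalize mono α β (p + 1 + 1) (q - 1 - 1) x = B
    generalize mono α β (p - 1 + 1) q x = M1 at hp ⊢
    generalize mono α β p (q - 1 + 1) x = M2 at hq ⊢
    linear_combination (-2 * (q + 1) : ℂ) * hp + (-2 * (p + 1) : ℂ) * hq
      + (p * (((p - 1 : ℕ) : ℂ) * A + (q + 1) * M1) + q * ((p + 1) * M2 + ((q - 1 : ℕ) : ℂ) * B)) * hI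
  · rw [h3, (D_mono α β p q x).2.2]
    linear_combination ((p - q : ℂ) ^ 2 * mono α β p q x) * hI

end

section

open MeasureTheory

/-- `ℓᵖ ℓ'^q` as a continuous function on `𝕊³`. -/
def monoC (α β : ℂ) (p q : ℕ) : C(S3, ℂ) :=
  ⟨fun s => mono α β p q s, (smoothOff_mono α β p q).continuous_restrict⟩

/-- The closed linear span of the functions `ℓᵖ ℓ'^q`. -/
def monoSpan : Submodule ℂ C(S3, ℂ) :=
  (Submodule.span ℂ {g | ∃ α β p q, g = monoC α β p q}).topologicalClosure

theorem monoC_mem (α β : ℂ) (p q : ℕ) : monoC α β p q ∈ monoSpan :=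
  Submodule.le_topologicalClosure _ (Submodule.subset_span ⟨α, β, p, q, rfl⟩)

/-- A linear form, as a continuous function on `𝕊³`. -/
def formC (φ : Euc 4 →L[ℝ] ℂ) : C(S3, ℂ) := ⟨fun s => φ s, by fun_prop⟩

theorem monoC_eq (α β : ℂ) (p q : ℕ) :
    monoC α β p q = formC (ell α β) ^ p * formC (ell' α β) ^ q := rfl

theorem formC_ell_add (α β γ δ : ℂ) (t : ℝ) :
    formC (ell (α + t * γ) (β + t * δ)) = formC (ell α β) + t • formC (ell γ δ) ∧
    formC (ell' (α + t * γ) (β + t * δ)) = formC (ell' α β) + t • formC (ell' γ δ) := by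
  constructor <;> ext s <;> simp [formC, ell_apply, ell'_apply] <;> ring

/-- On `𝕊³` the expression `m ℓ' - m' ℓ` is constant, by unimodularity of `SU(2)`. -/
theorem ell_mul_ell' (α β γ δ : ℂ) :
    formC (ell γ δ) * formC (ell' α β) - formC (ell' γ δ) * formC (ell α β)
      = (γ * β - δ * α) • 1 := by
  ext s
  have h := sum_sq_eq_one s.norm_eq
  have h' : ((s : Euc 4) 0 : ℂ) * ((s : Euc 4) 0 : ℂ) + ((s : Euc 4) 1 : ℂ) * ((s : Euc 4) 1 : ℂ)
    + ((s : Euc 4) 2 : ℂ) * ((s : Euc 4) 2 : ℂ) + ((s : Euc 4) 3 : ℂ) * ((s : Euc 4) 3 : ℂ) = 1 := by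
    have := congrArg (fun r : ℝ => (r : ℂ)) h
    push_cast at this
    exact this
  have hI := Complex.I_mul_I
  simp [formC, ell_apply, ell'_apply]
  generalize ((s : Euc 4) 0 : ℂ) = a at *
  generalize ((s : Euc 4) 1 : ℂ) = b at *
  generalize ((s : Euc 4) 2 : ℂ) = c at *
  generalize ((s : Euc 4) 3 : ℂ) = d at *
  linear_combination (γ * β - δ * α) * h' - (γ * β - δ * α) * (b ^ 2 + d ^ 2) * hI

theorem hasDerivAt_monoC (α β γ δ : ℂ) (p q : ℕ) :
    HasDerivAt (fun t : ℝ => monoC (α + t * γ) (β + t * δ) p q)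
      ((p : ℂ) • (formC (ell α β) ^ (p - 1) * formC (ell γ δ) * formC (ell' α β) ^ q)
        + (q : ℂ) • (formC (ell α β) ^ p * formC (ell' α β) ^ (q - 1) * formC (ell' γ δ))) 0 := by
  have h1 : HasDerivAt (fun t : ℝ => formC (ell (α + t * γ) (β + t * δ)))
      (formC (ell γ δ)) 0 := by
    simp only [(formC_ell_add α β γ δ _).1]
    simpa using ((hasDerivAt_id (0 : ℝ)).smul_const (formC (ell γ δ))).const_add
      (formC (ell α β))
  have h2 : HasDerivAt (fun t : ℝ => formC (ell' (α + t * γ) (β + t * δ)))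
      (formC (ell' γ δ)) 0 := by
    simp only [(formC_ell_add α β γ δ _).2]
    simpa using ((hasDerivAt_id (0 : ℝ)).smul_const (formC (ell' γ δ))).const_add
      (formC (ell' α β))
  have h := (h1.pow p).mul (h2.pow q)
  simp only [monoC_eq]
  refine h.congr_deriv ?_
  ext s
  simp
  ring

/-- Polarization: the closed span contains the derivatives of `ℓᵖ ℓ'^q` in the parameters of `ℓ`. -/
theorem deriv_monoC_mem (α β γ δ : ℂ) (p q : ℕ) :
    (p : ℂ) • (formC (ell α β) ^ (p - 1) * formC (ell γ δ) * formC (ell' α β) ^ q)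
      + (q : ℂ) • (formC (ell α β) ^ p * formC (ell' α β) ^ (q - 1) * formC (ell' γ δ))
      ∈ monoSpan := by
  have h := hasDerivAt_iff_tendsto_slope.1 (hasDerivAt_monoC α β γ δ p q)
  refine (Submodule.isClosed_topologicalClosure _).mem_of_tendsto h
    (Filter.Eventually.of_forall fun t => ?_)
  rw [slope, vsub_eq_sub]
  exact ((monoSpan.restrictScalars ℝ).smul_mem _
    (Submodule.sub_mem _ (monoC_mem _ _ _ _) (monoC_mem _ _ _ _)) :)

/-- Multiplication by a form `m` maps `ℓᵖ ℓ'^q` to the closed span: in the polarization of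
`ℓᵖ⁺¹ ℓ'^q`, the term with `m'` is brought to the form `m ℓᵖ ℓ'^q` by `ell_mul_ell'`, up to a
multiple of `ℓᵖ ℓ'^(q-1)`. -/
theorem ell_mul_monoC_mem (α β γ δ : ℂ) (p q : ℕ) :
    formC (ell γ δ) * monoC α β p q ∈ monoSpan := by
  have h := deriv_monoC_mem α β γ δ (p + 1) q
  have e := ell_mul_ell' α β γ δ
  have h2 := monoSpan.add_mem h
    (monoSpan.smul_mem (q * (γ * β - δ * α)) (monoC_mem α β p (q - 1)))
  have h3 := monoSpan.smul_mem ((p + 1 + q : ℂ)⁻¹) h2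
  have hne : (p + 1 + q : ℂ) ≠ 0 := by exact_mod_cast (by omega : p + 1 + q ≠ 0)
  convert h3 using 1
  rw [eq_inv_smul_iff₀ hne]
  ext s
  have es := DFunLike.congr_fun e s
  rcases q with _ | q
  · simp [monoC_eq, mul_comm]
  · simp [monoC_eq] at es ⊢
    linear_combination (((q : ℂ) + 1) * formC (ell α β) s ^ p * formC (ell' α β) s ^ q) * es

theorem ell'_mul_monoC_mem (α β γ δ : ℂ) (p q : ℕ) :
    formC (ell' γ δ) * monoC α β p q ∈ monoSpan := by
  have h := deriv_monoC_mem α β γ δ p (q + 1)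
  have e := ell_mul_ell' α β γ δ
  have h2 := monoSpan.sub_mem h
    (monoSpan.smul_mem (p * (γ * β - δ * α)) (monoC_mem α β (p - 1) q))
  have h3 := monoSpan.smul_mem ((p + 1 + q : ℂ)⁻¹) h2
  have hne : (p + 1 + q : ℂ) ≠ 0 := by exact_mod_cast (by omega : p + 1 + q ≠ 0)
  convert h3 using 1
  rw [eq_inv_smul_iff₀ hne]
  ext s
  have es := DFunLike.congr_fun e s
  rcases p with _ | p
  · simp [monoC_eq]; ring
  · simp [monoC_eq] at es ⊢
    linear_combination -(((p : ℂ) + 1) * formC (ell α β) s ^ p * formC (ell' α β) s ^ q) * es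

theorem mul_mem_monoSpan {z : C(S3, ℂ)} (hz : ∀ α β p q, z * monoC α β p q ∈ monoSpan)
    {g : C(S3, ℂ)} (hg : g ∈ monoSpan) : z * g ∈ monoSpan := by
  have h1 : monoSpan ≤ monoSpan.comap (LinearMap.mulLeft ℂ z) := by
    refine Submodule.topologicalClosure_minimal _ (Submodule.span_le.2 ?_) ?_
    · rintro _ ⟨α, β, p, q, rfl⟩
      exact hz α β p q
    · exact (Submodule.isClosed_topologicalClosure _).preimage (continuous_const_mul z)
  exact h1 hg

theorem adjoin_le_monoSpan {s : Set C(S3, ℂ)}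
    (hs : ∀ z ∈ s, ∀ α β p q, z * monoC α β p q ∈ monoSpan) :
    ∀ f ∈ Algebra.adjoin ℂ s, f ∈ monoSpan := by
  have h1 : ∀ f ∈ Algebra.adjoin ℂ s, ∀ g ∈ monoSpan, f * g ∈ monoSpan := by
    intro f hf
    induction hf using Algebra.adjoin_induction with
    | mem x hx => exact fun g hg => mul_mem_monoSpan (hs x hx) hg
    | algebraMap r =>
      intro g hg
      rw [← Algebra.smul_def]
      exact monoSpan.smul_mem r hg
    | add x y _ _ hx hy =>
      intro g hg
      rw [add_mul]
      exact monoSpan.add_mem (hx g hg) (hy g hg)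
    | mul x y _ _ hx hy =>
      intro g hg
      rw [mul_assoc]
      exact hx _ (hy g hg)
  intro f hf
  have h2 := h1 f hf 1 (by simpa [monoC_eq] using monoC_mem 0 0 0 0)
  rwa [mul_one] at h2

/-- The functions `ℓᵖ ℓ'^q` are total in `C(𝕊³, ℂ)`: their closed span is stable under
multiplication by `z₁`, `z₂` and their conjugates, so Stone–Weierstrass applies. -/
theorem monoSpan_eq_top : monoSpan = ⊤ := by
  let s : Set C(S3, ℂ) := {formC (ell 1 0), formC (ell 0 1)}
  have hstar : ∀ z ∈ s ∪ star s, ∀ α β p q, z * monoC α β p q ∈ monoSpan := by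
    have e1 : star (formC (ell 1 0)) = formC (ell' 0 1) := by
      ext t; simp [formC, ell_apply, ell'_apply]; ring
    have e2 : star (formC (ell 0 1)) = -formC (ell' 1 0) := by
      ext t; simp [formC, ell_apply, ell'_apply]; ring
    rintro z (hz | hz)
    · rcases hz with rfl | hz
      · exact fun α β => ell_mul_monoC_mem α β 1 0
      · rw [Set.mem_singleton_iff] at hz
        subst hz
        exact fun α β => ell_mul_monoC_mem α β 0 1
    · rw [Set.mem_star] at hz
      rcases hz with hz | hz
      · rw [star_eq_iff_star_eq] at hz
        rw [← hz, e1]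
        exact fun α β => ell'_mul_monoC_mem α β 0 1
      · rw [Set.mem_singleton_iff, star_eq_iff_star_eq] at hz
        rw [← hz, e2]
        intro α β p q
        rw [show -formC (ell' 1 0) * monoC α β p q = -(formC (ell' 1 0) * monoC α β p q) from by
          ext; simp]
        exact monoSpan.neg_mem (ell'_mul_monoC_mem _ _ 1 0 _ _)
  have hsep : (StarAlgebra.adjoin ℂ s).SeparatesPoints := by
    intro x y hxy
    by_contra! hcon
    apply hxy
    have h1 := hcon _ ⟨formC (ell 1 0), StarAlgebra.subset_adjoin ℂ s (by simp [s]), rfl⟩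
    have h2 := hcon _ ⟨formC (ell 0 1), StarAlgebra.subset_adjoin ℂ s (by simp [s]), rfl⟩
    simp [formC, ell_apply, Complex.ext_iff] at h1 h2
    ext i
    fin_cases i
    · exact h1.1
    · exact h1.2
    · exact h2.1
    · exact h2.2
  have htop := ContinuousMap.starSubalgebra_topologicalClosure_eq_top_of_separatesPoints _ hsep
  rw [eq_top_iff]
  intro f _
  have hf : f ∈ (StarAlgebra.adjoin ℂ s).topologicalClosure := by rw [htop]; trivial
  have hf' : f ∈ closure
      ((StarAlgebra.adjoin ℂ s : StarSubalgebra ℂ C(S3, ℂ)) : Set C(S3, ℂ)) := hf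
  refine (Submodule.isClosed_topologicalClosure _).closure_subset_iff.2 ?_ hf'
  intro g hg
  exact adjoin_le_monoSpan hstar g (by
    have : g ∈ (StarAlgebra.adjoin ℂ s).toSubalgebra := hg
    rwa [StarAlgebra.adjoin_toSubalgebra] at this)

/-- A continuous function on `𝕊³` orthogonal to all `ℓᵖ ℓ'^q` vanishes. -/
theorem eq_zero_of_integral_mono {f : S3 → ℂ} (hf : Continuous f)
    (h : ∀ α β p q, ∫ s : S3, f s * mono α β p q s ∂sphVol = 0) : f = 0 := by
  let fC : C(S3, ℂ) := ⟨f, hf⟩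
  have hint : ∀ g : C(S3, ℂ), Integrable (fun s => f s * g s) sphVol := fun g =>
    integrable_of_continuous (hf.mul g.continuous)
  let φ : C(S3, ℂ) →L[ℂ] ℂ := LinearMap.mkContinuous
    { toFun := fun g => ∫ s : S3, f s * g s ∂sphVol
      map_add' := fun g k => by
        rw [← integral_add (hint g) (hint k)]
        simp [mul_add]
      map_smul' := fun c g => by
        rw [RingHom.id_apply, smul_eq_mul, ← integral_const_mul]
        simp [mul_left_comm] } (‖fC‖ * sphVol.real Set.univ) (fun g => by
    have := norm_integral_le_of_norm_le_const (μ := sphVol) (f := fun s => f s * g s)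
      (C := ‖fC‖ * ‖g‖) (Filter.Eventually.of_forall fun s => by
        rw [norm_mul]
        exact mul_le_mul (fC.norm_coe_le_norm s) (g.norm_coe_le_norm s) (norm_nonneg _)
          (norm_nonneg _))
    calc _ ≤ _ := this
      _ = _ := by ring)
  have hker : monoSpan ≤ φ.ker := by
    refine Submodule.topologicalClosure_minimal _ (Submodule.span_le.2 ?_) φ.isClosed_ker
    rintro _ ⟨α, β, p, q, rfl⟩
    exact h α β p q
  have h0 : ∫ s : S3, f s * star (f s) ∂sphVol = 0 := by
    have : star fC ∈ φ.ker := hker (by rw [monoSpan_eq_top]; trivial)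
    exact this
  have h1 : ∫ s : S3, ‖f s‖ ^ 2 ∂sphVol = 0 := by
    have e : ∀ s : S3, f s * star (f s) = ((‖f s‖ ^ 2 : ℝ) : ℂ) := fun s => by
      rw [Complex.star_def, Complex.mul_conj, Complex.normSq_eq_norm_sq]
    simp only [e] at h0
    rw [integral_complex_ofReal] at h0
    exact_mod_cast h0
  have hc : Continuous fun s : S3 => ‖f s‖ ^ 2 := by fun_prop
  rw [integral_eq_zero_iff_of_nonneg (fun s => by positivity) (integrable_of_continuous hc)] at h1
  have h2 := (hc.ae_eq_iff_eq sphVol continuous_const).1 h1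
  funext s
  have h3 : ‖f s‖ ^ 2 = 0 := congrFun h2 s
  simpa using h3

end

section

/-! ### Fourier coefficients of the Jacobi equation -/

open MeasureTheory

/-- A real function, viewed as a complex one. -/
def cx (f : Euc 4 → ℝ) (x : Euc 4) : ℂ := f x

theorem SmoothOff.cx {f : Euc 4 → ℝ} (hf : SmoothOff f) : SmoothOff (cx f) :=
  Complex.ofRealCLM.contDiff.comp_contDiffOn hf

theorem D_cx {f : Euc 4 → ℝ} (hf : SmoothOff f) {x : Euc 4} (hx : x ≠ 0) (i : Fin 3) :
    D i (cx f) x = D i f x := by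
  have h : HasFDerivAt (cx f) (Complex.ofRealCLM.comp (fderiv ℝ f x)) x :=
    Complex.ofRealCLM.hasFDerivAt.comp x (hf.differentiableAt hx).hasFDerivAt
  rw [D, h.fderiv]
  rfl

/-- The Fourier coefficients of a function on `𝕊³`: its integrals against `ℓᵖ ℓ'^q`. -/
def coef (f : Euc 4 → ℝ) (α β : ℂ) (p q : ℕ) : ℂ :=
  ∫ s : S3, cx f s * mono α β p q s ∂sphVol

variable {f g : Euc 4 → ℝ} {α β : ℂ} {p q : ℕ}

theorem integrable_cx_mono (hf : SmoothOff f) (α β : ℂ) (p q : ℕ) :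
    Integrable (fun s : S3 => cx f s * mono α β p q s) sphVol :=
  (hf.cx.mul (smoothOff_mono α β p q)).integrable

theorem coef_congr (h : ∀ x, ‖x‖ = 1 → f x = g x) : coef f α β p q = coef g α β p q := by
  refine integral_congr_ae (Filter.Eventually.of_forall fun s => ?_)
  simp only [cx, h s s.norm_eq]

theorem coef_add (hf : SmoothOff f) (hg : SmoothOff g) :
    coef (fun x => f x + g x) α β p q = coef f α β p q + coef g α β p q := by
  rw [coef, coef, coef, ← integral_add (integrable_cx_mono hf _ _ _ _)
    (integrable_cx_mono hg _ _ _ _)]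
  simp [cx, add_mul]

theorem coef_const_mul (c : ℝ) : coef (fun x => c * f x) α β p q = c * coef f α β p q := by
  rw [coef, coef, ← integral_const_mul]
  simp [cx, mul_assoc]

theorem integral_sum_cx_mono {n : ℕ} (c : Fin n → ℂ) {f : Fin n → Euc 4 → ℝ}
    (hf : ∀ i, SmoothOff (f i)) (P Q : Fin n → ℕ) {F : S3 → ℂ}
    (h : ∀ s : S3, F s = ∑ i, c i * (cx (f i) s * mono α β (P i) (Q i) s)) :
    ∫ s : S3, F s ∂sphVol = ∑ i, c i * coef (f i) α β (P i) (Q i) := by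
  simp only [h]
  rw [integral_finsetSum _ fun i _ => (integrable_cx_mono (hf i) α β _ _).const_mul _]
  simp only [integral_const_mul, coef]

theorem coef_D_eq (hf : SmoothOff f) (i : Fin 3) :
    coef (D i f) α β p q = -∫ s : S3, cx f s * D i (mono α β p q) s ∂sphVol := by
  rw [← integral_D_mul hf.cx (smoothOff_mono α β p q)]
  refine integral_congr_ae (Filter.Eventually.of_forall fun s => ?_)
  simp only [D_cx hf s.ne_zero, cx]

theorem coef_D (hf : SmoothOff f) :
    coef (D 0 f) α β p q = -(p * coef f α β (p - 1) (q + 1) - q * coef f α β (p + 1) (q - 1)) ∧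
    coef (D 1 f) α β p q
      = -(Complex.I * (p * coef f α β (p - 1) (q + 1) + q * coef f α β (p + 1) (q - 1))) ∧
    coef (D 2 f) α β p q = -(Complex.I * (p - q) * coef f α β p q) := by
  refine ⟨?_, ?_, ?_⟩
  · rw [coef_D_eq hf, integral_sum_cx_mono (α := α) (β := β) ![(p : ℂ), -q] (fun _ => hf)
      ![p - 1, p + 1] ![q + 1, q - 1]
      (fun s => by rw [(D_mono α β p q s).1]; simp [Fin.sum_univ_two]; ring)]
    simp [Fin.sum_univ_two]; ring
  · rw [coef_D_eq hf, integral_sum_cx_mono (α := α) (β := β) ![Complex.I * p, Complex.I * q]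
      (fun _ => hf) ![p - 1, p + 1] ![q + 1, q - 1]
      (fun s => by rw [(D_mono α β p q s).2.1]; simp [Fin.sum_univ_two]; ring)]
    simp [Fin.sum_univ_two]; ring
  · rw [coef_D_eq hf, integral_sum_cx_mono (α := α) (β := β) ![Complex.I * (p - q)]
      (fun _ => hf) ![p] ![q]
      (fun s => by rw [(D_mono α β p q s).2.2]; simp; ring)]
    simp

theorem coef_D_D (hf : SmoothOff f) (i : Fin 3) :
    coef (D i (D i f)) α β p q = ∫ s : S3, cx f s * D i (D i (mono α β p q)) s ∂sphVol := by
  rw [coef_D_eq (hf.D i), neg_eq_iff_eq_neg, ← integral_D_mul hf.cx ((smoothOff_mono α β p q).D i)]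
  refine integral_congr_ae (Filter.Eventually.of_forall fun s => ?_)
  simp only [D_cx hf s.ne_zero, cx]

/-- The eigenvalue of the Laplacian `lap` on `ℓᵖ ℓ'^q`, up to sign. -/
def Lam (p q : ℕ) : ℝ := 3 / 4 * (2 * p * q + p + q) + 9 / 4 * (p - q) ^ 2

theorem smoothOff_lap (hf : SmoothOff f) : SmoothOff (lap f) :=
  ((contDiffOn_const (c := (3 / 8 : ℝ))).mul (((hf.D 0).D 0).add ((hf.D 1).D 1))).add
    ((contDiffOn_const (c := (9 / 4 : ℝ))).mul ((hf.D 2).D 2))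

theorem coef_lap (hf : SmoothOff f) :
    coef (lap f) α β p q = -Lam p q * coef f α β p q := by
  have hi : ∀ i, Integrable (fun s : S3 => cx f s * D i (D i (mono α β p q)) s) sphVol := fun i =>
    (hf.cx.mul (((smoothOff_mono α β p q).D i).D i)).integrable
  have h1 : coef (lap f) α β p q = (3 / 8 : ℝ) * (coef (D 0 (D 0 f)) α β p q
      + coef (D 1 (D 1 f)) α β p q) + (9 / 4 : ℝ) * coef (D 2 (D 2 f)) α β p q := by
    have e : lap f = fun x => (fun x => (3 / 8 : ℝ) * (fun x => D 0 (D 0 f) x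
      + D 1 (D 1 f) x) x) x + (fun x => (9 / 4 : ℝ) * D 2 (D 2 f) x) x := rfl
    rw [e, coef_add, coef_const_mul, coef_const_mul, coef_add]
    · exact (hf.D 0).D 0
    · exact (hf.D 1).D 1
    · exact (contDiffOn_const (c := (3 / 8 : ℝ))).mul (((hf.D 0).D 0).add ((hf.D 1).D 1))
    · exact (contDiffOn_const (c := (9 / 4 : ℝ))).mul ((hf.D 2).D 2)
  have hi' : Integrable (fun s : S3 => cx f s * D 0 (D 0 (mono α β p q)) s
      + cx f s * D 1 (D 1 (mono α β p q)) s) sphVol := (hi 0).add (hi 1)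
  rw [h1, coef_D_D hf, coef_D_D hf, coef_D_D hf, ← integral_add (hi 0) (hi 1),
    ← integral_const_mul, ← integral_const_mul,
    ← integral_add (hi'.const_mul _) ((hi 2).const_mul _), coef,
    ← integral_const_mul]
  refine integral_congr_ae (Filter.Eventually.of_forall fun s => ?_)
  obtain ⟨h2, h3⟩ := D_D_mono α β p q s
  simp only [Lam]
  push_cast
  linear_combination (3 / 8 * cx f s) * h2 + (9 / 4 * cx f s) * h3

/-- The Fourier coefficients of `a 1 + i a 2`. -/
def coefH (a : Fin 3 → Euc 4 → ℝ) (α β : ℂ) (p q : ℕ) : ℂ :=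
  coef (a 1) α β p q + Complex.I * coef (a 2) α β p q

/-- The Fourier coefficients of `a 1 - i a 2`. -/
def coefG (a : Fin 3 → Euc 4 → ℝ) (α β : ℂ) (p q : ℕ) : ℂ :=
  coef (a 1) α β p q - Complex.I * coef (a 2) α β p q

variable {a : Fin 3 → Euc 4 → ℝ} {ν : ℝ}

/-- The Jacobi equation on the side of the Fourier coefficients. Truncated exponents `p - 1` and
`q - 1` are harmless because of the factors `p`, `q` in front. -/
theorem coef_system (ha : ∀ i, SmoothOff (a i)) (h : ∀ i x, ‖x‖ = 1 → jop a i x = ν * a i x)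
    (α β : ℂ) (p q : ℕ) :
    (Lam p q - 15 / 4 + ν : ℂ) * coef (a 0) α β p q + 3 / 2 * (p * coefH a α β (p - 1) (q + 1)
      - q * coefG a α β (p + 1) (q - 1)) = 0 ∧
    (Lam p q + 21 / 4 * (p - q) + ν : ℂ) * coefH a α β p q
      + 9 / 8 * q * coef (a 0) α β (p + 1) (q - 1) = 0 ∧
    (Lam p q - 21 / 4 * (p - q) + ν : ℂ) * coefG a α β p q
      - 9 / 8 * p * coef (a 0) α β (p - 1) (q + 1) = 0 := by
  have hD := fun i j => (ha i).D j
  have hm : ∀ (c : ℝ) {f : Euc 4 → ℝ}, SmoothOff f → SmoothOff fun x => c * f x := fun c f hf =>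
    (contDiffOn_const (c := c)).mul hf
  have hadd : ∀ {f g : Euc 4 → ℝ}, SmoothOff f → SmoothOff g → SmoothOff fun x => f x + g x :=
    fun hf hg => ContDiffOn.add hf hg
  have e0 := coef_congr (α := α) (β := β) (p := p) (q := q) (h 0)
  have e1 := coef_congr (α := α) (β := β) (p := p) (q := q) (h 1)
  have e2 := coef_congr (α := α) (β := β) (p := p) (q := q) (h 2)
  have j0 : jop a 0 = fun x => (lap (a 0) x + (3 / 2 : ℝ) * (D 0 (a 1) x + D 1 (a 2) x))
      + (15 / 4 : ℝ) * a 0 x := rfl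
  have j1 : jop a 1 = fun x => (lap (a 1) x + (-(9 / 16) : ℝ) * D 0 (a 0) x)
      + (21 / 4 : ℝ) * D 2 (a 2) x := by
    funext x; simp [jop]; ring
  have j2 : jop a 2 = fun x => (lap (a 2) x + (-(9 / 16) : ℝ) * D 1 (a 0) x)
      + (-(21 / 4) : ℝ) * D 2 (a 1) x := by
    funext x; simp [jop]; ring
  have l := fun i => smoothOff_lap (ha i)
  rw [coef_const_mul, j0, coef_add (hadd (l 0) (hm _ (hadd (hD 1 0) (hD 2 1)))) (hm _ (ha 0)),
    coef_add (l 0) (hm _ (hadd (hD 1 0) (hD 2 1))), coef_const_mul, coef_const_mul,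
    coef_add (hD 1 0) (hD 2 1), coef_lap (ha 0), (coef_D (ha 1)).1, (coef_D (ha 2)).2.1] at e0
  rw [coef_const_mul, j1, coef_add (hadd (l 1) (hm _ (hD 0 0))) (hm _ (hD 2 2)),
    coef_add (l 1) (hm _ (hD 0 0)), coef_const_mul, coef_const_mul, coef_lap (ha 1),
    (coef_D (ha 0)).1, (coef_D (ha 2)).2.2] at e1
  rw [coef_const_mul, j2, coef_add (hadd (l 2) (hm _ (hD 0 1))) (hm _ (hD 1 2)),
    coef_add (l 2) (hm _ (hD 0 1)), coef_const_mul, coef_const_mul, coef_lap (ha 2),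
    (coef_D (ha 0)).2.1, (coef_D (ha 1)).2.2] at e2
  push_cast at e0 e1 e2
  have hI := Complex.I_mul_I
  simp only [coefH, coefG]
  refine ⟨?_, ?_, ?_⟩
  · linear_combination -e0
  · linear_combination -e1 - Complex.I * e2
      + (9 / 16 * (p * coef (a 0) α β (p - 1) (q + 1) + q * coef (a 0) α β (p + 1) (q - 1))
        + 21 / 4 * (p - q) * coef (a 1) α β p q) * hI
  · linear_combination -e1 + Complex.I * e2
      - (9 / 16 * (p * coef (a 0) α β (p - 1) (q + 1) + q * coef (a 0) α β (p + 1) (q - 1))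
        + 21 / 4 * (p - q) * coef (a 1) α β p q) * hI

end

section

open MeasureTheory

variable {a : Fin 3 → Euc 4 → ℝ} {ν : ℝ}

/-- The equations of `coef_system` that couple three Fourier coefficients. -/
theorem coef_system_coupled (ha : ∀ i, SmoothOff (a i))
    (h : ∀ i x, ‖x‖ = 1 → jop a i x = ν * a i x) (α β : ℂ) (p q : ℕ) :
    (Lam p q - 15 / 4 + ν : ℂ) * coef (a 0) α β p q + 3 / 2 * (p * coefH a α β (p - 1) (q + 1)
      - q * coefG a α β (p + 1) (q - 1)) = 0 ∧
    (Lam p q - 3 + ν - 9 / 4 * (p - q) : ℂ) * (p * coefH a α β (p - 1) (q + 1))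
      + 9 / 8 * (p * (q + 1)) * coef (a 0) α β p q = 0 ∧
    (Lam p q - 3 + ν + 9 / 4 * (p - q) : ℂ) * (q * coefG a α β (p + 1) (q - 1))
      - 9 / 8 * (q * (p + 1)) * coef (a 0) α β p q = 0 := by
  refine ⟨(coef_system ha h α β p q).1, ?_, ?_⟩
  · rcases p with _ | p
    · simp
    · have := (coef_system ha h α β p (q + 1)).2.1
      simp only [Lam, Nat.add_sub_cancel] at this ⊢
      push_cast at this ⊢
      linear_combination (p + 1 : ℂ) * this
  · rcases q with _ | q
    · simp
    · have := (coef_system ha h α β (p + 1) q).2.2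
      simp only [Lam, Nat.add_sub_cancel] at this ⊢
      push_cast at this ⊢
      linear_combination (q + 1 : ℂ) * this

/-- Cramer's rule for the coupled equations: their determinant is
`R ((R - 9/2) (R + 3/2) + 9/4 ν)` with `R = Λ - 3 + ν`. -/
theorem coupled_det {p q R ν c X Y : ℂ}
    (hν : ν = R + 3 - (3 / 4 * (2 * p * q + p + q) + 9 / 4 * (p - q) ^ 2))
    (h1 : (R - 3 / 4) * c + 3 / 2 * (X - Y) = 0)
    (h2 : (R - 9 / 4 * (p - q)) * X + 9 / 8 * (p * (q + 1)) * c = 0)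
    (h3 : (R + 9 / 4 * (p - q)) * Y - 9 / 8 * (q * (p + 1)) * c = 0) :
    R * ((R - 9 / 2) * (R + 3 / 2) + 9 / 4 * ν) * c = 0 ∧
    R * ((R - 9 / 2) * (R + 3 / 2) + 9 / 4 * ν) * X = 0 ∧
    R * ((R - 9 / 2) * (R + 3 / 2) + 9 / 4 * ν) * Y = 0 := by
  subst hν
  refine ⟨?_, ?_, ?_⟩
  · linear_combination (R - 9 / 4 * (p - q)) * (R + 9 / 4 * (p - q)) * h1
      - 3 / 2 * (R + 9 / 4 * (p - q)) * h2 + 3 / 2 * (R - 9 / 4 * (p - q)) * h3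
  · linear_combination -9 / 8 * (p * (q + 1)) * (R + 9 / 4 * (p - q)) * h1
      + ((R - 3 / 4) * (R + 9 / 4 * (p - q)) - 27 / 16 * (q * (p + 1))) * h2
      - 27 / 16 * (p * (q + 1)) * h3
  · linear_combination 9 / 8 * (q * (p + 1)) * (R - 9 / 4 * (p - q)) * h1
      - 27 / 16 * (q * (p + 1)) * h2
      + ((R - 3 / 4) * (R - 9 / 4 * (p - q)) - 27 / 16 * (p * (q + 1))) * h3

/-- Away from the zeros of the determinant, the coupled Fourier coefficients vanish. -/
theorem coef_eq_zero_of_det (ha : ∀ i, SmoothOff (a i))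
    (h : ∀ i x, ‖x‖ = 1 → jop a i x = ν * a i x) (α β : ℂ) (p q : ℕ)
    (hdet : (Lam p q - 3 + ν) * ((Lam p q - 3 + ν - 9 / 2) * (Lam p q - 3 + ν + 3 / 2)
      + 9 / 4 * ν) ≠ 0) :
    coef (a 0) α β p q = 0 ∧ p * coefH a α β (p - 1) (q + 1) = 0
      ∧ q * coefG a α β (p + 1) (q - 1) = 0 := by
  obtain ⟨h1, h2, h3⟩ := coef_system_coupled ha h α β p q
  have hdet' := Complex.ofReal_ne_zero.2 hdet
  push_cast at hdet'
  have hL : (Lam p q : ℂ) = 3 / 4 * (2 * p * q + p + q) + 9 / 4 * (p - q) ^ 2 := by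
    simp [Lam]
  obtain ⟨k1, k2, k3⟩ := coupled_det (p := p) (q := q) (R := Lam p q - 3 + ν) (ν := ν)
    (by rw [hL]; ring) (by linear_combination h1) h2 h3
  exact ⟨(mul_eq_zero.1 k1).resolve_left hdet', (mul_eq_zero.1 k2).resolve_left hdet',
    (mul_eq_zero.1 k3).resolve_left hdet'⟩

/-- The eigenvalue `Lam p q` is at least `9`, with six exceptions. -/
theorem nine_le_Lam (p q : ℕ) : 9 ≤ Lam p q ∨ (p = 0 ∧ q = 0) ∨ (p = 1 ∧ q = 0) ∨
    (p = 0 ∧ q = 1) ∨ (p = 1 ∧ q = 1) ∨ (p = 2 ∧ q = 1) ∨ (p = 1 ∧ q = 2) := by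
  by_cases h : 4 ≤ p + q
  · left
    have h' : (4 : ℝ) ≤ p + q := by exact_mod_cast h
    simp only [Lam]
    -- `2 p q = ((p + q)² - (p - q)²) / 2`
    nlinarith [sq_nonneg ((p : ℝ) - q)]
  · have hp : p ≤ 3 := by omega
    have hq : q ≤ 3 := by omega
    interval_cases p <;> interval_cases q <;> first
      | omega
      | (left; norm_num [Lam])

/-! ### Orthogonality to translations and rotations -/

theorem sec_eq (x : Euc 4) :
    sec a x = a 0 x • frame 4 x + a 1 x • frame 5 x + a 2 x • frame 6 x := by
  simp [sec, Fin.sum_univ_three, norIdx]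

/-- A complex linear form on the first factor of `ℝ⁷ = ℂ² × ℝ³`, which restricts to `ell α β` on
the link. -/
def lin (α β : ℂ) : Euc 7 →L[ℝ] ℂ := (ell α β).comp pr

/-- The antiholomorphic partner of `lin`, which restricts to `ell' α β` on the link. -/
def lin' (α β : ℂ) : Euc 7 →L[ℝ] ℂ := (ell' α β).comp pr

/-- The linear form on the second factor of `ℝ⁷ = ℝ⁴ × ℝ³` that pulls back under the Hopf map
to `ℓ m' + ℓ' m`, where `ℓ = ell α β` and `m = ell γ δ`; on the link a factor `√5 / 3` appears, see
`quad_frame_zero`. -/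
def quad (α β γ δ : ℂ) : Euc 7 →L[ℝ] ℂ :=
  LinearMap.toContinuousLinearMap
    { toFun := fun v => (α * δ + β * γ) * v 4 - α * γ * (v 5 + v 6 * Complex.I)
        + β * δ * (v 5 - v 6 * Complex.I)
      map_add' := fun x y => by simp; ring
      map_smul' := fun c x => by simp; ring }

theorem pr_sec (x : Euc 4) : pr (sec a x)
    = (5 / 2 * a 0 x) • x - (5 * a 1 x) • vf 0 x - (5 * a 2 x) • vf 1 x := by
  rw [sec_eq, map_add, map_add, map_smul, map_smul, map_smul]
  simp [frame, pr_join, frameLin, smul_smul]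
  module

theorem lin_frame_zero (α β : ℂ) (x : Euc 4) : lin α β (frame 0 x) = ell α β x := by
  simp [lin, pr_frame_zero]

theorem lin'_frame_zero (α β : ℂ) (x : Euc 4) : lin' α β (frame 0 x) = ell' α β x := by
  simp [lin', pr_frame_zero]

theorem lin_sec (α β : ℂ) (x : Euc 4) : lin α β (sec a x)
    = 5 / 2 * a 0 x * ell α β x - 5 * (a 1 x + Complex.I * a 2 x) * ell' α β x := by
  obtain ⟨h0, h1, -⟩ := ell_vf α β x
  rw [lin, ContinuousLinearMap.comp_apply, pr_sec, map_sub, map_sub, map_smul, map_smul, map_smul,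
    h0, h1]
  simp
  ring

theorem lin'_sec (α β : ℂ) (x : Euc 4) : lin' α β (sec a x)
    = 5 / 2 * a 0 x * ell' α β x + 5 * (a 1 x - Complex.I * a 2 x) * ell α β x := by
  obtain ⟨h0, h1, -⟩ := ell'_vf α β x
  rw [lin', ContinuousLinearMap.comp_apply, pr_sec, map_sub, map_sub, map_smul, map_smul, map_smul,
    h0, h1]
  simp
  ring

theorem quad_join (α β γ δ : ℂ) (u : Euc 4) (w : Euc 3) : quad α β γ δ (join (u, w))
    = √5 * ((α * δ + β * γ) * w 0 - α * γ * (w 1 + w 2 * Complex.I)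
        + β * δ * (w 1 - w 2 * Complex.I)) := by
  change (α * δ + β * γ) * ((join (u, w) 4 : ℝ) : ℂ) - α * γ * ((join (u, w) 5 : ℝ)
    + (join (u, w) 6 : ℝ) * Complex.I) + β * δ * ((join (u, w) 5 : ℝ)
    - (join (u, w) 6 : ℝ) * Complex.I) = _
  simp [join_apply]
  ring

theorem quad_frame_zero (α β γ δ : ℂ) (x : Euc 4) : quad α β γ δ (frame 0 x)
    = √5 / 3 * (ell α β x * ell' γ δ x + ell' α β x * ell γ δ x) := by
  have hI := Complex.I_sq
  rw [frame, quad_join]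
  simp [frameLin, hopfPol_apply, ell_apply, ell'_apply]
  ring_nf
  simp only [hI]
  ring

theorem quad_sec (α β γ δ : ℂ) (x : Euc 4) : quad α β γ δ (sec a x)
    = √5 / 3 * (-2 * a 0 x * (ell α β x * ell' γ δ x + ell' α β x * ell γ δ x)
      + 2 * (a 1 x + Complex.I * a 2 x) * (ell' α β x * ell' γ δ x)
      - 2 * (a 1 x - Complex.I * a 2 x) * (ell α β x * ell γ δ x)) := by
  have hI := Complex.I_sq
  have h3 : Complex.I ^ 3 = -Complex.I := by rw [pow_succ, hI]; ring
  rw [sec_eq, map_add, map_add, map_smul, map_smul, map_smul, frame, frame, frame, quad_join,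
    quad_join, quad_join]
  simp [frameLin, hopfPol_apply, vf_apply, ell_apply, ell'_apply]
  ring_nf
  simp only [hI, h3]
  ring

end

section

open MeasureTheory

variable {a : Fin 3 → Euc 4 → ℝ} {ν : ℝ}

/-- Fourier coefficients of a field orthogonal to the translations. -/
theorem coef_of_perp_translations (ha : ∀ i, SmoothOff (a i))
    (hT : ∀ f : Euc 7 →L[ℝ] ℂ, ∫ s : S3, f (sec a s) ∂sphVol = 0) (α β : ℂ) :
    coef (a 0) α β 1 0 = 2 * coefH a α β 0 1 ∧ coef (a 0) α β 0 1 = -2 * coefG a α β 1 0 ∧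
    2 * coef (a 0) α β 1 1 = coefH a α β 0 2 - coefG a α β 2 0 := by
  have h5 : (√5 : ℂ) ≠ 0 := by exact_mod_cast (Real.sqrt_pos.2 (by norm_num)).ne'
  simp only [coefH, coefG]
  refine ⟨?_, ?_, ?_⟩
  · have h := integral_sum_cx_mono (α := α) (β := β) ![5 / 2, -5, -5 * Complex.I] ha ![1, 0, 0]
      ![0, 1, 1] (F := fun s => lin α β (sec a s))
      (fun s => by rw [lin_sec]; simp [Fin.sum_univ_three, mono, cx]; ring)
    rw [hT] at h
    simp [Fin.sum_univ_three] at h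
    linear_combination (-2 / 5 : ℂ) * h
  · have h := integral_sum_cx_mono (α := α) (β := β) ![5 / 2, 5, -5 * Complex.I] ha ![0, 1, 1]
      ![1, 0, 0] (F := fun s => lin' α β (sec a s))
      (fun s => by rw [lin'_sec]; simp [Fin.sum_univ_three, mono, cx]; ring)
    rw [hT] at h
    simp [Fin.sum_univ_three] at h
    linear_combination (-2 / 5 : ℂ) * h
  · have h := integral_sum_cx_mono (α := α) (β := β) ![√5 / 3 * -4, √5 / 3 * 2,
      √5 / 3 * (2 * Complex.I), √5 / 3 * -2, √5 / 3 * (2 * Complex.I)]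
      (f := ![a 0, a 1, a 2, a 1, a 2]) (fun i => by fin_cases i <;> exact ha _) ![1, 0, 0, 2, 2]
      ![1, 2, 2, 0, 0] (F := fun s => quad α β α β (sec a s))
      (fun s => by rw [quad_sec]; simp [Fin.sum_univ_five, mono, cx]; ring)
    rw [hT] at h
    simp [Fin.sum_univ_five] at h
    apply mul_left_cancel₀ h5
    linear_combination (3 / 2 : ℂ) * h

theorem ell_mul_ell'_sub (α β γ δ : ℂ) (s : S3) :
    ell α β s * ell' γ δ s - ell' α β s * ell γ δ s = α * δ - β * γ := by
  have := DFunLike.congr_fun (ell_mul_ell' γ δ α β) s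
  simpa [formC] using this

/-- Fourier coefficients of a field orthogonal to the rotations. -/
theorem coef_of_perp_rotations (ha : ∀ i, SmoothOff (a i))
    (hR : ∀ f g : Euc 7 →L[ℝ] ℂ, ∫ s : S3, (f (frame 0 s) * g (sec a s)
      - g (frame 0 s) * f (sec a s)) ∂sphVol = 0) (α β : ℂ) :
    coefH a α β 0 0 = 0 ∧ coefG a α β 0 0 = 0 ∧
    coefH a α β 0 2 + coefG a α β 2 0 = 0 ∧
    9 * coef (a 0) α β 2 1 = 12 * coefH a α β 1 2 - 2 * coefG a α β 3 0 ∧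
    9 * coef (a 0) α β 1 2 = 2 * coefH a α β 0 3 - 12 * coefG a α β 2 1 := by
  have h5 : (√5 : ℂ) ≠ 0 := by exact_mod_cast (Real.sqrt_pos.2 (by norm_num)).ne'
  simp only [coefH, coefG]
  refine ⟨?_, ?_, ?_, ?_, ?_⟩
  · have h := integral_sum_cx_mono (α := α) (β := β) ![-5, -5 * Complex.I] (f := ![a 1, a 2])
      (fun i => by fin_cases i <;> exact ha _) ![0, 0] ![0, 0]
      (F := fun s => lin 1 0 (frame 0 s) * lin 0 1 (sec a s)
        - lin 0 1 (frame 0 s) * lin 1 0 (sec a s))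
      (fun s => by
        have k := ell_mul_ell'_sub 1 0 0 1 s
        rw [lin_sec, lin_sec, lin_frame_zero, lin_frame_zero]
        simp [Fin.sum_univ_two, mono, cx]
        linear_combination (-5 * (a 1 s + Complex.I * a 2 s)) * k)
    rw [hR] at h
    simp [Fin.sum_univ_two] at h
    linear_combination (1 / 5 : ℂ) * h
  · have h := integral_sum_cx_mono (α := α) (β := β) ![-5, 5 * Complex.I] (f := ![a 1, a 2])
      (fun i => by fin_cases i <;> exact ha _) ![0, 0] ![0, 0]
      (F := fun s => lin' 1 0 (frame 0 s) * lin' 0 1 (sec a s)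
        - lin' 0 1 (frame 0 s) * lin' 1 0 (sec a s))
      (fun s => by
        have k := ell_mul_ell'_sub 1 0 0 1 s
        rw [lin'_sec, lin'_sec, lin'_frame_zero, lin'_frame_zero]
        simp [Fin.sum_univ_two, mono, cx]
        linear_combination (-5 * (a 1 s - Complex.I * a 2 s)) * k)
    rw [hR] at h
    simp [Fin.sum_univ_two] at h
    linear_combination (1 / 5 : ℂ) * h
  · have h := integral_sum_cx_mono (α := α) (β := β) ![5, 5 * Complex.I, 5, -5 * Complex.I]
      (f := ![a 1, a 2, a 1, a 2]) (fun i => by fin_cases i <;> exact ha _) ![0, 0, 2, 2]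
      ![2, 2, 0, 0]
      (F := fun s => lin α β (frame 0 s) * lin' α β (sec a s)
        - lin' α β (frame 0 s) * lin α β (sec a s))
      (fun s => by
        rw [lin'_sec, lin_sec, lin'_frame_zero, lin_frame_zero]
        simp [Fin.sum_univ_four, mono, cx]
        ring)
    rw [hR] at h
    simp [Fin.sum_univ_four] at h
    linear_combination (-1 / 5 : ℂ) * h
  · have h := integral_sum_cx_mono (α := α) (β := β) ![√5 / 3 * -9, √5 / 3 * 12,
      √5 / 3 * (12 * Complex.I), √5 / 3 * -2, √5 / 3 * (2 * Complex.I)]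
      (f := ![a 0, a 1, a 2, a 1, a 2]) (fun i => by fin_cases i <;> exact ha _) ![2, 1, 1, 3, 3]
      ![1, 2, 2, 0, 0]
      (F := fun s => lin α β (frame 0 s) * quad α β α β (sec a s)
        - quad α β α β (frame 0 s) * lin α β (sec a s))
      (fun s => by
        rw [quad_sec, lin_sec, quad_frame_zero, lin_frame_zero]
        simp [Fin.sum_univ_five, mono, cx]
        ring)
    rw [hR] at h
    simp [Fin.sum_univ_five] at h
    apply mul_left_cancel₀ h5
    linear_combination (3 : ℂ) * h
  · have h := integral_sum_cx_mono (α := α) (β := β) ![√5 / 3 * -9, √5 / 3 * 2,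
      √5 / 3 * (2 * Complex.I), √5 / 3 * -12, √5 / 3 * (12 * Complex.I)]
      (f := ![a 0, a 1, a 2, a 1, a 2]) (fun i => by fin_cases i <;> exact ha _) ![1, 0, 0, 2, 2]
      ![2, 3, 3, 1, 1]
      (F := fun s => lin' α β (frame 0 s) * quad α β α β (sec a s)
        - quad α β α β (frame 0 s) * lin' α β (sec a s))
      (fun s => by
        rw [quad_sec, lin'_sec, quad_frame_zero, lin'_frame_zero]
        simp [Fin.sum_univ_five, mono, cx]
        ring)
    rw [hR] at h
    simp [Fin.sum_univ_five] at h
    apply mul_left_cancel₀ h5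
    linear_combination (3 : ℂ) * h

/-- The Fourier coefficients of degree one of a field orthogonal to the rotations. The rotations
used here mix the two factors of `ℝ⁷ = ℝ⁴ × ℝ³`. -/
theorem coef_one_of_perp_rotations (ha : ∀ i, SmoothOff (a i))
    (hR : ∀ f g : Euc 7 →L[ℝ] ℂ, ∫ s : S3, (f (frame 0 s) * g (sec a s)
      - g (frame 0 s) * f (sec a s)) ∂sphVol = 0) (α β : ℂ) :
    3 * coef (a 0) α β 1 0 = -2 * coefH a α β 0 1 ∧
    3 * coef (a 0) α β 0 1 = 2 * coefG a α β 1 0 := by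
  have h5 : (√5 : ℂ) ≠ 0 := by exact_mod_cast (Real.sqrt_pos.2 (by norm_num)).ne'
  simp only [coefH, coefG]
  -- the second form is chosen such that `ℓ m' - ℓ' m = |α|² + |β|²`
  set γ : ℂ := -star β with hγ
  set δ : ℂ := star α with hδ
  by_cases hκ : α * δ - β * γ = 0
  · have h0 : α = 0 ∧ β = 0 := by
      have : (Complex.normSq α + Complex.normSq β : ℂ) = 0 := by
        rw [Complex.normSq_eq_conj_mul_self, Complex.normSq_eq_conj_mul_self, ← hκ, hγ, hδ,
          ← Complex.star_def]
        simp
        ring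
      have h' : Complex.normSq α + Complex.normSq β = 0 := by exact_mod_cast this
      have hα := Complex.normSq_nonneg α
      have hβ := Complex.normSq_nonneg β
      exact ⟨Complex.normSq_eq_zero.1 (by linarith), Complex.normSq_eq_zero.1 (by linarith)⟩
    obtain ⟨rfl, rfl⟩ := h0
    have hz : ∀ (f : Euc 4 → ℝ), coef f 0 0 1 0 = 0 ∧ coef f 0 0 0 1 = 0 := fun f => by
      constructor <;> simp [coef, mono, ell_apply, ell'_apply]
    simp [hz]
  have hi : ∀ f g : Euc 7 →L[ℝ] ℂ, Integrable (fun s : S3 => f (frame 0 s) * g (sec a s)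
      - g (frame 0 s) * f (sec a s)) sphVol := by
    intro f g
    have hsec : SmoothOff (sec a) :=
      ContDiffOn.sum fun β _ => (ha β).smul (contDiff_frame _).contDiffOn
    have h1 : ∀ f : Euc 7 →L[ℝ] ℂ, SmoothOff fun x => f (sec a x) := fun f =>
      f.contDiff.comp_contDiffOn hsec
    have h2 : ∀ f : Euc 7 →L[ℝ] ℂ, SmoothOff fun x => f (frame 0 x) := fun f =>
      SmoothOff.of_contDiff (f.contDiff.comp (contDiff_frame 0))
    exact (((h2 f).mul (h1 g)).integrable).sub (((h2 g).mul (h1 f)).integrable)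
  constructor
  · have h := integral_sum_cx_mono (α := α) (β := β) ![√5 * (α * δ - β * γ) * (-3 / 2),
      √5 * (α * δ - β * γ) * -1, √5 * (α * δ - β * γ) * -Complex.I] ha ![1, 0, 0] ![0, 1, 1]
      (F := fun s => (lin α β (frame 0 s) * quad α β γ δ (sec a s)
        - quad α β γ δ (frame 0 s) * lin α β (sec a s))
        - (lin γ δ (frame 0 s) * quad α β α β (sec a s)
        - quad α β α β (frame 0 s) * lin γ δ (sec a s)))
      (fun s => by
        have k := ell_mul_ell'_sub α β γ δ s
        simp only [quad_sec, lin_sec, quad_frame_zero, lin_frame_zero]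
        simp [Fin.sum_univ_three, mono, cx]
        linear_combination (√5 * (-3 / 2 * a 0 s * ell α β s
          - (a 1 s + Complex.I * a 2 s) * ell' α β s)) * k)
    rw [integral_sub (hi _ _) (hi _ _), hR, hR] at h
    simp [Fin.sum_univ_three] at h
    apply mul_left_cancel₀ h5
    apply mul_left_cancel₀ hκ
    linear_combination (2 : ℂ) * h
  · have h := integral_sum_cx_mono (α := α) (β := β) ![√5 * (α * δ - β * γ) * (3 / 2),
      √5 * (α * δ - β * γ) * -1, √5 * (α * δ - β * γ) * Complex.I] ha ![0, 1, 1] ![1, 0, 0]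
      (F := fun s => (lin' α β (frame 0 s) * quad α β γ δ (sec a s)
        - quad α β γ δ (frame 0 s) * lin' α β (sec a s))
        - (lin' γ δ (frame 0 s) * quad α β α β (sec a s)
        - quad α β α β (frame 0 s) * lin' γ δ (sec a s)))
      (fun s => by
        have k := ell_mul_ell'_sub α β γ δ s
        simp only [quad_sec, lin'_sec, quad_frame_zero, lin'_frame_zero]
        simp [Fin.sum_univ_three, mono, cx]
        linear_combination (√5 * (3 / 2 * a 0 s * ell' α β s
          - (a 1 s - Complex.I * a 2 s) * ell α β s)) * k)
    rw [integral_sub (hi _ _) (hi _ _), hR, hR] at h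
    simp [Fin.sum_univ_three] at h
    apply mul_left_cancel₀ h5
    apply mul_left_cancel₀ hκ
    linear_combination (-2 : ℂ) * h

/-! ### Vanishing of eigenfields orthogonal to the known ones -/

/-- The Fourier coefficients of an eigenfield as in `eq_zero_of_perp` vanish, grouped as in the
coupled equations. -/
theorem coef_eq_zero (ha : ∀ i, SmoothOff (a i)) (hν : 0 ≤ ν)
    (h : ∀ i x, ‖x‖ = 1 → jop a i x = ν * a i x)
    (hE : ν = 15 / 4 → ∫ s : S3, cx (a 0) s ∂sphVol = 0)
    (hT : ν = 3 → ∀ f : Euc 7 →L[ℝ] ℂ, ∫ s : S3, f (sec a s) ∂sphVol = 0)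
    (hR : ν = 0 → ∀ f g : Euc 7 →L[ℝ] ℂ, ∫ s : S3, (f (frame 0 s) * g (sec a s)
      - g (frame 0 s) * f (sec a s)) ∂sphVol = 0) (α β : ℂ) (p q : ℕ) :
    coef (a 0) α β p q = 0 ∧ p * coefH a α β (p - 1) (q + 1) = 0
      ∧ q * coefG a α β (p + 1) (q - 1) = 0 := by
  rcases nine_le_Lam p q with hL | ⟨rfl, rfl⟩ | ⟨rfl, rfl⟩ | ⟨rfl, rfl⟩ | ⟨rfl, rfl⟩ | ⟨rfl, rfl⟩ |
    ⟨rfl, rfl⟩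
  -- for `Λ ≥ 9` the determinant is positive
  · refine coef_eq_zero_of_det ha h α β p q (mul_pos (by linarith) ?_).ne'
    have : 0 < (Lam p q - 3 + ν - 9 / 2) * (Lam p q - 3 + ν + 3 / 2) :=
      mul_pos (by linarith) (by linarith)
    linarith
  -- constants: singular for `ν = 15/4`, where `e₄` lives
  · obtain ⟨h1, -, -⟩ := coef_system_coupled ha h α β 0 0
    simp only [Lam] at h1
    norm_num at h1
    refine ⟨?_, by simp, by simp⟩
    rcases h1 with h1 | h1
    · have hν' : ν = 15 / 4 := by
        have : ((ν - 15 / 4 : ℝ) : ℂ) = 0 := by push_cast; linear_combination h1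
        linarith [Complex.ofReal_eq_zero.1 this]
      have := hE hν'
      simpa [coef, mono] using this
    · exact h1
  -- for `Λ = 3` the determinant is `ν (ν - 3) (ν + 9/4)`: rotations and translations
  · by_cases h0 : ν = 0
    · have e := (coef_one_of_perp_rotations ha (hR h0) α β).1
      obtain ⟨h1, h2, h3⟩ := coef_system_coupled ha h α β 1 0
      simp only [Lam, h0] at h1 h2 h3
      norm_num at h1 h2 h3 ⊢
      grind
    by_cases h3' : ν = 3
    · have e := (coef_of_perp_translations ha (hT h3') α β).1
      obtain ⟨h1, h2, h3⟩ := coef_system_coupled ha h α β 1 0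
      simp only [Lam, h3'] at h1 h2 h3
      norm_num at h1 h2 h3 ⊢
      grind
    refine coef_eq_zero_of_det ha h α β 1 0 ?_
    have : Lam 1 0 = 3 := by norm_num [Lam]
    rw [this, show (3 - 3 + ν) * ((3 - 3 + ν - 9 / 2) * (3 - 3 + ν + 3 / 2) + 9 / 4 * ν)
      = ν * ((ν - 3) * (ν + 9 / 4)) by ring]
    exact mul_ne_zero h0 (mul_ne_zero (sub_ne_zero.2 h3') (by linarith))
  · by_cases h0 : ν = 0
    · have e := (coef_one_of_perp_rotations ha (hR h0) α β).2
      obtain ⟨h1, h2, h3⟩ := coef_system_coupled ha h α β 0 1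
      simp only [Lam, h0] at h1 h2 h3
      norm_num at h1 h2 h3 ⊢
      grind
    by_cases h3' : ν = 3
    · have e := (coef_of_perp_translations ha (hT h3') α β).2.1
      obtain ⟨h1, h2, h3⟩ := coef_system_coupled ha h α β 0 1
      simp only [Lam, h3'] at h1 h2 h3
      norm_num at h1 h2 h3 ⊢
      grind
    refine coef_eq_zero_of_det ha h α β 0 1 ?_
    have : Lam 0 1 = 3 := by norm_num [Lam]
    rw [this, show (3 - 3 + ν) * ((3 - 3 + ν - 9 / 2) * (3 - 3 + ν + 3 / 2) + 9 / 4 * ν)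
      = ν * ((ν - 3) * (ν + 9 / 4)) by ring]
    exact mul_ne_zero h0 (mul_ne_zero (sub_ne_zero.2 h3') (by linarith))
  · by_cases h0 : ν = 0
    · have e := (coef_of_perp_rotations ha (hR h0) α β).2.2.1
      obtain ⟨h1, h2, h3⟩ := coef_system_coupled ha h α β 1 1
      simp only [Lam, h0] at h1 h2 h3
      norm_num at h1 h2 h3 ⊢
      grind
    by_cases h3' : ν = 3
    · have e := (coef_of_perp_translations ha (hT h3') α β).2.2
      obtain ⟨h1, h2, h3⟩ := coef_system_coupled ha h α β 1 1
      simp only [Lam, h3'] at h1 h2 h3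
      norm_num at h1 h2 h3 ⊢
      grind
    refine coef_eq_zero_of_det ha h α β 1 1 ?_
    have : Lam 1 1 = 3 := by norm_num [Lam]
    rw [this, show (3 - 3 + ν) * ((3 - 3 + ν - 9 / 2) * (3 - 3 + ν + 3 / 2) + 9 / 4 * ν)
      = ν * ((ν - 3) * (ν + 9 / 4)) by ring]
    exact mul_ne_zero h0 (mul_ne_zero (sub_ne_zero.2 h3') (by linarith))
  -- for `Λ = 15/2` the determinant is `(ν + 9/2) ν (ν + 33/4)`: rotations only
  · by_cases h0 : ν = 0
    · have e := (coef_of_perp_rotations ha (hR h0) α β).2.2.2.1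
      obtain ⟨h1, h2, h3⟩ := coef_system_coupled ha h α β 2 1
      simp only [Lam, h0] at h1 h2 h3
      norm_num at h1 h2 h3 ⊢
      grind
    refine coef_eq_zero_of_det ha h α β 2 1 ?_
    have : Lam 2 1 = 15 / 2 := by norm_num [Lam]
    rw [this, show (15 / 2 - 3 + ν) * ((15 / 2 - 3 + ν - 9 / 2) * (15 / 2 - 3 + ν + 3 / 2)
      + 9 / 4 * ν) = (9 / 2 + ν) * (ν * (ν + 33 / 4)) by ring]
    exact mul_ne_zero (by linarith) (mul_ne_zero h0 (by linarith))
  · by_cases h0 : ν = 0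
    · have e := (coef_of_perp_rotations ha (hR h0) α β).2.2.2.2
      obtain ⟨h1, h2, h3⟩ := coef_system_coupled ha h α β 1 2
      simp only [Lam, h0] at h1 h2 h3
      norm_num at h1 h2 h3 ⊢
      grind
    refine coef_eq_zero_of_det ha h α β 1 2 ?_
    have : Lam 1 2 = 15 / 2 := by norm_num [Lam]
    rw [this, show (15 / 2 - 3 + ν) * ((15 / 2 - 3 + ν - 9 / 2) * (15 / 2 - 3 + ν + 3 / 2)
      + 9 / 4 * ν) = (9 / 2 + ν) * (ν * (ν + 33 / 4)) by ring]
    exact mul_ne_zero (by linarith) (mul_ne_zero h0 (by linarith))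

/-- An eigenfield of a nonpositive eigenvalue `-ν` that is orthogonal to `e₄`, to the translations
and to the rotations (each for the relevant value of `ν`) vanishes. -/
theorem eq_zero_of_perp (ha : ∀ i, SmoothOff (a i)) (hν : 0 ≤ ν)
    (h : ∀ i x, ‖x‖ = 1 → jop a i x = ν * a i x)
    (hE : ν = 15 / 4 → ∫ s : S3, cx (a 0) s ∂sphVol = 0)
    (hT : ν = 3 → ∀ f : Euc 7 →L[ℝ] ℂ, ∫ s : S3, f (sec a s) ∂sphVol = 0)
    (hR : ν = 0 → ∀ f g : Euc 7 →L[ℝ] ℂ, ∫ s : S3, (f (frame 0 s) * g (sec a s)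
      - g (frame 0 s) * f (sec a s)) ∂sphVol = 0) {x : Euc 4} (hx : ‖x‖ = 1) (i : Fin 3) :
    a i x = 0 := by
  have key := coef_eq_zero ha hν h hE hT hR
  have hH : ∀ α β p q, coefH a α β p q = 0 := by
    intro α β p q
    rcases q with _ | q
    -- the coefficients at the edge `q = 0` satisfy an uncoupled equation
    · have h2 := (coef_system ha h α β p 0).2.1
      by_cases h0 : p = 0 ∧ ν = 0
      · obtain ⟨rfl, h0⟩ := h0
        exact (coef_of_perp_rotations ha (hR h0) α β).1
      · have hne : Lam p 0 + 21 / 4 * p + ν ≠ 0 := by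
          have h4 : 0 ≤ Lam p 0 := by simp only [Lam]; positivity
          intro h5
          have h6 : (p : ℝ) = 0 := by nlinarith [(Nat.cast_nonneg p : (0 : ℝ) ≤ p)]
          exact h0 ⟨by exact_mod_cast h6, by nlinarith [(Nat.cast_nonneg p : (0 : ℝ) ≤ p)]⟩
        have hne' := Complex.ofReal_ne_zero.2 hne
        push_cast at hne' h2
        refine (mul_eq_zero.1 ?_).resolve_left hne'
        linear_combination h2
    · have h2 := (key α β (p + 1) q).2.1
      rw [Nat.add_sub_cancel] at h2
      exact (mul_eq_zero.1 h2).resolve_left (Nat.cast_ne_zero.2 p.succ_ne_zero)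
  have hG : ∀ α β p q, coefG a α β p q = 0 := by
    intro α β p q
    rcases p with _ | p
    · have h2 := (coef_system ha h α β 0 q).2.2
      by_cases h0 : q = 0 ∧ ν = 0
      · obtain ⟨rfl, h0⟩ := h0
        exact (coef_of_perp_rotations ha (hR h0) α β).2.1
      · have hne : Lam 0 q + 21 / 4 * q + ν ≠ 0 := by
          have h4 : 0 ≤ Lam 0 q := by simp only [Lam]; positivity
          intro h5
          have h6 : (q : ℝ) = 0 := by nlinarith [(Nat.cast_nonneg q : (0 : ℝ) ≤ q)]
          exact h0 ⟨by exact_mod_cast h6, by nlinarith [(Nat.cast_nonneg q : (0 : ℝ) ≤ q)]⟩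
        have hne' := Complex.ofReal_ne_zero.2 hne
        push_cast at hne' h2
        refine (mul_eq_zero.1 ?_).resolve_left hne'
        linear_combination h2
    · have h2 := (key α β p (q + 1)).2.2
      rw [Nat.add_sub_cancel] at h2
      exact (mul_eq_zero.1 h2).resolve_left (Nat.cast_ne_zero.2 q.succ_ne_zero)
  have hc : ∀ i α β p q, coef (a i) α β p q = 0 := by
    intro i α β p q
    have h1 := hH α β p q
    have h2 := hG α β p q
    simp only [coefH, coefG] at h1 h2
    fin_cases i
    · exact (key α β p q).1
    · change coef (a 1) α β p q = 0
      linear_combination (1 / 2 : ℂ) * h1 + (1 / 2 : ℂ) * h2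
    · change coef (a 2) α β p q = 0
      have hI := Complex.I_mul_I
      linear_combination (-Complex.I / 2 : ℂ) * h1 + (Complex.I / 2 : ℂ) * h2
        + coef (a 2) α β p q * hI
  have h0 := eq_zero_of_integral_mono (ha i).cx.continuous_restrict (hc i)
  have := congrFun h0 ⟨x, by simpa using hx⟩
  simpa [cx] using this

end

/-! ### Normal fields and their coefficients -/

theorem mem_normalSpace_iff_nor {x : Euc 4} (hx : ‖x‖ = 1) {v : Euc 7} :
    v ∈ Submodule.span ℝ (Set.range fun β => frame (norIdx β) x) ↔ nor x v = v := by
  rw [← starProjection_nor hx, Submodule.starProjection_eq_self_iff]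

/-- Fields along the link, or along the cone, have smooth coefficients in the frame. -/
theorem exists_coef {Y : Euc 7 → Euc 7} {S : Set (Euc 7)} (hY : ContDiffOn ℝ ∞ Y S)
    (hS : loLink ⊆ S) (hn : ∀ x, ‖x‖ = 1 → nor x (Y (frame 0 x)) = Y (frame 0 x)) :
    ∃ a : Fin 3 → Euc 4 → ℝ, (∀ i, SmoothOff (a i)) ∧
      ∀ x, ‖x‖ = 1 → Y (frame 0 x) = sec a x := by
  have hu : ContDiffOn ℝ ∞ (fun x : Euc 4 => ‖x‖⁻¹ • x) {0}ᶜ := by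
    intro x hx
    have hx0 : x ≠ 0 := hx
    exact (((contDiffAt_norm ℝ hx0).inv (norm_ne_zero_iff.2 hx0)).smul
      contDiffAt_id).contDiffWithinAt
  have hn1 : ∀ x ∈ ({0}ᶜ : Set (Euc 4)), ‖‖x‖⁻¹ • x‖ = 1 := fun x hx => by
    have hx0 : x ≠ 0 := hx
    rw [norm_smul, norm_inv, norm_norm, inv_mul_cancel₀ (norm_ne_zero_iff.2 hx0)]
  refine ⟨fun β x => (frameSq (norIdx β))⁻¹ *
    inner ℝ (frame (norIdx β) (‖x‖⁻¹ • x)) (Y (frame 0 (‖x‖⁻¹ • x))), fun β => ?_, fun x hx => ?_⟩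
  · refine contDiffOn_const.mul (ContDiffOn.inner ℝ ((contDiff_frame _).comp_contDiffOn hu)
      (hY.comp ((contDiff_frame 0).comp_contDiffOn hu) fun x hx => hS ?_))
    exact frame_zero_mem_link (hn1 x hx)
  · rw [← hn x hx, sec]
    simp [hx, nor]

theorem sec_inj {a b : Fin 3 → Euc 4 → ℝ} {x : Euc 4} (hx : ‖x‖ = 1) (h : sec a x = sec b x)
    (i : Fin 3) : a i x = b i x := by
  have h1 := congrArg (fun v => inner ℝ (frame (norIdx i) x) v) h
  simp only [sec, inner_sum, inner_smul_right, inner_nor_nor hx, mul_ite, mul_zero,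
    Finset.sum_ite_eq, Finset.mem_univ, if_true] at h1
  exact mul_right_cancel₀ (frameSq_norIdx_ne_zero i) h1

theorem sec_smul (c : ℝ) (a : Fin 3 → Euc 4 → ℝ) (x : Euc 4) :
    sec (fun i x => c * a i x) x = c • sec a x := by
  simp [sec, Finset.smul_sum, smul_smul]

theorem sec_sub (a b : Fin 3 → Euc 4 → ℝ) (x : Euc 4) :
    sec (fun i x => a i x - b i x) x = sec a x - sec b x := by
  simp [sec, sub_smul]

theorem smoothOff_sec {a : Fin 3 → Euc 4 → ℝ} (ha : ∀ i, SmoothOff (a i)) : SmoothOff (sec a) :=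
  ContDiffOn.sum fun β _ => (ha β).smul (contDiff_frame _).contDiffOn

/-- An eigenfield on the link, in terms of its coefficients. -/
theorem IsEigenfield.exists_coef {μ : ℝ} {Y : Euc 7 → Euc 7}
    (h : IsEigenfield sphere6 loLink μ Y) : ∃ a : Fin 3 → Euc 4 → ℝ, (∀ i, SmoothOff (a i)) ∧
      (∀ x, ‖x‖ = 1 → Y (frame 0 x) = sec a x) ∧ ∀ i x, ‖x‖ = 1 → jop a i x = -μ * a i x := by
  obtain ⟨⟨h1, h2, -⟩, h4⟩ := h
  obtain ⟨a, ha, hY⟩ := LawsonOsserman.exists_coef h1 subset_rfl (fun x hx => by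
    have := h2 _ (frame_zero_mem_link hx)
    rw [normalSpace_link hx] at this
    exact (mem_normalSpace_iff_nor hx).1 this)
  refine ⟨a, ha, hY, fun i x hx => ?_⟩
  have h5 := h4 _ (frame_zero_mem_link hx)
  rw [jacobiOp_link ha hY hx, hY x hx, ← sec_smul] at h5
  exact sec_inj hx h5 i

/-- Converse of `IsEigenfield.exists_coef`. -/
theorem isEigenfield_of_coef {μ : ℝ} {Y : Euc 7 → Euc 7} {a : Fin 3 → Euc 4 → ℝ}
    (ha : ∀ i, SmoothOff (a i)) (h0 : ∀ p ∉ loLink, Y p = 0)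
    (hY : ∀ x, ‖x‖ = 1 → Y (frame 0 x) = sec a x)
    (h : ∀ i x, ‖x‖ = 1 → jop a i x = -μ * a i x) : IsEigenfield sphere6 loLink μ Y := by
  refine ⟨⟨?_, ?_, h0⟩, ?_⟩
  · have h1 : ContDiffOn ℝ ∞ (fun p => sec a (pr p)) loLink := by
      refine (smoothOff_sec ha).comp pr.contDiff.contDiffOn fun p hp => ?_
      obtain ⟨x, hx, rfl⟩ := mem_link_iff.1 hp
      rw [pr_frame_zero]
      exact ne_zero_of_norm_one hx
    refine h1.congr fun p hp => ?_
    obtain ⟨x, hx, rfl⟩ := mem_link_iff.1 hp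
    rw [hY x hx, pr_frame_zero]
  · intro p hp
    obtain ⟨x, hx, rfl⟩ := mem_link_iff.1 hp
    rw [normalSpace_link hx, mem_normalSpace_iff_nor hx, hY x hx, nor_sec hx]
  · intro p hp
    obtain ⟨x, hx, rfl⟩ := mem_link_iff.1 hp
    rw [jacobiOp_link ha hY hx, hY x hx, ← sec_smul]
    exact Finset.sum_congr rfl fun i _ => by rw [h i x hx]

/-! ### The coefficients of translations and rotations -/

theorem D_congr {f g : Euc 4 → ℝ} (h : ∀ x, x ≠ 0 → f x = g x) (i : Fin 3) {x : Euc 4}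
    (hx : x ≠ 0) : D i f x = D i g x := by
  have : f =ᶠ[nhds x] g := by
    filter_upwards [isOpen_compl_singleton.mem_nhds hx] with y hy using h y hy
  rw [D, D, this.fderiv_eq]

theorem D_sub {f g : Euc 4 → ℝ} (hf : SmoothOff f) (hg : SmoothOff g) (i : Fin 3) {x : Euc 4}
    (hx : x ≠ 0) : D i (fun x => f x - g x) x = D i f x - D i g x := by
  have h : HasFDerivAt (fun x => f x - g x) _ x :=
    (hf.differentiableAt hx).hasFDerivAt.sub (hg.differentiableAt hx).hasFDerivAt
  rw [D, h.fderiv]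
  rfl

theorem jop_sub {a b : Fin 3 → Euc 4 → ℝ} (ha : ∀ i, SmoothOff (a i)) (hb : ∀ i, SmoothOff (b i))
    (i : Fin 3) {x : Euc 4} (hx : x ≠ 0) :
    jop (fun i x => a i x - b i x) i x = jop a i x - jop b i x := by
  have h1 : ∀ i j, D j (fun x => a i x - b i x) x = D j (a i) x - D j (b i) x :=
    fun i j => D_sub (ha i) (hb i) j hx
  have h2 : ∀ i j, D j (D j (fun x => a i x - b i x)) x
      = D j (D j (a i)) x - D j (D j (b i)) x := fun i j => by
    rw [← D_sub ((ha i).D j) ((hb i).D j) j hx]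
    exact D_congr (fun y hy => D_sub (ha i) (hb i) j hy) j hx
  fin_cases i <;> simp [jop, lap, h1, h2] <;> ring

/-- The Laplacian `lap` on a space of functions that is stable under the derivatives `d i`. -/
def lapOn {V : Type*} [AddCommGroup V] [Module ℚ V] (d : Fin 3 → V → V) (u : V) : V :=
  (3 / 8 : ℚ) • (d 0 (d 0 u) + d 1 (d 1 u)) + (9 / 4 : ℚ) • d 2 (d 2 u)

/-- The Jacobi operator `jop` on a space of functions that is stable under the derivatives. -/
def jopOn {V : Type*} [AddCommGroup V] [Module ℚ V] (d : Fin 3 → V → V) (c : Fin 3 → V) :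
    Fin 3 → V :=
  ![lapOn d (c 0) + (3 / 2 : ℚ) • (d 0 (c 1) + d 1 (c 2)) + (15 / 4 : ℚ) • c 0,
    lapOn d (c 1) - (9 / 16 : ℚ) • d 0 (c 0) + (21 / 4 : ℚ) • d 2 (c 2),
    lapOn d (c 2) - (9 / 16 : ℚ) • d 1 (c 0) - (21 / 4 : ℚ) • d 2 (c 1)]

/-- The operator `jop` is computed in any space `V` of formal functions that carries formal
derivatives compatible with the evaluation `ev`. -/
theorem jop_ev {V : Type*} [AddCommGroup V] [Module ℚ V] (d : Fin 3 → V → V)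
    (ev : V →ₗ[ℚ] (Euc 4 → ℝ)) (hd : ∀ i u, D i (ev u) = ev (d i u)) (c : Fin 3 → V) (i : Fin 3) :
    jop (fun i => ev (c i)) i = ev (jopOn d c i) := by
  funext x
  fin_cases i <;> simp [jop, jopOn, lap, lapOn, hd, Rat.smul_def] <;> ring

/-- `structConst`, as rational numbers, for which identities are decided by evaluation. -/
def structConstQ : Fin 3 → Fin 7 → Fin 7 → ℚ :=
  ![![![0, 1, 0, 0, 0, 0, 0],
      ![-8 / 3, 0, 0, 0, 2 / 3, 0, 0],
      ![0, 0, 0, -1, 0, 0, 0],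
      ![0, 0, 1 / 6, 0, 0, 0, -1 / 6],
      ![0, -5 / 4, 0, 0, 0, -3 / 4, 0],
      ![0, 0, 0, 0, 2, 0, 0],
      ![0, 0, 0, 5, 0, 0, 0]],
    ![![0, 0, 1, 0, 0, 0, 0],
      ![0, 0, 0, 1, 0, 0, 0],
      ![-8 / 3, 0, 0, 0, 2 / 3, 0, 0],
      ![0, -1 / 6, 0, 0, 0, 1 / 6, 0],
      ![0, 0, -5 / 4, 0, 0, 0, -3 / 4],
      ![0, 0, 0, -5, 0, 0, 0],
      ![0, 0, 0, 0, 2, 0, 0]],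
    ![![0, 0, 0, 1, 0, 0, 0],
      ![0, 0, -11 / 6, 0, 0, 0, -1 / 6],
      ![0, 11 / 6, 0, 0, 0, 1 / 6, 0],
      ![-4 / 9, 0, 0, 0, -2 / 9, 0, 0],
      ![0, 0, 0, 5 / 2, 0, 0, 0],
      ![0, 0, -5 / 6, 0, 0, 0, -7 / 6],
      ![0, 5 / 6, 0, 0, 0, 7 / 6, 0]]]

theorem structConst_eq (i : Fin 3) (A B : Fin 7) : structConst i A B = structConstQ i A B := by
  fin_cases i <;> fin_cases A <;> fin_cases B <;> simp [structConst, structConstQ]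

/-- Evaluation of `∑ u_A F_A` against a fixed vector `v`. -/
def vecEv (v : Euc 7) : (Fin 7 → ℚ) →ₗ[ℚ] (Euc 4 → ℝ) where
  toFun u x := ∑ A, (u A : ℝ) * inner ℝ (frame A x) v
  map_add' u w := by
    funext x
    simp [add_mul, Finset.sum_add_distrib]
  map_smul' c u := by
    funext x
    simp [Finset.mul_sum, mul_assoc, Rat.smul_def]

/-- Evaluation of `∑ u_AC ⟨F_A, T F_C⟩`, for a fixed linear map `T`. -/
def matEv (T : Euc 7 →L[ℝ] Euc 7) : (Fin 7 → Fin 7 → ℚ) →ₗ[ℚ] (Euc 4 → ℝ) where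
  toFun u x := ∑ A, ∑ C, (u A C : ℝ) * inner ℝ (frame A x) (T (frame C x))
  map_add' u w := by
    funext x
    simp [add_mul, Finset.sum_add_distrib]
  map_smul' c u := by
    funext x
    simp [Finset.mul_sum, mul_assoc, Rat.smul_def]

/-- The derivative along the `i`-th vector field, on the side of `vecEv`. -/
def vecD (i : Fin 3) (u : Fin 7 → ℚ) (B : Fin 7) : ℚ := ∑ A, u A * structConstQ i A B

/-- The derivative along the `i`-th vector field, on the side of `matEv`. -/
def matD (i : Fin 3) (u : Fin 7 → Fin 7 → ℚ) (A C : Fin 7) : ℚ :=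
  ∑ B, (u B C * structConstQ i B A + u A B * structConstQ i B C)

theorem D_vecEv (v : Euc 7) (i : Fin 3) (u : Fin 7 → ℚ) : D i (vecEv v u) = vecEv v (vecD i u) := by
  funext x
  have e : vecEv v u = fun x => ∑ A, (u A : ℝ) * inner ℝ (frame A x) v := rfl
  have h : HasFDerivAt (fun x => ∑ A, (u A : ℝ) * inner ℝ (frame A x) v) _ x :=
    HasFDerivAt.fun_sum fun A _ =>
    (((differentiable_frame A x).hasFDerivAt.inner ℝ (hasFDerivAt_const v x)).const_mul (u A : ℝ))
  rw [D, e, h.fderiv]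
  simp [sum_apply, fderiv_frame, sum_inner, inner_smul_left, vecEv, vecD, Finset.sum_mul,
    structConst_eq]
  rw [Finset.sum_comm' (t' := Finset.univ) (s' := fun _ => Finset.univ) (by simp)]
  simp [Finset.mul_sum, mul_assoc]

theorem D_matEv (T : Euc 7 →L[ℝ] Euc 7) (i : Fin 3) (u : Fin 7 → Fin 7 → ℚ) :
    D i (matEv T u) = matEv T (matD i u) := by
  funext x
  have e0 : matEv T u
    = fun x => ∑ A, ∑ C, (u A C : ℝ) * inner ℝ (frame A x) (T (frame C x)) := rfl
  have h : HasFDerivAt (fun x => ∑ A, ∑ C, (u A C : ℝ) * inner ℝ (frame A x) (T (frame C x))) _ x :=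
    HasFDerivAt.fun_sum fun A _ => HasFDerivAt.fun_sum fun C _ =>
      (((differentiable_frame A x).hasFDerivAt.inner ℝ
        (T.hasFDerivAt.comp x (differentiable_frame C x).hasFDerivAt)).const_mul (u A C : ℝ))
  rw [D, e0, h.fderiv]
  have e : ∀ A C, ((u A C : ℝ) • ((fderivInnerCLM ℝ (frame A x, T (frame C x))).comp
      ((fderiv ℝ (frame A) x).prod (T.comp (fderiv ℝ (frame C) x))))) (vf i x)
      = ∑ B, (u A C * structConst i A B * inner ℝ (frame B x) (T (frame C x))
        + u A C * structConst i C B * inner ℝ (frame A x) (T (frame B x))) := by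
    intro A C
    simp [fderiv_frame, sum_inner, inner_sum, inner_smul_left, inner_smul_right,
      Finset.sum_add_distrib, Finset.mul_sum, mul_add]
    rw [add_comm]
    simp [mul_assoc]
  simp only [sum_apply]
  refine (Finset.sum_congr rfl fun A _ => Finset.sum_congr rfl fun C _ => e A C).trans ?_
  simp only [Finset.sum_add_distrib]
  change _ = ∑ A, ∑ C, ((matD i u A C : ℚ) : ℝ) * inner ℝ (frame A x) (T (frame C x))
  simp only [matD, structConst_eq]
  push_cast
  simp only [Finset.sum_add_distrib, add_mul, Finset.sum_mul]
  congr 1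
  · rw [Finset.sum_comm]
    conv_rhs => rw [Finset.sum_comm]
    refine Finset.sum_congr rfl fun C _ => ?_
    rw [Finset.sum_comm]
  · refine Finset.sum_congr rfl fun A _ => ?_
    rw [Finset.sum_comm]

/-- The normal frame fields, divided by their squared lengths. -/
def norCoef (β : Fin 3) : Fin 7 → ℚ := ![![0, 0, 0, 0, 1 / 5, 0, 0], ![0, 0, 0, 0, 0, 3 / 40, 0],
  ![0, 0, 0, 0, 0, 0, 3 / 40]] β

theorem norCoef_eq (β : Fin 3) (A : Fin 7) :
    (norCoef β A : ℝ) = if A = norIdx β then (frameSq (norIdx β))⁻¹ else 0 := by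
  fin_cases β <;> fin_cases A <;> simp [norCoef, norIdx, frameSq]

/-- The coefficients of the normal projection of a constant vector. -/
def transCoef (v : Euc 7) (β : Fin 3) : Euc 4 → ℝ := vecEv v (norCoef β)

/-- The coefficients of the normal projection of the field `p ↦ T p`. -/
def rotCoef (T : Euc 7 →L[ℝ] Euc 7) (β : Fin 3) : Euc 4 → ℝ :=
  matEv T fun A C => if C = 0 then norCoef β A else 0

theorem transCoef_apply (v : Euc 7) (β : Fin 3) (x : Euc 4) :
    transCoef v β x = (frameSq (norIdx β))⁻¹ * inner ℝ (frame (norIdx β) x) v := by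
  simp [transCoef, vecEv, norCoef_eq]

theorem rotCoef_apply (T : Euc 7 →L[ℝ] Euc 7) (β : Fin 3) (x : Euc 4) :
    rotCoef T β x = (frameSq (norIdx β))⁻¹ * inner ℝ (frame (norIdx β) x) (T (frame 0 x)) := by
  have : ∀ A C : Fin 7, (((if C = 0 then norCoef β A else 0 : ℚ)) : ℝ)
      = if C = 0 then (if A = norIdx β then (frameSq (norIdx β))⁻¹ else 0) else 0 := fun A C => by
    split_ifs <;> simp_all [norCoef_eq]
  simp [rotCoef, matEv, this]

theorem sec_transCoef (v : Euc 7) (x : Euc 4) : sec (transCoef v) x = nor x v := by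
  simp [sec, nor, transCoef_apply]

theorem sec_rotCoef (T : Euc 7 →L[ℝ] Euc 7) (x : Euc 4) :
    sec (rotCoef T) x = nor x (T (frame 0 x)) := by
  simp [sec, nor, rotCoef_apply]

theorem smoothOff_transCoef (v : Euc 7) (β : Fin 3) : SmoothOff (transCoef v β) := by
  have : transCoef v β = fun x => (frameSq (norIdx β))⁻¹ * inner ℝ (frame (norIdx β) x) v :=
    funext fun x => transCoef_apply v β x
  rw [this]
  exact SmoothOff.of_contDiff (contDiff_const.mul ((contDiff_frame _).inner ℝ contDiff_const))

theorem smoothOff_rotCoef (T : Euc 7 →L[ℝ] Euc 7) (β : Fin 3) : SmoothOff (rotCoef T β) := by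
  have : rotCoef T β = fun x => (frameSq (norIdx β))⁻¹ *
      inner ℝ (frame (norIdx β) x) (T (frame 0 x)) := funext fun x => rotCoef_apply T β x
  rw [this]
  exact SmoothOff.of_contDiff (contDiff_const.mul
    ((contDiff_frame _).inner ℝ (T.contDiff.comp (contDiff_frame 0))))

theorem jopOn_transCoef (β : Fin 3) (B : Fin 7) :
    jopOn vecD norCoef β B = 3 * norCoef β B := by
  revert β B
  decide +kernel

/-- The Jacobi operator maps the coefficients of `⟨F_β, T F_0⟩` to a symmetric matrix, which
pairs to zero with the skew matrix `⟨F_A, T F_C⟩`. -/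
theorem jopOn_rotCoef (β : Fin 3) (A C : Fin 7) :
    jopOn matD (fun β A C => if C = 0 then norCoef β A else 0) β A C
      = jopOn matD (fun β A C => if C = 0 then norCoef β A else 0) β C A := by
  revert β A C
  decide +kernel

/-- Infinitesimal translations are eigenfields of the eigenvalue `-3`. -/
theorem jop_transCoef (v : Euc 7) (β : Fin 3) (x : Euc 4) :
    jop (transCoef v) β x = 3 * transCoef v β x := by
  have h := jop_ev vecD (vecEv v) (D_vecEv v) norCoef β
  have h2 : jopOn vecD norCoef β = (3 : ℚ) • norCoef β := funext fun B => jopOn_transCoef β B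
  rw [h2, map_smul] at h
  have := congrFun h x
  simp only [Pi.smul_apply, Rat.smul_def] at this
  exact_mod_cast this

/-- Infinitesimal rotations are Jacobi fields. -/
theorem jop_rotCoef {T : Euc 7 →L[ℝ] Euc 7} (hT : ∀ v w, inner ℝ v (T w) = -inner ℝ w (T v))
    (β : Fin 3) (x : Euc 4) : jop (rotCoef T) β x = 0 := by
  have h := jop_ev matD (matEv T) (D_matEv T) (fun β A C => if C = 0 then norCoef β A else 0) β
  have h1 := congrFun h x
  have hs := jopOn_rotCoef β
  generalize jopOn matD (fun β A C => if C = 0 then norCoef β A else 0) β = u at *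
  refine h1.trans ?_
  have h2 : matEv T u x = -matEv T u x := by
    change ∑ A, ∑ C, (u A C : ℝ) * inner ℝ (frame A x) (T (frame C x))
      = -∑ A, ∑ C, (u A C : ℝ) * inner ℝ (frame A x) (T (frame C x))
    conv_lhs => rw [Finset.sum_comm]
    rw [← Finset.sum_neg_distrib]
    refine Finset.sum_congr rfl fun A _ => ?_
    rw [← Finset.sum_neg_distrib]
    refine Finset.sum_congr rfl fun C _ => ?_
    rw [hs C A, hT]
    ring
  linarith

section

/-! ### Classification of the eigenfields -/

open MeasureTheory

/-- Orthogonal projection of a field to a finite-dimensional space of fields, in `L²`. -/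
theorem exists_perp {P : Type*} [AddCommGroup P] [Module ℝ P] [FiniteDimensional ℝ P]
    (Φ : P →ₗ[ℝ] C(S3, Euc 7)) (y : C(S3, Euc 7)) :
    ∃ p, ∀ p', ∫ s : S3, inner ℝ (Φ p' s) (y s - Φ p s) ∂sphVol = 0 := by
  let J : C(S3, Euc 7) →L[ℝ] Lp (Euc 7) 2 sphVol := ContinuousMap.toLp 2 sphVol ℝ
  let U : Submodule ℝ (Lp (Euc 7) 2 sphVol) := LinearMap.range (J.toLinearMap ∘ₗ Φ)
  have hmem : U.starProjection (J y) ∈ U := Submodule.starProjection_apply_mem _ _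
  obtain ⟨p, hp⟩ := hmem
  refine ⟨p, fun p' => ?_⟩
  have h1 : inner ℝ (J (Φ p')) (J (y - Φ p)) = 0 := by
    have h2 := Submodule.sub_starProjection_mem_orthogonal (K := U) (J y)
    rw [← hp] at h2
    have h3 := h2 (J (Φ p')) ⟨p', rfl⟩
    rw [map_sub]
    exact h3
  rw [L2.inner_def] at h1
  rw [← h1]
  refine integral_congr_ae ?_
  filter_upwards [ContinuousMap.coeFn_toLp (p := 2) sphVol (𝕜 := ℝ) (Φ p'),
    ContinuousMap.coeFn_toLp (p := 2) sphVol (𝕜 := ℝ) (y - Φ p)] with s h2 h3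
  rw [h2, h3]
  rfl

theorem inner_nor_left {x : Euc 4} (hx : ‖x‖ = 1) (v : Euc 7) (a : Fin 3 → Euc 4 → ℝ) :
    inner ℝ (nor x v) (sec a x) = inner ℝ v (sec a x) := by
  rw [← starProjection_nor hx, Submodule.inner_starProjection_left_eq_right,
    starProjection_nor hx, nor_sec hx]

theorem eq_sum_single (f : Euc 7 →L[ℝ] ℂ) (v : Euc 7) :
    f v = ∑ i, (v i : ℂ) * f (EuclideanSpace.single i 1) := by
  have h : v = ∑ i, v i • EuclideanSpace.single i (1 : ℝ) := by
    ext j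
    simp [Finset.sum_apply, Pi.single_apply]
  conv_lhs => rw [h]
  simp [map_sum]

variable {a : Fin 3 → Euc 4 → ℝ}

theorem smoothOff_sub {b : Fin 3 → Euc 4 → ℝ} (ha : ∀ i, SmoothOff (a i))
    (hb : ∀ i, SmoothOff (b i)) (i : Fin 3) : SmoothOff (fun x => a i x - b i x) :=
  ContDiffOn.sub (ha i) (hb i)

/-- The eigenfields of the eigenvalue `-3` are the infinitesimal translations. -/
theorem exists_translation (ha : ∀ i, SmoothOff (a i))
    (h : ∀ i x, ‖x‖ = 1 → jop a i x = 3 * a i x) :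
    ∃ v : Euc 7, ∀ x, ‖x‖ = 1 → sec a x = nor x v := by
  let Φ : Euc 7 →ₗ[ℝ] C(S3, Euc 7) :=
    { toFun := fun v => ⟨fun s => sec (transCoef v) s,
        (smoothOff_sec (smoothOff_transCoef v)).continuous_restrict⟩
      map_add' := fun v w => by ext1 s; simp [sec_transCoef, nor_add]
      map_smul' := fun c v => by ext1 s; simp [sec_transCoef, nor_smul] }
  obtain ⟨v, hv⟩ := exists_perp Φ ⟨fun s => sec a s, (smoothOff_sec ha).continuous_restrict⟩
  have hb := smoothOff_sub ha (smoothOff_transCoef v)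
  have hv' : ∀ w : Euc 7, ∫ s : S3, inner ℝ w
      (sec (fun i x => a i x - transCoef v i x) s) ∂sphVol = 0 := by
    intro w
    rw [← hv w]
    refine integral_congr_ae (Filter.Eventually.of_forall fun s => ?_)
    change _ = inner ℝ (sec (transCoef w) s) (sec a s - sec (transCoef v) s)
    simp only
    rw [← sec_sub, sec_transCoef, inner_nor_left s.norm_eq]
  refine ⟨v, fun x hx => ?_⟩
  have hz := fun i => eq_zero_of_perp (ν := 3) hb (by norm_num) (fun i x hx => by
    rw [jop_sub ha (smoothOff_transCoef v) i (ne_zero_of_norm_one hx), h i x hx, jop_transCoef]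
    ring) (fun h => by norm_num at h) (fun _ f => by
      have e : ∀ s : S3, f (sec (fun i x => a i x - transCoef v i x) s)
          = ∑ i, f (EuclideanSpace.single i 1) * ((inner ℝ (EuclideanSpace.single i (1 : ℝ))
            (sec (fun i x => a i x - transCoef v i x) s) : ℝ) : ℂ) := fun s => by
        rw [eq_sum_single f]
        simp [EuclideanSpace.inner_single_left, mul_comm]
      simp only [e]
      rw [integral_finsetSum]
      · refine Finset.sum_eq_zero fun i _ => ?_
        rw [integral_const_mul, integral_complex_ofReal, hv']
        simp
      · intro i _
        refine (integrable_of_continuous ?_).const_mul _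
        exact Complex.continuous_ofReal.comp
          (continuous_const.inner (smoothOff_sec hb).continuous_restrict))
    (fun h => by norm_num at h) hx i
  rw [← sec_transCoef, ← sub_eq_zero, ← sec_sub]
  simp [sec, hz]

/-- The action of a matrix on the Euclidean space `ℝ⁷`. -/
def matCLM (T : Matrix (Fin 7) (Fin 7) ℝ) : Euc 7 →L[ℝ] Euc 7 :=
  LinearMap.toContinuousLinearMap (Matrix.toEuclideanLin T)

theorem matCLM_apply (T : Matrix (Fin 7) (Fin 7) ℝ) (v : Euc 7) :
    matCLM T v = WithLp.toLp 2 (T *ᵥ v.ofLp) := rfl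

theorem inner_matCLM (T : Matrix (Fin 7) (Fin 7) ℝ) (v w : Euc 7) :
    inner ℝ v (matCLM T w) = ∑ i, ∑ j, v i * T i j * w j := by
  simp [PiLp.inner_apply, matCLM_apply, Matrix.mulVec, dotProduct, Finset.sum_mul]
  refine Finset.sum_congr rfl fun i _ => Finset.sum_congr rfl fun j _ => by ring

theorem mem_so_iff {T : Matrix (Fin 7) (Fin 7) ℝ} :
    T ∈ LieAlgebra.Orthogonal.so (Fin 7) ℝ ↔ ∀ i j, T i j = -T j i := by
  rw [LieAlgebra.Orthogonal.mem_so, ← Matrix.ext_iff]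
  constructor
  · intro h i j
    have := h j i
    simpa using this
  · intro h i j
    simpa using h j i

theorem inner_matCLM_of_mem_so {T : Matrix (Fin 7) (Fin 7) ℝ}
    (hT : T ∈ LieAlgebra.Orthogonal.so (Fin 7) ℝ) (v w : Euc 7) :
    inner ℝ v (matCLM T w) = -inner ℝ w (matCLM T v) := by
  rw [mem_so_iff] at hT
  rw [inner_matCLM, inner_matCLM, Finset.sum_comm, ← Finset.sum_neg_distrib]
  refine Finset.sum_congr rfl fun i _ => ?_
  rw [← Finset.sum_neg_distrib]
  refine Finset.sum_congr rfl fun j _ => ?_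
  rw [hT i j]
  ring

theorem sub_transpose_mem_so (M : Matrix (Fin 7) (Fin 7) ℝ) :
    M - M.transpose ∈ LieAlgebra.Orthogonal.so (Fin 7) ℝ :=
  mem_so_iff.2 fun i j => by simp

/-- The Jacobi fields on the link are the infinitesimal rotations. -/
theorem exists_rotation (ha : ∀ i, SmoothOff (a i)) (h : ∀ i x, ‖x‖ = 1 → jop a i x = 0) :
    ∃ T ∈ LieAlgebra.Orthogonal.so (Fin 7) ℝ, ∀ x, ‖x‖ = 1 →
      sec a x = nor x (matCLM T (frame 0 x)) := by
  let Φ : Matrix (Fin 7) (Fin 7) ℝ →ₗ[ℝ] C(S3, Euc 7) :=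
    { toFun := fun M => ⟨fun s => sec (rotCoef (matCLM (M - M.transpose))) s,
        (smoothOff_sec (smoothOff_rotCoef _)).continuous_restrict⟩
      map_add' := fun v w => by
        ext1 s
        simp only [sec_rotCoef, ContinuousMap.coe_mk, ContinuousMap.add_apply, ← nor_add]
        congr 1
        rw [matCLM, Matrix.transpose_add, add_sub_add_comm, map_add, map_add]
        rfl
      map_smul' := fun c v => by
        ext1 s
        simp only [sec_rotCoef, ContinuousMap.coe_mk, ContinuousMap.smul_apply, RingHom.id_apply,
          ← nor_smul]
        congr 1
        rw [matCLM, Matrix.transpose_smul, ← smul_sub, map_smul, map_smul]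
        rfl }
  obtain ⟨M, hM⟩ := exists_perp Φ ⟨fun s => sec a s, (smoothOff_sec ha).continuous_restrict⟩
  set T := M - M.transpose with hTdef
  have hT : T ∈ LieAlgebra.Orthogonal.so (Fin 7) ℝ := sub_transpose_mem_so M
  have hb := smoothOff_sub ha (smoothOff_rotCoef (matCLM T))
  have hM' : ∀ i j, ∫ s : S3, (frame 0 s j * sec (fun i x => a i x - rotCoef (matCLM T) i x) s i
      - frame 0 s i * sec (fun i x => a i x - rotCoef (matCLM T) i x) s j) ∂sphVol = 0 := by
    intro i j
    rw [← hM (Matrix.single i j 1)]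
    refine integral_congr_ae (Filter.Eventually.of_forall fun s => ?_)
    change _ = inner ℝ (sec (rotCoef (matCLM (Matrix.single i j 1 - (Matrix.single i j 1).transpose)))
      s) (sec a s - sec (rotCoef (matCLM T)) s)
    simp only
    rw [← sec_sub, sec_rotCoef, inner_nor_left s.norm_eq, real_inner_comm, inner_matCLM]
    simp [Matrix.single_apply, Finset.sum_sub_distrib, mul_sub, sub_mul, ite_and]
    ring
  refine ⟨T, hT, fun x hx => ?_⟩
  have hz := fun i => eq_zero_of_perp (ν := 0) hb le_rfl (fun i x hx => by
    rw [jop_sub ha (smoothOff_rotCoef _) i (ne_zero_of_norm_one hx), h i x hx,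
      jop_rotCoef (inner_matCLM_of_mem_so hT)]
    ring) (fun h => by norm_num at h) (fun h => by norm_num at h) (fun _ f g => by
      have e : ∀ s : S3, f (frame 0 s) * g (sec (fun i x => a i x - rotCoef (matCLM T) i x) s)
          - g (frame 0 s) * f (sec (fun i x => a i x - rotCoef (matCLM T) i x) s)
          = ∑ i, ∑ j, (g (EuclideanSpace.single i 1) * f (EuclideanSpace.single j 1)) *
          (((frame 0 s j * sec (fun i x => a i x - rotCoef (matCLM T) i x) s i
      - frame 0 s i * sec (fun i x => a i x - rotCoef (matCLM T) i x) s j) : ℝ) : ℂ) := fun s => by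
        rw [eq_sum_single f (frame 0 s), eq_sum_single g (frame 0 s), eq_sum_single f (sec _ _),
          eq_sum_single g (sec _ _), Finset.sum_mul_sum, Finset.sum_mul_sum, Finset.sum_comm,
          ← Finset.sum_sub_distrib]
        refine Finset.sum_congr rfl fun i _ => ?_
        rw [← Finset.sum_sub_distrib]
        refine Finset.sum_congr rfl fun j _ => ?_
        push_cast
        ring
      have hc : ∀ i j, Continuous fun s : S3 =>
          (((frame 0 s j * sec (fun i x => a i x - rotCoef (matCLM T) i x) s i
          - frame 0 s i * sec (fun i x => a i x - rotCoef (matCLM T) i x) s j) : ℝ) : ℂ) := by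
        intro i j
        have h1 := (smoothOff_sec hb).continuous_restrict
        have h2 := (SmoothOff.of_contDiff (contDiff_frame 0)).continuous_restrict
        fun_prop
      simp only [e]
      rw [integral_finsetSum]
      · refine Finset.sum_eq_zero fun i _ => ?_
        rw [integral_finsetSum]
        · refine Finset.sum_eq_zero fun j _ => ?_
          rw [integral_const_mul, integral_complex_ofReal, hM']
          simp
        · exact fun j _ => (integrable_of_continuous (hc i j)).const_mul _
      · exact fun i _ => integrable_finsetSum _ fun j _ =>
          (integrable_of_continuous (hc i j)).const_mul _) hx i
  rw [← sec_rotCoef, ← sub_eq_zero, ← sec_sub]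
  simp [sec, hz]

/-- The coefficients of the field `frame 4`, which is a multiple of `e₄`. -/
def axisCoef (c : ℝ) : Fin 3 → Euc 4 → ℝ := ![fun _ => c, fun _ => 0, fun _ => 0]

theorem smoothOff_axisCoef (c : ℝ) (i : Fin 3) : SmoothOff (axisCoef c i) := by
  fin_cases i <;> exact SmoothOff.of_contDiff contDiff_const

theorem sec_axisCoef (c : ℝ) (x : Euc 4) : sec (axisCoef c) x = c • frame 4 x := by
  simp [sec_eq, axisCoef]

theorem jop_axisCoef (c : ℝ) (i : Fin 3) (x : Euc 4) :
    jop (axisCoef c) i x = 15 / 4 * axisCoef c i x := by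
  have hD : ∀ (c : ℝ) i, D i (fun _ : Euc 4 => c) = fun _ => 0 := fun c i => by
    funext x; simp [D]
  fin_cases i <;> simp [jop, lap, axisCoef, hD]

/-- The eigenfields of the eigenvalue `-15/4` are the multiples of `e₄`. -/
theorem exists_axis (ha : ∀ i, SmoothOff (a i))
    (h : ∀ i x, ‖x‖ = 1 → jop a i x = 15 / 4 * a i x) :
    ∃ c : ℝ, ∀ x, ‖x‖ = 1 → sec a x = c • frame 4 x := by
  let Φ : ℝ →ₗ[ℝ] C(S3, Euc 7) :=
    { toFun := fun c => ⟨fun s => sec (axisCoef c) s,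
        (smoothOff_sec (smoothOff_axisCoef c)).continuous_restrict⟩
      map_add' := fun v w => by ext1 s; simp [sec_axisCoef, add_smul]
      map_smul' := fun c v => by ext1 s; simp [sec_axisCoef, mul_smul] }
  obtain ⟨c, hc⟩ := exists_perp Φ ⟨fun s => sec a s, (smoothOff_sec ha).continuous_restrict⟩
  have hb := smoothOff_sub ha (smoothOff_axisCoef c)
  refine ⟨c, fun x hx => ?_⟩
  have hz := fun i => eq_zero_of_perp (ν := 15 / 4) hb (by norm_num) (fun i x hx => by
    rw [jop_sub ha (smoothOff_axisCoef c) i (ne_zero_of_norm_one hx), h i x hx, jop_axisCoef]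
    ring) (fun _ => by
      have h1 := hc 1
      have e : ∀ s : S3, inner ℝ (sec (axisCoef 1) s) (sec a s - sec (axisCoef c) s)
          = 5 * (a 0 s - axisCoef c 0 s) := fun s => by
        rw [← sec_sub, sec_axisCoef, one_smul, sec]
        simp only [inner_sum, inner_smul_right, inner_frame s.norm_eq]
        simp [Fin.sum_univ_three, norIdx, frameSq]
        ring
      have h2 : ∫ s : S3, 5 * (a 0 s - axisCoef c 0 s) ∂sphVol = 0 := by
        rw [← h1]
        exact integral_congr_ae (Filter.Eventually.of_forall fun s => (e s).symm)
      rw [integral_const_mul] at h2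
      have h3 := (mul_eq_zero.1 h2).resolve_left (by norm_num)
      simp only [cx]
      rw [integral_complex_ofReal, h3]
      simp) (fun h => by norm_num at h) (fun h => by norm_num at h) hx i
  rw [← sec_axisCoef, ← sub_eq_zero, ← sec_sub]
  simp [sec, hz]

end

/-! ### Independence of translations and rotations -/

theorem inner_frame_of_nor_eq_zero {x : Euc 4} (hx : ‖x‖ = 1) {v : Euc 7} (h : nor x v = 0)
    (β : Fin 3) : inner ℝ (frame (norIdx β) x) v = 0 := by
  rw [← inner_zero_right (𝕜 := ℝ) (frame (norIdx β) x), ← h, nor]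
  simp only [inner_sum, inner_smul_right, inner_nor_nor hx, mul_ite, mul_zero,
    Finset.sum_ite_eq, Finset.mem_univ, if_true]
  have := frameSq_norIdx_ne_zero β
  field_simp

theorem norm_euc_four (a b c d : ℝ) (h : a ^ 2 + b ^ 2 + c ^ 2 + d ^ 2 = 1) :
    ‖(!₂[a, b, c, d] : Euc 4)‖ = 1 := by
  rw [EuclideanSpace.norm_eq]
  simp [Fin.sum_univ_four, h]

theorem inner_frame_four_join (x : Euc 4) (v : Euc 7) : inner ℝ (frame 4 x) v
    = 5 / 3 * (x 0 * v 0 + x 1 * v 1 + x 2 * v 2 + x 3 * v 3)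
      - 2 * √5 / 3 * ((x 0 ^ 2 + x 1 ^ 2 - x 2 ^ 2 - x 3 ^ 2) * v 4
        + 2 * (x 0 * x 2 + x 1 * x 3) * v 5 + 2 * (x 1 * x 2 - x 0 * x 3) * v 6) := by
  simp [frame, join_apply, frameLin, hopfPol_apply, PiLp.inner_apply, Fin.sum_univ_succ]
  ring

/-- The field `e₄` and the infinitesimal translations are linearly independent. -/
theorem axis_translation_injective {c : ℝ} {v : Euc 7}
    (h : ∀ x, ‖x‖ = 1 → c • frame 4 x + nor x v = 0) : c = 0 ∧ v = 0 := by
  have h5 : √5 ≠ 0 := (Real.sqrt_pos.2 (by norm_num)).ne'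
  have key : ∀ a b d e : ℝ, a ^ 2 + b ^ 2 + d ^ 2 + e ^ 2 = 1 →
      5 * c + (5 / 3 * (a * v 0 + b * v 1 + d * v 2 + e * v 3)
      - 2 * √5 / 3 * ((a ^ 2 + b ^ 2 - d ^ 2 - e ^ 2) * v 4
        + 2 * (a * d + b * e) * v 5 + 2 * (b * d - a * e) * v 6)) = 0 := by
    intro a b d e hx
    have hx := norm_euc_four a b d e hx
    have h1 := congrArg (fun w => nor !₂[a, b, d, e] w) (h _ hx)
    have h2 : frame 4 !₂[a, b, d, e] = sec (axisCoef 1) !₂[a, b, d, e] := by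
      rw [sec_axisCoef, one_smul]
    have h3 : c • frame 4 !₂[a, b, d, e] + nor !₂[a, b, d, e] v
        = nor !₂[a, b, d, e] (c • frame 4 !₂[a, b, d, e] + v) := by
      rw [nor_add, nor_smul, h2, nor_sec hx]
    have h4 := inner_frame_of_nor_eq_zero hx (h3 ▸ h _ hx) 0
    have h6 : norIdx 0 = 4 := rfl
    rw [h6, inner_add_right, inner_smul_right, inner_frame hx, inner_frame_four_join] at h4
    simp [frameSq] at h4
    linarith
  have k1 := key 1 0 0 0 (by norm_num)
  have k2 := key (-1) 0 0 0 (by norm_num)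
  have k3 := key 0 1 0 0 (by norm_num)
  have k4 := key 0 (-1) 0 0 (by norm_num)
  have k5 := key 0 0 1 0 (by norm_num)
  have k6 := key 0 0 (-1) 0 (by norm_num)
  have k7 := key 0 0 0 1 (by norm_num)
  have k8 := key 0 0 0 (-1) (by norm_num)
  have k9 := key (3 / 5) 0 (4 / 5) 0 (by norm_num)
  have k10 := key 0 (3 / 5) (4 / 5) 0 (by norm_num)
  ring_nf at k1 k2 k3 k4 k5 k6 k7 k8 k9 k10
  have hc : c = 0 := by linarith
  have v4 : √5 * v 4 = 0 := by linarith
  have v0 : v 0 = 0 := by linarith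
  have v1 : v 1 = 0 := by linarith
  have v2 : v 2 = 0 := by linarith
  have v3 : v 3 = 0 := by linarith
  have v5 : √5 * v 5 = 0 := by linarith
  have v6 : √5 * v 6 = 0 := by linarith
  refine ⟨hc, ?_⟩
  ext i
  fin_cases i
  · exact v0
  · exact v1
  · exact v2
  · exact v3
  · exact (mul_eq_zero.1 v4).resolve_left h5
  · exact (mul_eq_zero.1 v5).resolve_left h5
  · exact (mul_eq_zero.1 v6).resolve_left h5

/-- Infinitesimal rotations of `ℝ⁷` that span a complement of the symmetry algebra of the link, of
dimension `21 - 4`. The factors `√5` make the action on `join (u, w)` rational. -/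
def rotMat (t : Fin 17 → ℝ) : Matrix (Fin 7) (Fin 7) ℝ :=
  !![0, t 0, t 1, t 2, √5 * t 5, √5 * t 6, √5 * t 7;
    -t 0, 0, t 3, t 4, √5 * t 8, √5 * t 9, √5 * t 10;
    -t 1, -t 3, 0, 0, √5 * t 11, √5 * t 12, √5 * t 13;
    -t 2, -t 4, 0, 0, √5 * t 14, √5 * t 15, √5 * t 16;
    -(√5 * t 5), -(√5 * t 8), -(√5 * t 11), -(√5 * t 14), 0, 0, 0;
    -(√5 * t 6), -(√5 * t 9), -(√5 * t 12), -(√5 * t 15), 0, 0, 0;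
    -(√5 * t 7), -(√5 * t 10), -(√5 * t 13), -(√5 * t 16), 0, 0, 0]

/-- The Lie algebra of `U(2)`, which acts on `ℝ⁷ = ℂ² × ℝ³` by symmetries of the link. -/
def symMat (a b c d : ℝ) : Matrix (Fin 7) (Fin 7) ℝ :=
  !![0, -(a + d), -b, -c, 0, 0, 0;
    a + d, 0, c, -b, 0, 0, 0;
    b, -c, 0, a - d, 0, 0, 0;
    c, b, d - a, 0, 0, 0, 0;
    0, 0, 0, 0, 0, -2 * b, 2 * c;
    0, 0, 0, 0, 2 * b, 0, -2 * a;
    0, 0, 0, 0, -2 * c, 2 * a, 0]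

theorem rotMat_mem_so (t : Fin 17 → ℝ) : rotMat t ∈ LieAlgebra.Orthogonal.so (Fin 7) ℝ := by
  rw [mem_so_iff]
  intro i j
  fin_cases i <;> fin_cases j <;> simp [rotMat]

theorem symMat_mem_so (a b c d : ℝ) : symMat a b c d ∈ LieAlgebra.Orthogonal.so (Fin 7) ℝ := by
  rw [mem_so_iff]
  intro i j
  fin_cases i <;> fin_cases j <;> simp [symMat]

/-- The symmetry algebra and its complement span `so(7)`. -/
theorem exists_rotMat {T : Matrix (Fin 7) (Fin 7) ℝ} (hT : T ∈ LieAlgebra.Orthogonal.so (Fin 7) ℝ) :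
    ∃ t a b c d, T = rotMat t + symMat a b c d := by
  rw [mem_so_iff] at hT
  have h5 : √5 ≠ 0 := (Real.sqrt_pos.2 (by norm_num)).ne'
  have hd : ∀ i, T i i = 0 := fun i => by linarith [hT i i]
  have hm : ∀ r : ℝ, √5 * (r / √5) = r := fun r => by field_simp
  -- the symmetry is read off from the entries of `T` that vanish in `rotMat`
  obtain ⟨t, ht⟩ : ∃ t, t = ![T 0 1 + (-(T 5 6) - T 2 3), T 0 2 - T 4 5 / 2,
    T 0 3 + T 4 6 / 2, T 1 2 - T 4 6 / 2, T 1 3 - T 4 5 / 2, T 0 4 / √5, T 0 5 / √5, T 0 6 / √5,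
    T 1 4 / √5, T 1 5 / √5, T 1 6 / √5,
    T 2 4 / √5, T 2 5 / √5, T 2 6 / √5, T 3 4 / √5, T 3 5 / √5, T 3 6 / √5] :=
    ⟨_, rfl⟩
  refine ⟨t, -(T 5 6) / 2, -(T 4 5) / 2, T 4 6 / 2, -(T 5 6) / 2 - T 2 3, ?_⟩
  have hup : ∀ i j, i < j → T i j = (rotMat t
      + symMat (-(T 5 6) / 2) (-(T 4 5) / 2) (T 4 6 / 2) (-(T 5 6) / 2 - T 2 3)) i j := by
    intro i j hij
    fin_cases i <;> fin_cases j <;> first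
      | exact absurd hij (by decide)
      | (simp [ht, rotMat, symMat, hm]; try ring)
  ext i j
  rcases lt_trichotomy i j with hij | rfl | hij
  · exact hup i j hij
  · rw [hd]
    fin_cases i <;> simp [rotMat, symMat]
  · rw [hT i j, hup j i hij, Matrix.add_apply, Matrix.add_apply,
      mem_so_iff.1 (rotMat_mem_so _) i j, mem_so_iff.1 (symMat_mem_so _ _ _ _) i j]
    ring

/-- A vector tangent to the orbits of the parametrization is tangent to the link. -/
theorem nor_join_tangent {x u : Euc 4} (hx : ‖x‖ = 1) (hu : inner ℝ x u = 0) :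
    nor x (join ((2 / 3 : ℝ) • u, (2 / 3 : ℝ) • hopfPol x u)) = 0 := by
  have h := eq_sum_vf hx u
  rw [hu, zero_smul, zero_add] at h
  have e : join ((2 / 3 : ℝ) • u, (2 / 3 : ℝ) • hopfPol x u)
      = ∑ i, inner ℝ (vf i x) u • frame (linkIdx i) x := by
    have hL : ∀ i, frame (linkIdx i) x
        = join ((2 / 3 : ℝ) • vf i x, (2 / 3 : ℝ) • hopfPol x (vf i x)) := fun i => by
      fin_cases i <;> simp [linkIdx, frame, frameLin]
    have hs : ∀ (c : ℝ) p, c • join p = join (c • p) := fun c p => (map_smul join c p).symm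
    have hadd : ∀ p p', join p + join p' = join (p + p') := fun p p' => (map_add join p p').symm
    simp only [hL, Fin.sum_univ_three, hs, hadd, Prod.smul_mk, Prod.mk_add_mk]
    rw [Fin.sum_univ_three] at h
    refine congrArg join (Prod.ext ?_ ?_)
    · conv_lhs => rw [h]
      module
    · conv_lhs => rw [h]
      simp only [map_add, map_smul]
      module
  rw [e]
  simp only [Fin.sum_univ_three, nor_add, nor_smul, nor_frame_link hx, smul_zero, add_zero]

/-- Symmetries of the link give trivial Jacobi fields. -/
theorem nor_symMat (a b c d : ℝ) {x : Euc 4} (hx : ‖x‖ = 1) :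
    nor x (matCLM (symMat a b c d) (frame 0 x)) = 0 := by
  set u : Euc 4 := !₂[-(a + d) * x 1 - b * x 2 - c * x 3, (a + d) * x 0 - b * x 3 + c * x 2,
    b * x 0 - c * x 1 + (a - d) * x 3, b * x 1 + c * x 0 + (d - a) * x 2] with hu
  have e : matCLM (symMat a b c d) (frame 0 x)
      = join ((2 / 3 : ℝ) • u, (2 / 3 : ℝ) • hopfPol x u) := by
    ext i
    fin_cases i <;> simp [matCLM_apply, symMat, frame, join_apply, frameLin,
      hopfPol_apply, hu] <;> ring
  rw [e]
  refine nor_join_tangent hx ?_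
  rw [inner_euc_four, hu]
  simp
  ring

theorem matCLM_rotMat_join (t : Fin 17 → ℝ) (u : Euc 4) (w : Euc 3) :
    matCLM (rotMat t) (join (u, w)) = join
      (!₂[t 0 * u 1 + t 1 * u 2 + t 2 * u 3 + 5 * (t 5 * w 0 + t 6 * w 1 + t 7 * w 2),
        -t 0 * u 0 + t 3 * u 2 + t 4 * u 3 + 5 * (t 8 * w 0 + t 9 * w 1 + t 10 * w 2),
        -t 1 * u 0 - t 3 * u 1 + 5 * (t 11 * w 0 + t 12 * w 1 + t 13 * w 2),
        -t 2 * u 0 - t 4 * u 1 + 5 * (t 14 * w 0 + t 15 * w 1 + t 16 * w 2)],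
      !₂[-(t 5 * u 0 + t 8 * u 1 + t 11 * u 2 + t 14 * u 3),
        -(t 6 * u 0 + t 9 * u 1 + t 12 * u 2 + t 15 * u 3),
        -(t 7 * u 0 + t 10 * u 1 + t 13 * u 2 + t 16 * u 3)]) := by
  have h5 : √5 * √5 = 5 := Real.mul_self_sqrt (by norm_num)
  ext i
  fin_cases i <;> simp [matCLM_apply, rotMat, join_apply]
  · linear_combination (t 5 * w 0 + t 6 * w 1 + t 7 * w 2) * h5
  · linear_combination (t 8 * w 0 + t 9 * w 1 + t 10 * w 2) * h5
  · linear_combination (t 11 * w 0 + t 12 * w 1 + t 13 * w 2) * h5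
  · linear_combination (t 14 * w 0 + t 15 * w 1 + t 16 * w 2) * h5
  · ring
  · ring
  · ring

/-- Distinct elements of the complement of the symmetry algebra give distinct Jacobi fields. -/
theorem rotMat_injective {t : Fin 17 → ℝ}
    (h : ∀ x, ‖x‖ = 1 → nor x (matCLM (rotMat t) (frame 0 x)) = 0) : t = 0 := by
  have key : ∀ a b d e : ℝ, a ^ 2 + b ^ 2 + d ^ 2 + e ^ 2 = 1 → ∀ β, inner ℝ
      (frame (norIdx β) !₂[a, b, d, e]) (matCLM (rotMat t) (frame 0 !₂[a, b, d, e])) = 0 :=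
    fun a b d e hx β => inner_frame_of_nor_eq_zero (norm_euc_four a b d e hx)
      (h _ (norm_euc_four a b d e hx)) β
  -- seven points of the sphere separate the parameters
  have k1 := key 1 0 0 0 (by norm_num)
  have k2 := key (-1) 0 0 0 (by norm_num)
  have k3 := key 0 1 0 0 (by norm_num)
  have k4 := key 0 (-1) 0 0 (by norm_num)
  have k5 := key 0 0 1 0 (by norm_num)
  have k6 := key 0 0 0 1 (by norm_num)
  have k7 := key (3 / 5) 0 (4 / 5) 0 (by norm_num)
  rw [Fin.forall_fin_succ, Fin.forall_fin_two] at k1 k2 k3 k4 k5 k6 k7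
  simp only [norIdx, frame, frameLin, matCLM_rotMat_join, inner_join, inner_euc_four,
    inner_euc_three, hopfPol_apply] at k1 k2 k3 k4 k5 k6 k7
  simp [vf_apply] at k1 k2 k3 k4 k5 k6 k7
  obtain ⟨k11, k12, k13⟩ := k1
  obtain ⟨k21, k22, k23⟩ := k2
  obtain ⟨k31, k32, k33⟩ := k3
  obtain ⟨k41, k42, k43⟩ := k4
  obtain ⟨k51, k52, k53⟩ := k5
  obtain ⟨k61, k62, k63⟩ := k6
  obtain ⟨k71, k72, k73⟩ := k7
  have h5 : t 5 = 0 := by linarith only [k11]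
  have h8 : t 8 = 0 := by linarith only [k31]
  have h11 : t 11 = 0 := by linarith only [k51]
  have h14 : t 14 = 0 := by linarith only [k61]
  simp only [h5, h8, h11, h14] at k12 k13 k22 k23 k32 k33 k42 k43 k52 k53 k62 k63 k71 k72 k73
  have h1 : t 1 = 0 := by linarith only [k12, k22]
  have h6 : t 6 = 0 := by linarith only [k12, k22]
  have h2 : t 2 = 0 := by linarith only [k13, k23]
  have h7 : t 7 = 0 := by linarith only [k13, k23]
  have h4 : t 4 = 0 := by linarith only [k32, k42]
  have h9 : t 9 = 0 := by linarith only [k32, k42]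
  have h3 : t 3 = 0 := by linarith only [k33, k43]
  have h10 : t 10 = 0 := by linarith only [k33, k43]
  have h12 : t 12 = 0 := by linarith only [k52, h1]
  have h13 : t 13 = 0 := by linarith only [k53, h3]
  have h15 : t 15 = 0 := by linarith only [k62, h4]
  have h16 : t 16 = 0 := by linarith only [k63, h2]
  have h0 : t 0 = 0 := by linarith only [k73, h2, h3, h7, h9, h13, h15]
  funext i
  fin_cases i <;> assumption

/-! ### Spaces of fields and their dimensions -/

/-- The normal projections of the fields `p ↦ L p`, for a linear family of maps `L`. -/
def fieldMap {P : Type*} [AddCommGroup P] [Module ℝ P] (L : P →ₗ[ℝ] (Euc 7 → Euc 7)) :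
    P →ₗ[ℝ] (Euc 7 → Euc 7) where
  toFun u := loLink.indicator fun p => norProj sphere6 loLink p (L u p)
  map_add' u w := by
    funext p
    by_cases hp : p ∈ loLink <;> simp [hp]
  map_smul' c u := by
    funext p
    by_cases hp : p ∈ loLink <;> simp [hp]

/-- Constant vector fields. -/
def constFields : Euc 7 →ₗ[ℝ] (Euc 7 → Euc 7) where
  toFun v _ := v
  map_add' _ _ := rfl
  map_smul' _ _ := rfl

/-- Infinitesimal rotations in a complement of the symmetry algebra. -/
def rotFields : (Fin 17 → ℝ) →ₗ[ℝ] (Euc 7 → Euc 7) where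
  toFun t p := matCLM (rotMat t) p
  map_add' t u := by
    funext p
    have : rotMat (t + u) = rotMat t + rotMat u := by
      ext i j
      fin_cases i <;> fin_cases j <;> simp [rotMat] <;> ring
    simp only [this, matCLM_apply, Matrix.add_mulVec, Pi.add_apply]
    rfl
  map_smul' c t := by
    funext p
    have : rotMat (c • t) = c • rotMat t := by
      ext i j
      fin_cases i <;> fin_cases j <;> simp [rotMat] <;> ring
    simp only [this, matCLM_apply, Matrix.smul_mulVec, Pi.smul_apply]
    rfl

theorem indicator_frame_zero (F : Euc 7 → Euc 7) {x : Euc 4} (hx : ‖x‖ = 1) :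
    loLink.indicator (fun p => norProj sphere6 loLink p (F p)) (frame 0 x)
      = nor x (F (frame 0 x)) := by
  rw [Set.indicator_of_mem (frame_zero_mem_link hx), norProj_link hx]

/-- A field on the link is determined by its values along the parametrization. -/
theorem eq_indicator {Y F : Euc 7 → Euc 7} (h0 : ∀ p ∉ loLink, Y p = 0)
    (h : ∀ x, ‖x‖ = 1 → Y (frame 0 x) = nor x (F (frame 0 x))) :
    Y = loLink.indicator fun p => norProj sphere6 loLink p (F p) := by
  funext p
  by_cases hp : p ∈ loLink
  · obtain ⟨x, hx, rfl⟩ := mem_link_iff.1 hp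
    rw [indicator_frame_zero F hx, h x hx]
  · rw [h0 p hp, Set.indicator_of_notMem hp]

theorem translationFields_eq : translationFields sphere6 loLink
    = (LinearMap.range (fieldMap constFields) : Set (Euc 7 → Euc 7)) := by
  ext Y
  exact ⟨fun ⟨v, hv⟩ => ⟨v, hv.symm⟩, fun ⟨v, hv⟩ => ⟨v, hv.symm⟩⟩

theorem rotationFields_eq : rotationFields sphere6 loLink
    = (LinearMap.range (fieldMap rotFields) : Set (Euc 7 → Euc 7)) := by
  ext Y
  constructor
  · rintro ⟨T, hT, rfl⟩
    obtain ⟨t, a, b, c, d, rfl⟩ := exists_rotMat hT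
    have hmul : ∀ p : Euc 7, matCLM (rotMat t + symMat a b c d) p
        = matCLM (rotMat t) p + matCLM (symMat a b c d) p := fun p => by
      simp only [matCLM_apply, Matrix.add_mulVec]
      rfl
    refine ⟨t, eq_indicator (Y := fieldMap rotFields t)
      (F := matCLM (rotMat t + symMat a b c d))
      (fun p hp => (Set.indicator_of_notMem hp _ : loLink.indicator
        (fun p => norProj sphere6 loLink p (rotFields t p)) p = 0)) fun x hx => ?_⟩
    have hL : fieldMap rotFields t (frame 0 x) = nor x (matCLM (rotMat t) (frame 0 x)) :=
      indicator_frame_zero (fun p => matCLM (rotMat t) p) hx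
    rw [hL, hmul, nor_add, nor_symMat a b c d hx, add_zero]
  · rintro ⟨t, rfl⟩
    exact ⟨rotMat t, rotMat_mem_so t, rfl⟩

theorem fieldMap_constFields_injective : Function.Injective (fieldMap constFields) := by
  rw [injective_iff_map_eq_zero]
  intro v hv
  refine (axis_translation_injective (c := 0) fun x hx => ?_).2
  have := congrFun hv (frame 0 x)
  rw [zero_smul, zero_add]
  rwa [← indicator_frame_zero (fun _ => v) hx]

theorem fieldMap_rotFields_injective : Function.Injective (fieldMap rotFields) := by
  rw [injective_iff_map_eq_zero]
  intro t ht
  refine rotMat_injective fun x hx => ?_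
  have := congrFun ht (frame 0 x)
  rwa [← indicator_frame_zero (fun p => matCLM (rotMat t) p) hx]

/-! ### The eigenspaces -/

theorem isEigenfield_three_iff (Y : Euc 7 → Euc 7) :
    IsEigenfield sphere6 loLink (-3) Y ↔ Y ∈ translationFields sphere6 loLink := by
  constructor
  · intro h
    obtain ⟨a, ha, hY, hj⟩ := h.exists_coef
    obtain ⟨v, hv⟩ := exists_translation ha (by simpa using hj)
    exact ⟨v, eq_indicator (F := fun _ => v) h.1.2.2 fun x hx => by rw [hY x hx, hv x hx]⟩
  · rintro ⟨v, rfl⟩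
    refine isEigenfield_of_coef (smoothOff_transCoef v)
      (fun p hp => Set.indicator_of_notMem hp _) (fun x hx => ?_) fun i x _ => by
        rw [jop_transCoef]; ring
    rw [indicator_frame_zero (fun _ => v) hx, sec_transCoef]

theorem isEigenfield_zero_iff (Y : Euc 7 → Euc 7) :
    IsEigenfield sphere6 loLink 0 Y ↔ Y ∈ rotationFields sphere6 loLink := by
  constructor
  · intro h
    obtain ⟨a, ha, hY, hj⟩ := h.exists_coef
    obtain ⟨T, hT, hv⟩ := exists_rotation ha (by simpa using hj)
    exact ⟨T, hT, eq_indicator (F := matCLM T) h.1.2.2 fun x hx => by rw [hY x hx, hv x hx]⟩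
  · rintro ⟨T, hT, rfl⟩
    refine isEigenfield_of_coef (smoothOff_rotCoef (matCLM T))
      (fun p hp => Set.indicator_of_notMem hp _) (fun x hx => ?_) fun i x _ => by
        rw [jop_rotCoef (inner_matCLM_of_mem_so hT)]; ring
    rw [indicator_frame_zero (fun p => WithLp.toLp 2 (T *ᵥ p.ofLp)) hx, sec_rotCoef]
    rfl

theorem isJacobiField_iff (Y : Euc 7 → Euc 7) :
    IsJacobiField sphere6 loLink Y ↔ Y ∈ rotationFields sphere6 loLink := by
  rw [← isEigenfield_zero_iff, IsJacobiField, IsEigenfield]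
  simp

theorem e4_frame_zero {x : Euc 4} (hx : ‖x‖ = 1) : e4 (frame 0 x) = (√5)⁻¹ • frame 4 x := by
  have h5 : √5 ^ 2 = 5 := Real.sq_sqrt (by norm_num)
  have h0 : √5 ≠ 0 := (Real.sqrt_pos.2 (by norm_num)).ne'
  rw [e4, Set.indicator_of_mem (frame_zero_mem_link hx)]
  ext i
  fin_cases i <;> simp [frame, frameLin, join_apply, hopfPol_apply, Complex.sq_norm,
    Complex.normSq_mk] <;> field_simp
  all_goals first | rw [h5, mul_comm] | ring

theorem isEigenfield_axis_iff (Y : Euc 7 → Euc 7) :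
    IsEigenfield sphere6 loLink (-(15 / 4)) Y ↔ ∃ c : ℝ, Y = c • e4 := by
  have h0 : √5 ≠ 0 := (Real.sqrt_pos.2 (by norm_num)).ne'
  constructor
  · intro h
    obtain ⟨a, ha, hY, hj⟩ := h.exists_coef
    obtain ⟨c, hc⟩ := exists_axis ha (by simpa using hj)
    refine ⟨c * √5, funext fun p => ?_⟩
    by_cases hp : p ∈ loLink
    · obtain ⟨x, hx, rfl⟩ := mem_link_iff.1 hp
      rw [hY x hx, hc x hx, Pi.smul_apply, e4_frame_zero hx, smul_smul, mul_assoc,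
        mul_inv_cancel₀ h0, mul_one]
    · rw [h.1.2.2 p hp, Pi.smul_apply, e4, Set.indicator_of_notMem hp, smul_zero]
  · rintro ⟨c, rfl⟩
    refine isEigenfield_of_coef (smoothOff_axisCoef (c * (√5)⁻¹))
      (fun p hp => by rw [Pi.smul_apply, e4, Set.indicator_of_notMem hp, smul_zero])
      (fun x hx => ?_) fun i x _ => by rw [jop_axisCoef]; ring
    rw [Pi.smul_apply, e4_frame_zero hx, sec_axisCoef, smul_smul]

theorem eq_zero_of_isEigenfield {μ : ℝ} (hμ : μ ≤ 0) (h1 : μ ≠ -(15 / 4)) (h2 : μ ≠ -3)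
    (h3 : μ ≠ 0) {Y : Euc 7 → Euc 7} (h : IsEigenfield sphere6 loLink μ Y) : Y = 0 := by
  obtain ⟨a, ha, hY, hj⟩ := h.exists_coef
  funext p
  by_cases hp : p ∈ loLink
  · obtain ⟨x, hx, rfl⟩ := mem_link_iff.1 hp
    have hz := eq_zero_of_perp (ν := -μ) ha (by linarith) hj
      (fun h => absurd (by linarith) h1) (fun h => absurd (by linarith) h2)
      (fun h => absurd (by linarith) h3) hx
    rw [hY x hx]
    simp [sec, hz]
  · exact h.1.2.2 p hp

theorem e4_ne_zero : e4 ≠ 0 := by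
  intro h
  have h0 : √5 ≠ 0 := (Real.sqrt_pos.2 (by norm_num)).ne'
  have h1 := (axis_translation_injective (c := (√5)⁻¹) (v := 0) fun x hx => by
    rw [nor_zero, add_zero, ← e4_frame_zero hx, h]; rfl).1
  exact inv_ne_zero h0 h1

/-! ### Multiplicities, index, and the cone -/

theorem finrank_span_eq_of_range {P : Type*} [AddCommGroup P] [Module ℝ P] [FiniteDimensional ℝ P]
    {f : P →ₗ[ℝ] (Euc 7 → Euc 7)} (hf : Function.Injective f) {s : Set (Euc 7 → Euc 7)}
    (hs : s = (LinearMap.range f : Set (Euc 7 → Euc 7))) :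
    Module.finrank ℝ (Submodule.span ℝ s) = Module.finrank ℝ P := by
  rw [hs, Submodule.span_eq, LinearMap.finrank_range_of_inj hf]

theorem jacobiMultiplicity_axis : jacobiMultiplicity sphere6 loLink (-(15 / 4)) = 1 := by
  have h : {Y | IsEigenfield sphere6 loLink (-(15 / 4)) Y}
      = (Submodule.span ℝ {e4} : Set (Euc 7 → Euc 7)) := by
    ext Y
    rw [Set.mem_ofPred_eq, isEigenfield_axis_iff, SetLike.mem_coe, Submodule.mem_span_singleton]
    exact exists_congr fun c => eq_comm
  rw [jacobiMultiplicity, h, Submodule.span_eq, finrank_span_singleton e4_ne_zero]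

theorem jacobiMultiplicity_three : jacobiMultiplicity sphere6 loLink (-3) = 7 := by
  rw [jacobiMultiplicity, finrank_span_eq_of_range fieldMap_constFields_injective]
  · simp
  · rw [← translationFields_eq]
    exact Set.ext isEigenfield_three_iff

theorem jacobiMultiplicity_zero : jacobiMultiplicity sphere6 loLink 0 = 17 := by
  rw [jacobiMultiplicity, finrank_span_eq_of_range fieldMap_rotFields_injective]
  · simp
  · rw [← rotationFields_eq]
    exact Set.ext isEigenfield_zero_iff

theorem nullity_link : nullity sphere6 loLink = 17 := by
  have h : {Y | IsJacobiField sphere6 loLink Y} = {Y | IsEigenfield sphere6 loLink 0 Y} :=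
    Set.ext fun Y => (isJacobiField_iff Y).trans (isEigenfield_zero_iff Y).symm
  rw [nullity, h]
  exact jacobiMultiplicity_zero

/-- A nonzero multiplicity exhibits an eigenvalue. -/
theorem isEigenvalue_of_multiplicity {μ : ℝ} (h : jacobiMultiplicity sphere6 loLink μ ≠ 0) :
    IsEigenvalue sphere6 loLink μ := by
  by_contra hc
  apply h
  have : Submodule.span ℝ {Y | IsEigenfield sphere6 loLink μ Y} = ⊥ := by
    rw [Submodule.span_eq_bot]
    intro Y hY
    by_contra h0
    exact hc ⟨Y, hY, h0⟩
  rw [jacobiMultiplicity, this, finrank_bot]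

theorem isEigenvalue_iff {μ : ℝ} (hμ : μ ≤ 0) :
    IsEigenvalue sphere6 loLink μ ↔ μ = -(15 / 4) ∨ μ = -3 ∨ μ = 0 := by
  constructor
  · rintro ⟨Y, hY, h0⟩
    by_contra! hc
    exact h0 (eq_zero_of_isEigenfield hμ hc.1 hc.2.1 hc.2.2 hY)
  · rintro (rfl | rfl | rfl) <;> apply isEigenvalue_of_multiplicity
    · rw [jacobiMultiplicity_axis]; norm_num
    · rw [jacobiMultiplicity_three]; norm_num
    · rw [jacobiMultiplicity_zero]; norm_num

/-- The sum of the eigenspaces of negative eigenvalues is parametrized by `ℝ × ℝ⁷`: multiples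
of `e₄` and infinitesimal translations. -/
theorem morseIndex_link : morseIndex sphere6 loLink = 8 := by
  let f : (ℝ × Euc 7) →ₗ[ℝ] (Euc 7 → Euc 7) :=
    LinearMap.coprod (LinearMap.toSpanSingleton ℝ _ e4) (fieldMap constFields)
  have hf : Function.Injective f := by
    rw [injective_iff_map_eq_zero]
    rintro ⟨c, v⟩ h
    have h0 : √5 ≠ 0 := (Real.sqrt_pos.2 (by norm_num)).ne'
    have h1 := axis_translation_injective (c := c * (√5)⁻¹) (v := v) fun x hx => by
      have := congrFun h (frame 0 x)
      rw [mul_smul, ← e4_frame_zero hx, ← indicator_frame_zero (fun _ => v) hx]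
      simpa [f, fieldMap, constFields] using this
    ext1
    · exact (mul_eq_zero.1 h1.1).resolve_right (inv_ne_zero h0)
    · exact h1.2
  have hs : Submodule.span ℝ {Y | ∃ μ < 0, IsEigenfield sphere6 loLink μ Y}
      = LinearMap.range f := by
    apply le_antisymm
    · refine Submodule.span_le.2 ?_
      rintro Y ⟨μ, hμ, hY⟩
      by_cases h1 : μ = -(15 / 4)
      · subst h1
        obtain ⟨c, rfl⟩ := (isEigenfield_axis_iff Y).1 hY
        exact ⟨(c, 0), by simp [f]⟩
      · by_cases h2 : μ = -3
        · subst h2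
          have h3 := (isEigenfield_three_iff Y).1 hY
          rw [translationFields_eq] at h3
          obtain ⟨v, rfl⟩ := h3
          exact ⟨(0, v), by simp [f]⟩
        · rw [eq_zero_of_isEigenfield hμ.le h1 h2 hμ.ne hY]
          exact Submodule.zero_mem _
    · rintro _ ⟨⟨c, v⟩, rfl⟩
      refine Submodule.add_mem _ (Submodule.subset_span ⟨-(15 / 4), by norm_num, ?_⟩)
        (Submodule.subset_span ⟨-3, by norm_num, ?_⟩)
      · exact (isEigenfield_axis_iff _).2 ⟨c, rfl⟩
      · rw [isEigenfield_three_iff, translationFields_eq]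
        exact ⟨v, rfl⟩
  rw [morseIndex, hs, LinearMap.finrank_range_of_inj hf]
  simp

/-- A Jacobi field on the cone, homogeneous of degree `k`, restricts to an eigenfield of the Jacobi
operator of the link, of the eigenvalue `k (k - 1) + 3 k - 3`. For `k = 1` this is a Jacobi field,
and for `k = 0` it is an eigenfield of the eigenvalue `-3`. -/
theorem exists_coef_of_isHomogeneousField {Z : Euc 7 → Euc 7} {k : ℕ}
    (hZ : IsJacobiField Set.univ (loCone \ {0}) Z) (hk : IsHomogeneousField loCone k Z) :
    ∃ a : Fin 3 → Euc 4 → ℝ, (∀ i, SmoothOff (a i)) ∧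
      (∀ t : ℝ, 0 < t → ∀ x, ‖x‖ = 1 → Z (t • frame 0 x) = t ^ k • sec a x) ∧
      ∀ i x, ‖x‖ = 1 → jop a i x = -(k * (k - 1) + 3 * k - 3) * a i x := by
  obtain ⟨⟨h1, h2, -⟩, h4⟩ := hZ
  have hmem : ∀ x : Euc 4, ‖x‖ = 1 → frame 0 x ∈ loCone \ {0} := fun x hx => by
    simpa using smul_frame_zero_mem_cone hx one_pos
  obtain ⟨a, ha, hY⟩ := exists_coef h1 (fun p hp => by
    obtain ⟨x, hx, rfl⟩ := mem_link_iff.1 hp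
    exact hmem x hx) (fun x hx => by
    have := h2 _ (hmem x hx)
    have h5 := normalSpace_cone hx one_pos
    rw [one_smul] at h5
    rw [h5] at this
    exact (mem_normalSpace_iff_nor hx).1 this)
  have hh : ∀ t : ℝ, 0 < t → ∀ x, ‖x‖ = 1 → Z (t • frame 0 x) = t ^ k • sec a x :=
    fun t ht x hx => by rw [hk _ (hmem x hx) t ht, hY x hx]
  refine ⟨a, ha, hh, fun i x hx => ?_⟩
  have h5 := h4 _ (hmem x hx)
  rw [jacobiOp_cone (k : ℤ) ha (by simpa using hh) hx, ← sec_smul] at h5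
  have h6 : sec (jop a) x
      = sec (fun i x => -(k * (k - 1) + 3 * k - 3 : ℝ) * a i x) x := by
    rw [sec_smul] at h5 ⊢
    push_cast at h5
    rw [neg_smul]
    exact eq_neg_of_add_eq_zero_left h5
  exact sec_inj hx h6 i

theorem isIntegrableCone_loCone : IsIntegrableCone loCone := by
  intro Z hZ
  have h0 := hZ.1.2.2
  constructor
  · intro hk
    obtain ⟨a, ha, hh, hj⟩ := exists_coef_of_isHomogeneousField hZ hk
    obtain ⟨T, hT, hv⟩ := exists_rotation ha (fun i x hx => by rw [hj i x hx]; norm_num)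
    refine ⟨T, hT, funext fun p => ?_⟩
    by_cases hp : p ∈ loCone \ {0}
    · rw [Set.indicator_of_mem hp]
      obtain ⟨t, ht, x, hx, rfl⟩ := mem_cone_iff.1 hp
      rw [hh t ht x hx, hv x hx, norProj_cone hx ht, ← matCLM_apply, map_smul, nor_smul, pow_one]
    · rw [Set.indicator_of_notMem hp, h0 p hp]
  · intro hk
    obtain ⟨a, ha, hh, hj⟩ := exists_coef_of_isHomogeneousField hZ hk
    obtain ⟨v, hv⟩ := exists_translation ha (fun i x hx => by rw [hj i x hx]; norm_num)
    refine ⟨v, funext fun p => ?_⟩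
    by_cases hp : p ∈ loCone \ {0}
    · rw [Set.indicator_of_mem hp]
      obtain ⟨t, ht, x, hx, rfl⟩ := mem_cone_iff.1 hp
      rw [hh t ht x hx, hv x hx, norProj_cone hx ht, pow_zero, one_smul]
    · rw [Set.indicator_of_notMem hp, h0 p hp]

end LawsonOsserman

end

theorem theorem1p1 :
    -- the Jacobi fields of the link are exactly the Killing Jacobi fields
    (∀ Y : Euc 7 → Euc 7,
      IsJacobiField sphere6 loLink Y ↔ Y ∈ rotationFields sphere6 loLink) ∧
    -- the cone is integrable
    IsIntegrableCone loCone ∧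
    -- the nonpositive eigenvalues
    (∀ μ : ℝ, μ ≤ 0 →
      (IsEigenvalue sphere6 loLink μ ↔ μ = -(15 / 4) ∨ μ = -3 ∨ μ = 0)) ∧
    -- their multiplicities
    jacobiMultiplicity sphere6 loLink (-(15 / 4)) = 1 ∧
    jacobiMultiplicity sphere6 loLink (-3) = 7 ∧
    jacobiMultiplicity sphere6 loLink 0 = 17 ∧
    -- the eigenspaces of the first and of the second eigenvalue
    (∀ Y : Euc 7 → Euc 7,
      IsEigenfield sphere6 loLink (-(15 / 4)) Y ↔ ∃ c : ℝ, Y = c • e4) ∧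
    (∀ Y : Euc 7 → Euc 7,
      IsEigenfield sphere6 loLink (-3) Y ↔ Y ∈ translationFields sphere6 loLink) ∧
    -- Morse index and nullity
    morseIndex sphere6 loLink = 8 ∧
    nullity sphere6 loLink = 17 :=
  ⟨isJacobiField_iff, isIntegrableCone_loCone, fun _ hμ => isEigenvalue_iff hμ,
    jacobiMultiplicity_axis, jacobiMultiplicity_three, jacobiMultiplicity_zero,
    isEigenfield_axis_iff, isEigenfield_three_iff, morseIndex_link, nullity_link⟩
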